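/- Let $p\neq 2$ be a prime, $\mathbb F$ an algebraic closure of $\mathbb F_p$, and $n\ge 1$. Let $\tilde J_{2n}=\begin{pmatrix}0&\tilde I_n\\-\tilde I_n&0\end{pmatrix}$ with $\tilde I_n=\mathrm{antidiag}(1,\dots,1)$. Let $F/\mathbb Q$ be a totally real number field with $p\mathcal O_F=\mathcal P^e$ for a single prime $\mathcal P$. Put $F_{\mathcal P}=F\otimes\mathbb Q_p$ and $\mathcal O=\mathcal O_F\otimes\mathbb Z_p$. Fix a uniformizer $\pi$ of $\mathcal O_F\otimes\mathbb Z_{(p)}$ and a generator $\delta$ of the inverse different of $\mathcal O$ over $\mathbb Z_p$. Let $V=F^{2n}$ with standard basis $(e'_j)$, let $(\cdot,\cdot)'$ be the form with matrix $\tilde J_{2n}$, and $(\cdot,\cdot)=\mathrm{tr}_{F/\mathbb Q}\circ(\cdot,\cdot)'$. Put $e_j=e'_j$ and $e_{n+j}=\delta e'_{n+j}$ for $1\le j\le n$. For $0\le i<2n$ and $k\in\mathbb Z$ let $\omega_{2nk+i}=((-1)^{(i)},0^{(2n-i)})-(k,\dots,k)\in\mathbb Z^{2n}$, where $a^{(m)}$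 means $a$ repeated $m$ times. For $i\in\mathbb Z$ let $\Lambda_i\subset V\otimes\mathbb Q_p$ be the $\mathcal O$-lattice with basis $(\pi^{\omega_i(j)}e_j)_j$. The $\Lambda_i$, with the inclusions $\rho_i:\Lambda_i\to\Lambda_{i+1}$, the maps $\vartheta_i=\pi\cdot:\Lambda_{2n+i}\to\Lambda_i$ and the pairings $(\cdot,\cdot)_i:\Lambda_i\times\Lambda_{-i}\to\mathbb Z_p$ induced by $(\cdot,\cdot)$, form a polarized chain $\mathcal L$. Write $\Lambda_{i,\mathbb F}=\Lambda_i\otimes_{\mathbb Z_p}\mathbb F$. Let $M^{\rm loc}(\mathbb F)$ be the set of families $(t_i)_{i\in\mathbb Z}$ of $\mathcal O_F\otimes\mathbb F$-submodules $t_i\subset\Lambda_{i,\mathbb F}$ such that for all $i$: $\rho_i(t_i)\subset t_{i+1}$; $\Lambda_{i,\mathbb F}/t_i$ is finite locally free over $\mathbb F$; $\det_{\Lambda_{i,\mathbb F}/t_i}=\det_{V_{-i}}\otimes\mathbb F$ as polynomial functions on $\mathcal O_F\otimes\mathbb F$, where $V_{-i}$ (here $i=\sqrt{-1}$) is the $(-\sqrt{-1})$-eigenspace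 in $V\otimes\mathbb C$ of the endomorphism with matrix $-\tilde J_{2n}$, whose determinant function is defined over $\mathbb Z$; $t_i$ and $t_{-i}$ pair to zero; $\vartheta_i(t_{2n+i})=t_i$. Let $\mathrm{Aut}(\mathcal L)(\mathbb F)$ be the group of families of $\mathcal O_F\otimes\mathbb F$-linear automorphisms of the $\Lambda_{i,\mathbb F}$ commuting with all $\rho_i$ and $\vartheta_i$ and preserving all pairings $(\cdot,\cdot)_i$; it acts on $M^{\rm loc}(\mathbb F)$. Let $\mathfrak S$ be the set of embeddings $\mathcal O_F/\mathcal P\hookrightarrow\mathbb F$. There is a unique isomorphism of $\mathbb F$-algebras $\mathcal O_F\otimes\mathbb F\cong\prod_{\sigma\in\mathfrak S}\mathbb F[u]/(u^e)$ that sends $\pi$ to $u$ in every factor and whose $\sigma$-component is $a\mapsto\sigma(a\bmod\mathcal P)$ modulo $u$ for $a\in\mathcal O_F$. Through it and the bases above, $\Lambda_{i,\mathbb F}=\prod_\sigma(\mathbb F[u]/u^e)^{2n}$ and $t_i=\prod_\sigma t_{i,\sigma}$. Let $\mathrm{GSp}=\mathrm{GSp}_{2n}$ be the group of similitudes of $\tilde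 J_{2n}$, let $\tilde\Lambda_i\subset\mathbb F((u))^{2n}$ be the $\mathbb F[[u]]$-lattice with basis $(u^{\omega_i(j)}e_j)_j$ ($(e_j)$ now being the standard basis of $\mathbb F((u))^{2n}$), and let $I=I_{\mathrm{GSp}}(\mathbb F)\subset\mathrm{GSp}(\mathbb F((u)))$ be the stabilizer of the chain $(\tilde\Lambda_i)_i$. Let $\alpha_i:\tilde\Lambda_i\to(\mathbb F[u]/u^e)^{2n}$ be reduction of coordinates modulo $u^e$. For every $t\in M^{\rm loc}(\mathbb F)$ and $\sigma\in\mathfrak S$ there is a unique coset $\tilde\alpha_\sigma(t)=gI\in\mathrm{GSp}(\mathbb F((u)))/I$ with $g\tilde\Lambda_i=\alpha_i^{-1}(t_{i,\sigma})$ for all $i$. Let $\tilde\alpha=(\tilde\alpha_\sigma)_\sigma$. **Theorem.** (1) For every $t\in M^{\rm loc}(\mathbb F)$, $\tilde\alpha$ restricts to a bijection $$\mathrm{Aut}(\mathcal L)(\mathbb F)\cdot t\ \xrightarrow{\sim}\ \prod_{\sigma\in\mathfrak S}I\cdot\tilde\alpha_\sigma(t).$$ (2) Consequently $\tilde\alpha$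 induces an injection $$\iota:\mathrm{Aut}(\mathcal L)(\mathbb F)\backslash M^{\rm loc}(\mathbb F)\hookrightarrow\prod_{\sigma\in\mathfrak S}I\backslash\mathrm{GSp}(\mathbb F((u)))/I.$$ (3) Let $T\subset\mathrm{GSp}$ be the diagonal torus, $N$ its normalizer and $\widetilde W=N(\mathbb F((u)))/T(\mathbb F[[u]])$. An extended alcove is a family $(x_i)_{i=0}^{2n-1}$ in $\mathbb Z^{2n}$ such that, after extension to $i\in\mathbb Z$ by $x_{i+2n}=x_i-(1,\dots,1)$, each $x_i-x_{i+1}$ is a standard basis vector and there is $c\in\mathbb Z$ with $x_i(j)+x_{-i}(2n+1-j)=c$ for all $i,j$. The rule that $w\in\widetilde W$ corresponds to $(x_i)$ if $w\tilde\Lambda_i$ has basis $(u^{x_i(j)}e_j)_j$ for all $i$ is a bijection between $\widetilde W$ and the set of extended alcoves. Let $\mathrm{Perm}\subset\widetilde W$ be the set of permissible extended alcoves, i.e. those with $\omega_i(j)\le x_i(j)\le\omega_i(j)+e$ for all $j$ and $\sum_jx_i(j)=ne-i$, for $0\le i<2n$. Then $(x_\sigma)_\sigma\mapsto(Ix_\sigma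 I)_\sigma$ restricts to a bijection from $\prod_{\sigma\in\mathfrak S}\mathrm{Perm}$ onto the image of $\iota$; thus $\prod_\sigma\mathrm{Perm}$ is a set of representatives of $\mathrm{Aut}(\mathcal L)(\mathbb F)\backslash M^{\rm loc}(\mathbb F)$. -/

import Mathlib

open scoped TensorProduct NumberField LaurentSeries PowerSeries Polynomial

noncomputable section

namespace SymplecticLocalModel

/-! ### Linear algebra conventions

Indices `1, …, 2n` of the text are the elements `0, …, 2n - 1` of `Fin (2 * n)`. -/

/-- The matrix `J̃_{2n}` with blocks `0, Ĩ_n, -Ĩ_n, 0`, where `Ĩ_n = antidiag(1, …, 1)`. -/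
def Jmat (n : ℕ) (R : Type*) [CommRing R] : Matrix (Fin (2 * n)) (Fin (2 * n)) R :=
  Matrix.of fun a b =>
    if (a : ℕ) + (b : ℕ) + 1 = 2 * n then (if (a : ℕ) < n then 1 else -1) else 0

/-- The vectors `ω_i` (`i ∈ ℤ`): `ω_i = ((-1)^{(i)}, 0^{(2n - i)})` for `0 ≤ i < 2n`, and
`ω_{2nk + i} = ω_i - (k, …, k)`. -/
def omega (n : ℕ) (i : ℤ) (j : Fin (2 * n)) : ℤ :=
  -(i / ((2 * n : ℕ) : ℤ)) - (if ((j : ℕ) : ℤ) < i % ((2 * n : ℕ) : ℤ) then 1 else 0)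

/-! ### The field `F ⊗ ℚ_p`, its integers, and the choices made at `p` -/

section Lattices

variable (p : ℕ) [Fact p.Prime] (F : Type*) [Field F] [NumberField F]

/-- `F_𝒫 = F ⊗ ℚ_p`. -/
abbrev Kp : Type _ := ℚ_[p] ⊗[ℚ] F

/-- The inclusion `F → F ⊗ ℚ_p`. -/
def inclF : F →ₐ[ℚ] Kp p F := Algebra.TensorProduct.includeRight

/-- `𝒪_F ⊗ ℤ_p`, as the `ℤ_p`-subalgebra of `F ⊗ ℚ_p` generated by `𝒪_F`. -/
def Op : Subalgebra ℤ_[p] (Kp p F) :=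
  Algebra.adjoin ℤ_[p] (Set.range fun a : 𝓞 F => inclF p F (a : F))

/-- The image of `a ∈ 𝒪_F` in `𝒪_F ⊗ ℤ_p`. -/
def inclO (a : 𝓞 F) : Op p F := ⟨inclF p F (a : F), Algebra.subset_adjoin ⟨a, rfl⟩⟩

/-- The local situation at `p` together with the choices of `π` and `δ`. -/
structure LocalDatum where
  /-- the unique prime of `𝒪_F` over `p` -/
  P : Ideal (𝓞 F)
  isPrime : P.IsPrime
  /-- the ramification index -/
  e : ℕ
  span_p : Ideal.span {(p : 𝓞 F)} = P ^ e
  /-- a uniformizer of the discrete valuation ring `𝒪_F ⊗ ℤ_(p) = {a / s | a ∈ 𝒪_F, p ∤ s ∈ ℤ}` -/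
  unif : F
  unif_spec : ∃ a : 𝓞 F, a ∈ P ∧ a ∉ P ^ 2 ∧ ∃ s : ℤ, ¬ (p : ℤ) ∣ s ∧ (s : F) * unif = (a : F)
  /-- a generator of the inverse different `{x ∈ F_𝒫 | tr(x 𝒪) ⊆ ℤ_p}` -/
  delta : Kp p F
  delta_spec : ∀ x : Kp p F,
    (∀ y ∈ Op p F, ‖Algebra.trace ℚ_[p] (Kp p F) (x * y)‖ ≤ 1) ↔ ∃ y ∈ Op p F, x = y * delta

variable {p F}

theorem unif_ne_zero (D : LocalDatum p F) : D.unif ≠ 0 := by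
  intro h
  obtain ⟨a, _, ha2, s, _, hs⟩ := D.unif_spec
  rw [h, mul_zero] at hs
  have : a = 0 := by exact_mod_cast hs.symm
  exact ha2 (this ▸ Ideal.zero_mem _)

theorem unif_mem (D : LocalDatum p F) : inclF p F D.unif ∈ Op p F := by
  obtain ⟨a, _, _, s, hps, hs⟩ := D.unif_spec
  have hu : IsUnit (s : ℤ_[p]) := by
    rw [PadicInt.isUnit_iff]
    refine le_antisymm (PadicInt.norm_le_one _) (not_lt.1 fun h => hps ?_)
    exact (PadicInt.norm_int_lt_one_iff_dvd s).1 h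
  obtain ⟨v, hv⟩ := hu
  have h1 : inclF p F D.unif = ((v⁻¹ : ℤ_[p]ˣ) : ℤ_[p]) • inclF p F (a : F) := by
    have h2 : inclF p F (a : F) = (v : ℤ_[p]) • inclF p F D.unif := by
      rw [← hs, map_mul, hv, Algebra.smul_def]
      simp
    rw [h2, smul_smul]
    simp
  rw [h1]
  exact Subalgebra.smul_mem _ (inclO p F a).2 _

/-- The uniformizer as an element of `𝒪_F ⊗ ℤ_p`. -/
def unifO (D : LocalDatum p F) : Op p F := ⟨inclF p F D.unif, unif_mem D⟩

/-- The basis vector number `j` of `𝔈_i`: it is `π^{ω_i(j)} e_j`, where `e_j = e'_j` for the first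
`n` indices and `e_j = δ e'_j` for the last `n` ones, `(e'_j)` being the standard basis. -/
def frameVec (D : LocalDatum p F) (n : ℕ) (i : ℤ) (j : Fin (2 * n)) : Fin (2 * n) → Kp p F :=
  Pi.single j (inclF p F (D.unif ^ omega n i j) * (if (j : ℕ) < n then 1 else D.delta))

/-- The lattice `Λ_i` in `V ⊗ ℚ_p = (F ⊗ ℚ_p)^{2n}`: the `𝒪_F ⊗ ℤ_p`-module spanned by `𝔈_i`. -/
def Lam (D : LocalDatum p F) (n : ℕ) (i : ℤ) : Submodule (Op p F) (Fin (2 * n) → Kp p F) :=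
  Submodule.span (Op p F) (Set.range (frameVec D n i))

instance instModuleOp (D : LocalDatum p F) (n : ℕ) (i : ℤ) : Module (Op p F) (Lam D n i) :=
  Submodule.module _

instance instSMulOp (D : LocalDatum p F) (n : ℕ) (i : ℤ) : SMul (Op p F) (Lam D n i) :=
  (instModuleOp D n i).toSMul

instance instModuleZp (D : LocalDatum p F) (n : ℕ) (i : ℤ) : Module ℤ_[p] (Lam D n i) :=
  Submodule.module' _

instance instTower (D : LocalDatum p F) (n : ℕ) (i : ℤ) :
    IsScalarTower ℤ_[p] (Op p F) (Lam D n i) :=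
  Submodule.isScalarTower _

instance instComm (D : LocalDatum p F) (n : ℕ) (i : ℤ) :
    SMulCommClass (Op p F) ℤ_[p] (Lam D n i) :=
  IsScalarTower.to_smulCommClass'

instance instTowerZp (D : LocalDatum p F) (n : ℕ) (i : ℤ) :
    IsScalarTower ℤ_[p] ℤ_[p] (Lam D n i) :=
  IsScalarTower.left _

/-- The `ℚ_p`-bilinear form `tr ∘ (·,·)'` on `V ⊗ ℚ_p`, where `(·,·)'` has matrix `J̃_{2n}` in the
basis `(e'_j)`. -/
def form (p : ℕ) [Fact p.Prime] (F : Type*) [Field F] [NumberField F] (n : ℕ)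
    (x y : Fin (2 * n) → Kp p F) : ℚ_[p] :=
  Algebra.trace ℚ_[p] (Kp p F) (x ⬝ᵥ (Jmat n (Kp p F)).mulVec y)

theorem omega_anti {n : ℕ} (i : ℤ) (j : Fin (2 * n)) : omega n (i + 1) j ≤ omega n i j := by
  have hj := j.2
  unfold omega
  generalize hN : ((2 * n : ℕ) : ℤ) = N
  have hN0 : 0 < N := by omega
  have h1 := Int.emod_add_mul_ediv i N
  have h2 := Int.emod_add_mul_ediv (i + 1) N
  have h3 := Int.emod_nonneg i hN0.ne'
  have h4 := Int.emod_lt_of_pos i hN0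
  have h5 := Int.emod_nonneg (i + 1) hN0.ne'
  have h6 := Int.emod_lt_of_pos (i + 1) hN0
  have hle : i / N ≤ (i + 1) / N := Int.ediv_le_ediv hN0 (by omega)
  rcases hle.eq_or_lt with h | h
  · rw [← h] at h2 ⊢
    split_ifs <;> omega
  · split_ifs <;> omega

theorem omega_add {n : ℕ} (i : ℤ) (j : Fin (2 * n)) :
    omega n ((2 * n : ℕ) + i) j = omega n i j - 1 := by
  have hj := j.2
  have hN0 : ((2 * n : ℕ) : ℤ) ≠ 0 := by omega
  unfold omega
  rw [Int.add_emod_left, Int.add_ediv_of_dvd_left (dvd_refl _), Int.ediv_self hN0]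
  ring

theorem omega_neg {n : ℕ} (i : ℤ) (j k : Fin (2 * n)) (h : (j : ℕ) + (k : ℕ) + 1 = 2 * n) :
    omega n i j + omega n (-i) k = 0 := by
  have hj := j.2
  unfold omega
  generalize hN : ((2 * n : ℕ) : ℤ) = N
  have hN0 : 0 < N := by omega
  have h1 := Int.emod_add_mul_ediv i N
  have h3 := Int.emod_nonneg i hN0.ne'
  have h4 := Int.emod_lt_of_pos i hN0
  have h2 := Int.emod_add_mul_ediv (-i) N
  have h5 := Int.emod_nonneg (-i) hN0.ne'
  have h6 := Int.emod_lt_of_pos (-i) hN0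
  set q := i / N
  set q' := (-i) / N
  set r := i % N
  set r' := (-i) % N
  have h7 : r + r' = N * (-(q + q')) := by linarith
  have h8 : -(q + q') = 0 ∨ -(q + q') = 1 := by
    have ha : 0 ≤ -(q + q') := by
      by_contra hc
      nlinarith
    have hb : -(q + q') < 2 := by
      by_contra hc
      nlinarith
    omega
  rcases h8 with h8 | h8
  · rw [h8] at h7
    split_ifs <;> omega
  · rw [h8] at h7
    split_ifs <;> omega

theorem unif_zpow_mem (D : LocalDatum p F) {m : ℤ} (hm : 0 ≤ m) :
    inclF p F (D.unif ^ m) ∈ Op p F := by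
  obtain ⟨k, rfl⟩ := Int.eq_ofNat_of_zero_le hm
  simpa using Subalgebra.pow_mem _ (unif_mem D) k

theorem frameVec_eq_smul (D : LocalDatum p F) (n : ℕ) (i i' : ℤ) (j : Fin (2 * n))
    (h : 0 ≤ omega n i j - omega n i' j) :
    frameVec D n i j =
      (⟨_, unif_zpow_mem D h⟩ : Op p F) • frameVec D n i' j := by
  unfold frameVec
  rw [← Pi.single_smul]
  congr 1
  change _ = inclF p F _ * _
  rw [← mul_assoc, ← map_mul, ← zpow_add₀ (unif_ne_zero D), sub_add_cancel]

theorem Lam_le_succ (D : LocalDatum p F) (n : ℕ) (i : ℤ) : Lam D n i ≤ Lam D n (i + 1) := by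
  refine Submodule.span_le.2 ?_
  rintro _ ⟨j, rfl⟩
  rw [frameVec_eq_smul D n i (i + 1) j (sub_nonneg.2 (omega_anti i j))]
  exact Submodule.smul_mem _ _ (Submodule.subset_span ⟨j, rfl⟩)

theorem unif_smul_mem (D : LocalDatum p F) (n : ℕ) (i : ℤ) {x : Fin (2 * n) → Kp p F}
    (hx : x ∈ Lam D n ((2 * n : ℕ) + i)) : unifO D • x ∈ Lam D n i := by
  refine Submodule.span_induction ?_ ?_ ?_ ?_ hx
  · rintro _ ⟨j, rfl⟩
    have : unifO D • frameVec D n ((2 * n : ℕ) + i) j = frameVec D n i j := by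
      unfold frameVec
      rw [← Pi.single_smul]
      congr 1
      change inclF p F _ * _ = _
      rw [← mul_assoc, ← map_mul, omega_add, ← zpow_one_add₀ (unif_ne_zero D),
        add_sub_cancel]
    rw [this]
    exact Submodule.subset_span ⟨j, rfl⟩
  · simp
  · intro x y _ _ hx hy
    rw [smul_add]
    exact Submodule.add_mem _ hx hy
  · intro a x _ hx
    rw [smul_comm]
    exact Submodule.smul_mem _ _ hx

theorem frameVec_form (D : LocalDatum p F) (n : ℕ) (i : ℤ) (j k : Fin (2 * n)) :
    ∃ c ∈ Op p F, frameVec D n i j ⬝ᵥ (Jmat n (Kp p F)).mulVec (frameVec D n (-i) k)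
      = c * D.delta := by
  have key : frameVec D n i j ⬝ᵥ (Jmat n (Kp p F)).mulVec (frameVec D n (-i) k)
      = inclF p F (D.unif ^ omega n i j) * (if (j : ℕ) < n then 1 else D.delta)
        * (Jmat n (Kp p F) j k * (inclF p F (D.unif ^ omega n (-i) k)
            * (if (k : ℕ) < n then 1 else D.delta))) := by
    unfold frameVec
    rw [single_dotProduct, Matrix.mulVec_single]
    simp [Matrix.col_apply, mul_comm]
  rw [key]
  by_cases h : (j : ℕ) + (k : ℕ) + 1 = 2 * n
  · have hw : inclF p F (D.unif ^ omega n i j) * inclF p F (D.unif ^ omega n (-i) k) = 1 := by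
      rw [← map_mul, ← zpow_add₀ (unif_ne_zero D), omega_neg i j k h, zpow_zero, map_one]
    by_cases hj : (j : ℕ) < n
    · have hk : ¬ (k : ℕ) < n := by omega
      refine ⟨1, Subalgebra.one_mem _, ?_⟩
      simp only [Jmat, Matrix.of_apply, h, hj, hk, if_true, if_false]
      linear_combination D.delta * hw
    · have hk : (k : ℕ) < n := by omega
      refine ⟨-1, Subalgebra.neg_mem _ (Subalgebra.one_mem _), ?_⟩
      simp only [Jmat, Matrix.of_apply, h, hj, hk, if_true, if_false]
      linear_combination (-D.delta) * hw
  · refine ⟨0, Subalgebra.zero_mem _, ?_⟩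
    simp [Jmat, h]

theorem form_integral (D : LocalDatum p F) (n : ℕ) (i : ℤ) {x y : Fin (2 * n) → Kp p F}
    (hx : x ∈ Lam D n i) (hy : y ∈ Lam D n (-i)) : ‖form p F n x y‖ ≤ 1 := by
  have key : ∃ c ∈ Op p F, x ⬝ᵥ (Jmat n (Kp p F)).mulVec y = c * D.delta := by
    refine Submodule.span_induction ?_ ?_ ?_ ?_ hx
    · rintro _ ⟨j, rfl⟩
      refine Submodule.span_induction ?_ ?_ ?_ ?_ hy
      · rintro _ ⟨k, rfl⟩
        exact frameVec_form D n i j k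
      · exact ⟨0, Subalgebra.zero_mem _, by simp⟩
      · rintro u v _ _ ⟨c, hc, h⟩ ⟨c', hc', h'⟩
        exact ⟨c + c', Subalgebra.add_mem _ hc hc', by
          rw [Matrix.mulVec_add, dotProduct_add, h, h', add_mul]⟩
      · rintro a u _ ⟨c, hc, h⟩
        refine ⟨a * c, Subalgebra.mul_mem _ a.2 hc, ?_⟩
        rw [Matrix.mulVec_smul, dotProduct_smul, h, mul_assoc]
        rfl
    · exact ⟨0, Subalgebra.zero_mem _, by simp⟩
    · rintro u v _ _ ⟨c, hc, h⟩ ⟨c', hc', h'⟩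
      exact ⟨c + c', Subalgebra.add_mem _ hc hc', by rw [add_dotProduct, h, h', add_mul]⟩
    · rintro a u _ ⟨c, hc, h⟩
      refine ⟨a * c, Subalgebra.mul_mem _ a.2 hc, ?_⟩
      rw [smul_dotProduct, h, mul_assoc]
      rfl
  obtain ⟨c, hc, h⟩ := key
  have := (D.delta_spec (c * D.delta)).2 ⟨c, hc, rfl⟩ 1 (Subalgebra.one_mem _)
  rw [mul_one] at this
  rw [form, h]
  exact this

/-- The inclusion `ρ_i : Λ_i → Λ_{i+1}`. -/
def rho (D : LocalDatum p F) (n : ℕ) (i : ℤ) : Lam D n i →ₗ[Op p F] Lam D n (i + 1) :=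
  Submodule.inclusion (Lam_le_succ D n i)

/-- Multiplication by `π`, `ϑ_i : Λ_{2n+i} → Λ_i`. -/
def theta (D : LocalDatum p F) (n : ℕ) (i : ℤ) :
    Lam D n ((2 * n : ℕ) + i) →ₗ[Op p F] Lam D n i where
  toFun x := ⟨unifO D • (x : Fin (2 * n) → Kp p F), unif_smul_mem D n i x.2⟩
  map_add' _ _ := Subtype.ext (smul_add _ _ _)
  map_smul' _ _ := Subtype.ext (smul_comm _ _ _)

theorem form_add_left (n : ℕ) (x x' y : Fin (2 * n) → Kp p F) :
    form p F n (x + x') y = form p F n x y + form p F n x' y := by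
  simp only [form, add_dotProduct, map_add]

theorem form_add_right (n : ℕ) (x y y' : Fin (2 * n) → Kp p F) :
    form p F n x (y + y') = form p F n x y + form p F n x y' := by
  simp only [form, Matrix.mulVec_add, dotProduct_add, map_add]

theorem form_smul_left (n : ℕ) (c : ℤ_[p]) (x y : Fin (2 * n) → Kp p F) :
    form p F n (c • x) y = (c : ℚ_[p]) * form p F n x y := by
  rw [form, smul_dotProduct, ← algebraMap_smul ℚ_[p] c, map_smul]
  rfl

theorem form_smul_right (n : ℕ) (c : ℤ_[p]) (x y : Fin (2 * n) → Kp p F) :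
    form p F n x (c • y) = (c : ℚ_[p]) * form p F n x y := by
  rw [form, Matrix.mulVec_smul, dotProduct_smul, ← algebraMap_smul ℚ_[p] c, map_smul]
  rfl

/-- The pairing `(·,·)_i : Λ_i × Λ_{-i} → ℤ_p`, the restriction of `form`. -/
def pairing (D : LocalDatum p F) (n : ℕ) (i : ℤ) :
    Lam D n i →ₗ[ℤ_[p]] Lam D n (-i) →ₗ[ℤ_[p]] ℤ_[p] :=
  LinearMap.mk₂ ℤ_[p]
    (fun x y => ⟨form p F n (x : Fin (2 * n) → Kp p F) (y : Fin (2 * n) → Kp p F),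
      form_integral D n i x.2 y.2⟩)
    (fun _ _ _ => Subtype.ext (form_add_left n _ _ _))
    (fun _ _ _ => Subtype.ext (form_smul_left n _ _ _))
    (fun _ _ _ => Subtype.ext (form_add_right n _ _ _))
    (fun _ _ _ => Subtype.ext (form_smul_right n _ _ _))

/-! ### The special fibre of the chain -/

variable (𝔽 : Type*) [Field 𝔽] [Algebra ℤ_[p] 𝔽]

variable (p F) in
/-- `𝒪_F ⊗ 𝔽`. -/
abbrev OF : Type _ := 𝔽 ⊗[ℤ_[p]] Op p F

/-- `Λ_{i,𝔽} = Λ_i ⊗ 𝔽`. -/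
def LamF (D : LocalDatum p F) (n : ℕ) (i : ℤ) : Type _ := 𝔽 ⊗[ℤ_[p]] Lam D n i

variable {𝔽}

instance (D : LocalDatum p F) (n : ℕ) (i : ℤ) : AddCommGroup (LamF 𝔽 D n i) :=
  inferInstanceAs (AddCommGroup (𝔽 ⊗[ℤ_[p]] Lam D n i))

instance (D : LocalDatum p F) (n : ℕ) (i : ℤ) : Module 𝔽 (LamF 𝔽 D n i) :=
  inferInstanceAs (Module 𝔽 (𝔽 ⊗[ℤ_[p]] Lam D n i))

/-- The action of `𝒪_F ⊗ 𝔽` on `Λ_i ⊗ 𝔽`. -/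
def actOF (D : LocalDatum p F) (n : ℕ) (i : ℤ) :
    OF p F 𝔽 →ₐ[𝔽] Module.End 𝔽 (𝔽 ⊗[ℤ_[p]] Lam D n i) :=
  Algebra.TensorProduct.lift (Algebra.ofId 𝔽 _)
    ((Module.End.baseChangeHom ℤ_[p] 𝔽 (Lam D n i)).comp
      (Algebra.lsmul ℤ_[p] ℤ_[p] (Lam D n i)))
    (fun c _ => by
      rw [Algebra.ofId_apply]
      exact Algebra.commute_algebraMap_left c _)

instance (D : LocalDatum p F) (n : ℕ) (i : ℤ) : Module (OF p F 𝔽) (LamF 𝔽 D n i) :=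
  Module.compHom (𝔽 ⊗[ℤ_[p]] Lam D n i) (actOF D n i).toRingHom

instance (D : LocalDatum p F) (n : ℕ) (i : ℤ) :
    IsScalarTower 𝔽 (OF p F 𝔽) (LamF 𝔽 D n i) where
  smul_assoc c a x := LinearMap.congr_fun (map_smul (actOF D n i) c a) x

/-- The element `c ⊗ x` of `Λ_i ⊗ 𝔽`. -/
def tm (D : LocalDatum p F) (n : ℕ) (i : ℤ) (c : 𝔽) (x : Lam D n i) : LamF 𝔽 D n i :=
  c ⊗ₜ[ℤ_[p]] x

/-- `ρ_{i,𝔽}`. -/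
def rhoF (D : LocalDatum p F) (n : ℕ) (i : ℤ) : LamF 𝔽 D n i →ₗ[𝔽] LamF 𝔽 D n (i + 1) :=
  ((rho D n i).restrictScalars ℤ_[p]).baseChange 𝔽

/-- `ϑ_{i,𝔽}`. -/
def thetaF (D : LocalDatum p F) (n : ℕ) (i : ℤ) :
    LamF 𝔽 D n ((2 * n : ℕ) + i) →ₗ[𝔽] LamF 𝔽 D n i :=
  ((theta D n i).restrictScalars ℤ_[p]).baseChange 𝔽

/-- The `𝔽`-bilinear pairing `(·,·)_{i,𝔽} : Λ_{i,𝔽} × Λ_{-i,𝔽} → 𝔽`. -/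
def pairingF (D : LocalDatum p F) (n : ℕ) (i : ℤ) :
    LamF 𝔽 D n i →ₗ[𝔽] LamF 𝔽 D n (-i) →ₗ[𝔽] 𝔽 :=
  LinearMap.liftBaseChange 𝔽
    ((LinearMap.compRight ℤ_[p]
        (TensorProduct.AlgebraTensorModule.rid ℤ_[p] 𝔽 𝔽).toLinearMap).restrictScalars ℤ_[p] ∘ₗ
      LinearMap.baseChangeHom ℤ_[p] 𝔽 (Lam D n (-i)) ℤ_[p] ∘ₗ pairing D n i)

/-! ### The local model -/

variable (F) in
/-- Let `M` be a finite free `R`-module with an action `act` of `𝒪_F`. In the coordinates of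
`𝒪_F ⊗ R` given by a `ℤ`-basis `(b_k)` of `𝒪_F`, this is the polynomial
`det (∑ X_k b_k | M ⊗ R[X])`, i.e. the morphism `det_M : V_{𝒪_F ⊗ R} → 𝔸¹_R`. -/
def detPoly (R M : Type*) [CommRing R] [AddCommGroup M] [Module R M]
    (act : 𝓞 F → Module.End R M) :
    MvPolynomial (Module.Free.ChooseBasisIndex ℤ (𝓞 F)) R :=
  LinearMap.det (∑ k, (MvPolynomial.X k : MvPolynomial (Module.Free.ChooseBasisIndex ℤ (𝓞 F)) R) •
    (act (NumberField.RingOfIntegers.basis F k)).baseChange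
      (MvPolynomial (Module.Free.ChooseBasisIndex ℤ (𝓞 F)) R))

variable (F) in
/-- The `(-i)`-eigenspace `V_{-i}` of `J_ℂ` in `V ⊗ ℂ = (ℂ ⊗ F)^{2n}`, where `J` has matrix
`-J̃_{2n}`. -/
def Vneg (n : ℕ) : Submodule (ℂ ⊗[ℚ] F) (Fin (2 * n) → ℂ ⊗[ℚ] F) :=
  LinearMap.ker ((-(Jmat n (ℂ ⊗[ℚ] F))).mulVecLin
    + (Complex.I ⊗ₜ[ℚ] (1 : F)) • (LinearMap.id : (Fin (2 * n) → ℂ ⊗[ℚ] F) →ₗ[ℂ ⊗[ℚ] F] _))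

/-- A point `(t_i)_i` of `M^loc(𝔽)`. -/
@[ext]
structure MLoc (𝔽 : Type*) [Field 𝔽] [Algebra ℤ_[p] 𝔽] (D : LocalDatum p F) (n : ℕ) where
  t : ∀ i : ℤ, Submodule (OF p F 𝔽) (LamF 𝔽 D n i)
  functorial : ∀ i, ∀ x ∈ t i, rhoF D n i x ∈ t (i + 1)
  finite : ∀ i, Module.Finite 𝔽 (LamF 𝔽 D n i ⧸ t i)
  projective : ∀ i, Module.Projective 𝔽 (LamF 𝔽 D n i ⧸ t i)
  /-- `det_{Λ_{i,𝔽}/t_i} = det_{V_{-i}} ⊗ 𝔽`, the morphism `det_{V_{-i}}` being defined over `ℤ` -/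
  determinant : ∀ i, ∃ d : MvPolynomial (Module.Free.ChooseBasisIndex ℤ (𝓞 F)) ℤ,
    MvPolynomial.map (Int.castRingHom ℂ) d =
      detPoly F ℂ (Vneg F n) (fun a => Algebra.lsmul ℂ ℂ (Vneg F n) ((1 : ℂ) ⊗ₜ[ℚ] (a : F))) ∧
    MvPolynomial.map (Int.castRingHom 𝔽) d =
      detPoly F 𝔽 (LamF 𝔽 D n i ⧸ t i)
        (fun a => Algebra.lsmul 𝔽 𝔽 (LamF 𝔽 D n i ⧸ t i) ((1 : 𝔽) ⊗ₜ[ℤ_[p]] inclO p F a))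
  dual : ∀ i, ∀ x ∈ t i, ∀ y ∈ t (-i), pairingF D n i x y = 0
  periodic : ∀ i, (thetaF (𝔽 := 𝔽) D n i) '' (t ((2 * n : ℕ) + i)) = t i

/-- `Aut(ℒ)(𝔽)`: automorphisms of the polarized chain `ℒ ⊗ 𝔽`. -/
def AutL (𝔽 : Type*) [Field 𝔽] [Algebra ℤ_[p] 𝔽] (D : LocalDatum p F) (n : ℕ) :
    Subgroup (∀ i : ℤ, LamF 𝔽 D n i ≃ₗ[OF p F 𝔽] LamF 𝔽 D n i) where
  carrier := {φ | (∀ i x, rhoF D n i (φ i x) = φ (i + 1) (rhoF D n i x)) ∧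
    (∀ i x, thetaF D n i (φ ((2 * n : ℕ) + i) x) = φ i (thetaF D n i x)) ∧
    ∀ i x y, pairingF D n i (φ i x) (φ (-i) y) = pairingF D n i x y}
  one_mem' := ⟨fun _ _ => rfl, fun _ _ => rfl, fun _ _ _ => rfl⟩
  mul_mem' := by
    rintro φ ψ ⟨h1, h2, h3⟩ ⟨k1, k2, k3⟩
    refine ⟨fun i x => ?_, fun i x => ?_, fun i x y => ?_⟩
    · exact (h1 i _).trans (congrArg _ (k1 i x))
    · exact (h2 i _).trans (congrArg _ (k2 i x))
    · exact (h3 i _ _).trans (k3 i x y)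
  inv_mem' := by
    rintro φ ⟨h1, h2, h3⟩
    have hr : ∀ i x, φ i ((φ⁻¹) i x) = x := fun i x => (φ i).apply_symm_apply x
    refine ⟨fun i x => ?_, fun i x => ?_, fun i x y => ?_⟩
    · apply (φ (i + 1)).injective
      rw [← h1, hr, hr]
    · apply (φ i).injective
      rw [← h2, hr, hr]
    · rw [← h3, hr, hr]

/-- The `Aut(ℒ)(𝔽)`-orbit of `t` in `M^loc(𝔽)`, for the action `(φ_i) · (t_i) = (φ_i(t_i))`. -/
def autOrbit {D : LocalDatum p F} {n : ℕ} (t : MLoc 𝔽 D n) : Set (MLoc 𝔽 D n) :=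
  {t' | ∃ φ ∈ AutL 𝔽 D n, ∀ i, φ i '' (t.t i) = t'.t i}

/-- The partition of `M^loc(𝔽)` into `Aut(ℒ)(𝔽)`-orbits. -/
def autSetoid (𝔽 : Type*) [Field 𝔽] [Algebra ℤ_[p] 𝔽] (D : LocalDatum p F) (n : ℕ) :
    Setoid (MLoc 𝔽 D n) where
  r t t' := t' ∈ autOrbit t
  iseqv :=
    { refl := fun t => ⟨1, one_mem _, fun i => Set.image_id _⟩
      symm := by
        rintro t t' ⟨φ, hφ, h⟩
        refine ⟨φ⁻¹, inv_mem hφ, fun i => ?_⟩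
        rw [← h, Set.image_image]
        convert Set.image_id _ using 2
        exact funext fun x => (φ i).symm_apply_apply x
      trans := by
        rintro t t' t'' ⟨φ, hφ, h⟩ ⟨ψ, hψ, k⟩
        refine ⟨ψ * φ, mul_mem hψ hφ, fun i => ?_⟩
        rw [← k, ← h, Set.image_image]
        rfl }

/-! ### The decomposition of the special fibre -/

variable (𝔽) in
/-- `𝔽[u]/u^e`, realized as `𝔽⟦u⟧/(u^e)`. -/
abbrev TruncRing (e : ℕ) : Type _ := 𝔽⟦X⟧ ⧸ Ideal.span {(PowerSeries.X : 𝔽⟦X⟧) ^ e}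

variable (𝔽) in
/-- The set `𝔖` of embeddings `k_𝒫 → 𝔽`. -/
abbrev Emb (D : LocalDatum p F) : Type _ := (𝓞 F ⧸ D.P) →+* 𝔽

/-- The defining properties of the canonical isomorphism `𝒪_F ⊗ 𝔽 ≃ ∏_σ 𝔽[u]/(u^e)` attached to
the uniformizer `π`: it sends `π` to `u` in each factor, and modulo `u` its `σ`-component is
`a ↦ σ(a mod 𝒫)` on `𝒪_F`. -/
structure IsCanonicalDecomp (D : LocalDatum p F)
    (Φ : OF p F 𝔽 ≃ₐ[𝔽] (Emb 𝔽 D → TruncRing 𝔽 D.e)) : Prop where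
  map_unif : ∀ σ, Φ (1 ⊗ₜ unifO D) σ = Ideal.Quotient.mk _ PowerSeries.X
  map_residue : ∀ (a : 𝓞 F) σ, Φ (1 ⊗ₜ inclO p F a) σ -
      Ideal.Quotient.mk _ (PowerSeries.C (σ (Ideal.Quotient.mk D.P a))) ∈
    Ideal.span {(Ideal.Quotient.mk _ PowerSeries.X : TruncRing 𝔽 D.e)}

theorem frameVec_mem (D : LocalDatum p F) (n : ℕ) (i : ℤ) (j : Fin (2 * n)) :
    frameVec D n i j ∈ Lam D n i := Submodule.subset_span ⟨j, rfl⟩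

/-- The element of `Λ_{i,𝔽}` with coordinates `z` in the basis `𝔈_{i,𝔽}`. -/
def frameF (D : LocalDatum p F) (n : ℕ) (i : ℤ) :
    (Fin (2 * n) → OF p F 𝔽) →ₗ[OF p F 𝔽] LamF 𝔽 D n i :=
  Fintype.linearCombination (OF p F 𝔽)
    (fun j => tm D n i (1 : 𝔽) ⟨frameVec D n i j, frameVec_mem D n i j⟩)

/-- The submodule `t_{i,σ}` of `Λ̄_i = (𝔽[u]/u^e)^{2n}`: the image of `t_i` in the factor `σ` of
`Λ_{i,𝔽} = ∏_σ Λ̄_i`, where the basis `𝔈_{i,𝔽}` is identified with the product of the standard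
bases. -/
def component {D : LocalDatum p F} {n : ℕ} (Φ : OF p F 𝔽 ≃ₐ[𝔽] (Emb 𝔽 D → TruncRing 𝔽 D.e))
    (t : MLoc 𝔽 D n) (σ : Emb 𝔽 D) (i : ℤ) :
    Submodule (TruncRing 𝔽 D.e) (Fin (2 * n) → TruncRing 𝔽 D.e) where
  carrier := {y | ∃ z : Fin (2 * n) → OF p F 𝔽, frameF D n i z ∈ t.t i ∧ ∀ j, Φ (z j) σ = y j}
  add_mem' := by
    rintro y y' ⟨z, hz, h⟩ ⟨z', hz', h'⟩
    refine ⟨z + z', ?_, fun j => ?_⟩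
    · rw [map_add]
      exact Submodule.add_mem _ hz hz'
    · simp [h, h']
  zero_mem' := ⟨0, by simp, by simp⟩
  smul_mem' := by
    rintro r y ⟨z, hz, h⟩
    refine ⟨Φ.symm (fun _ => r) • z, ?_, fun j => ?_⟩
    · rw [map_smul]
      exact Submodule.smul_mem _ _ hz
    · simp [h]

end Lattices

/-! ### The group `GSp` and its affine flag variety over `𝔽` -/

section Flags

/-- The group `GSp_{2n}(R)` of symplectic similitudes. -/
def GSp (n : ℕ) (R : Type*) [CommRing R] : Subgroup (GL (Fin (2 * n)) R) where
  carrier := {g | ∃ c : Rˣ, (g : Matrix (Fin (2 * n)) (Fin (2 * n)) R).transpose * Jmat n R * g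
    = (c : R) • Jmat n R}
  one_mem' := ⟨1, by simp⟩
  mul_mem' := by
    rintro g h ⟨c, hc⟩ ⟨d, hd⟩
    refine ⟨c * d, ?_⟩
    calc _ = (h : Matrix (Fin (2 * n)) (Fin (2 * n)) R).transpose *
          ((g : Matrix (Fin (2 * n)) (Fin (2 * n)) R).transpose * Jmat n R * g) * h := by
            simp [Matrix.mul_assoc, Matrix.transpose_mul]
      _ = _ := by
            rw [hc, Matrix.mul_smul, Matrix.smul_mul, hd, smul_smul]
            simp
  inv_mem' := by
    rintro g ⟨c, hc⟩
    refine ⟨c⁻¹, ?_⟩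
    have h1 : (g : Matrix (Fin (2 * n)) (Fin (2 * n)) R) * (g⁻¹ : GL (Fin (2 * n)) R) = 1 := by
      rw [← Units.val_mul, mul_inv_cancel, Units.val_one]
    have h2 : ((g⁻¹ : GL (Fin (2 * n)) R) : Matrix (Fin (2 * n)) (Fin (2 * n)) R).transpose *
        (g : Matrix (Fin (2 * n)) (Fin (2 * n)) R).transpose = 1 := by
      rw [← Matrix.transpose_mul, h1, Matrix.transpose_one]
    have h3 : (c : R) • (((g⁻¹ : GL (Fin (2 * n)) R) :
        Matrix (Fin (2 * n)) (Fin (2 * n)) R).transpose * Jmat n R * (g⁻¹ : GL (Fin (2 * n)) R))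
        = Jmat n R := by
      rw [← Matrix.smul_mul, ← Matrix.mul_smul, ← hc]
      simp only [Matrix.mul_assoc]
      rw [h1, Matrix.mul_one, ← Matrix.mul_assoc, h2, Matrix.one_mul]
    have h4 := congrArg (((c⁻¹ : Rˣ) : R) • ·) h3
    simp only [smul_smul, Units.inv_mul, one_smul] at h4
    exact h4

variable (n : ℕ) (𝔽 : Type*) [Field 𝔽]

/-- Families `(L_i)_{i ∈ ℤ}` of `𝔽⟦u⟧`-submodules of `𝔽((u))^{2n}`. -/
def Chain : Type _ := ℤ → Submodule 𝔽⟦X⟧ (Fin (2 * n) → 𝔽⸨X⸩)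

variable {n 𝔽}

/-- The action of `GSp_{2n}(𝔽((u)))` by `(g, (L_i)_i) ↦ (g L_i)_i`. -/
instance : MulAction (GSp n 𝔽⸨X⸩) (Chain n 𝔽) where
  smul g L := fun i => (L i).map
    ((Matrix.mulVecLin ((g : GL (Fin (2 * n)) 𝔽⸨X⸩) :
      Matrix (Fin (2 * n)) (Fin (2 * n)) 𝔽⸨X⸩)).restrictScalars 𝔽⟦X⟧)
  one_smul L := funext fun i => by
    change Submodule.map _ (L i) = L i
    convert Submodule.map_id (L i)
    ext x : 1
    simp
  mul_smul g h L := funext fun i => by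
    change Submodule.map _ (L i) = Submodule.map _ (Submodule.map _ (L i))
    rw [← Submodule.map_comp]
    congr 1
    ext x : 1
    simp

/-- `u^m ∈ 𝔽((u))`. -/
def upow (m : ℤ) : 𝔽⸨X⸩ := HahnSeries.single m (1 : 𝔽)

/-- The lattice with basis `(u^{a(j)} e_j)_j`. -/
def diagLattice (a : Fin (2 * n) → ℤ) : Submodule 𝔽⟦X⟧ (Fin (2 * n) → 𝔽⸨X⸩) :=
  Submodule.span 𝔽⟦X⟧ (Set.range fun j => Pi.single j (upow (a j)))

variable (n 𝔽) in
/-- The standard lattice chain `(Λ̃_i)_i`. -/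
def stdChain : Chain n 𝔽 := fun i => diagLattice (omega n i)

variable (n 𝔽) in
/-- `I_GSp(𝔽)`, the stabilizer of the standard lattice chain in `GSp_{2n}(𝔽((u)))`. -/
def Iwahori : Subgroup (GSp n 𝔽⸨X⸩) := MulAction.stabilizer (GSp n 𝔽⸨X⸩) (stdChain n 𝔽)

/-- The injection `φ : GSp_{2n}(𝔽((u))) / I_GSp(𝔽) → {lattice chains}`, `g ↦ g · (Λ̃_i)_i`. -/
def flag (x : GSp n 𝔽⸨X⸩ ⧸ Iwahori n 𝔽) : Chain n 𝔽 :=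
  MulAction.ofQuotientStabilizer (GSp n 𝔽⸨X⸩) (stdChain n 𝔽) x

variable (n 𝔽) in
/-- `I_GSp(𝔽) \ GSp_{2n}(𝔽((u))) / I_GSp(𝔽)`. -/
abbrev DoubleCosets : Type _ :=
  MulAction.orbitRel.Quotient (Iwahori n 𝔽) (GSp n 𝔽⸨X⸩ ⧸ Iwahori n 𝔽)

/-- The double coset of `g I_GSp(𝔽)`. -/
def toDouble (x : GSp n 𝔽⸨X⸩ ⧸ Iwahori n 𝔽) : DoubleCosets n 𝔽 :=
  Quotient.mk (MulAction.orbitRel (Iwahori n 𝔽) (GSp n 𝔽⸨X⸩ ⧸ Iwahori n 𝔽)) x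

/-! ### The extended affine Weyl group and permissible alcoves -/

variable (n 𝔽) in
/-- `T(𝔽((u)))`, the diagonal matrices in `GSp_{2n}(𝔽((u)))`. -/
def torus : Subgroup (GSp n 𝔽⸨X⸩) :=
  (Units.map (Matrix.diagonalRingHom (Fin (2 * n)) 𝔽⸨X⸩ :
    (Fin (2 * n) → 𝔽⸨X⸩) →* Matrix (Fin (2 * n)) (Fin (2 * n)) 𝔽⸨X⸩)).range.subgroupOf
      (GSp n 𝔽⸨X⸩)

variable (n 𝔽) in
/-- `T(𝔽⟦u⟧)`. -/
def torusInt : Subgroup (GSp n 𝔽⸨X⸩) :=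
  (Units.map (((Matrix.diagonalRingHom (Fin (2 * n)) 𝔽⸨X⸩).comp
    ((algebraMap 𝔽⟦X⟧ 𝔽⸨X⸩).compLeft (Fin (2 * n))) :
    (Fin (2 * n) → 𝔽⟦X⟧) →+* Matrix (Fin (2 * n)) (Fin (2 * n)) 𝔽⸨X⸩) :
    (Fin (2 * n) → 𝔽⟦X⟧) →* Matrix (Fin (2 * n)) (Fin (2 * n)) 𝔽⸨X⸩)).range.subgroupOf
      (GSp n 𝔽⸨X⸩)

variable (n 𝔽) in
/-- `N(𝔽((u)))`, the normalizer of `T(𝔽((u)))`. -/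
abbrev normTorus : Subgroup (GSp n 𝔽⸨X⸩) :=
  Subgroup.normalizer (torus n 𝔽 : Set (GSp n 𝔽⸨X⸩))

variable (n 𝔽) in
/-- The extended affine Weyl group `W̃ = N(𝔽((u))) / T(𝔽⟦u⟧)`. -/
abbrev ExtWeyl : Type _ := normTorus n 𝔽 ⧸ (torusInt n 𝔽).subgroupOf (normTorus n 𝔽)

theorem diag_map_le (d : Fin (2 * n) → 𝔽⟦X⟧) (a : Fin (2 * n) → ℤ) :
    (diagLattice a).map ((Matrix.mulVecLin (Matrix.diagonal
      (fun j => algebraMap 𝔽⟦X⟧ 𝔽⸨X⸩ (d j)))).restrictScalars 𝔽⟦X⟧) ≤ diagLattice a := by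
  rw [diagLattice, Submodule.map_span_le]
  rintro _ ⟨j, rfl⟩
  have : ((Matrix.mulVecLin (Matrix.diagonal
      (fun j => algebraMap 𝔽⟦X⟧ 𝔽⸨X⸩ (d j)))).restrictScalars 𝔽⟦X⟧)
        (Pi.single j (upow (a j))) = d j • (Pi.single j (upow (a j)) : Fin (2 * n) → 𝔽⸨X⸩) := by
    ext1 k
    rcases eq_or_ne k j with rfl | h
    · simp [Matrix.mulVec_diagonal, Algebra.smul_def]
    · simp [Matrix.mulVec_diagonal, h]
  rw [this]
  exact Submodule.smul_mem _ _ (Submodule.subset_span ⟨j, rfl⟩)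

theorem torusInt_smul_le {g : GSp n 𝔽⸨X⸩} (hg : g ∈ torusInt n 𝔽) (i : ℤ) :
    (g • stdChain n 𝔽) i ≤ stdChain n 𝔽 i := by
  obtain ⟨d, hd⟩ := hg
  have h : ((g : GL (Fin (2 * n)) 𝔽⸨X⸩) : Matrix (Fin (2 * n)) (Fin (2 * n)) 𝔽⸨X⸩)
      = Matrix.diagonal (fun j => algebraMap 𝔽⟦X⟧ 𝔽⸨X⸩ ((d : Fin (2 * n) → 𝔽⟦X⟧) j)) :=
    (congrArg Units.val hd).symm
  have := diag_map_le (d : Fin (2 * n) → 𝔽⟦X⟧) (omega n i)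
  rw [← h] at this
  exact this

theorem torusInt_le : torusInt n 𝔽 ≤ Iwahori n 𝔽 := by
  intro g hg
  refine MulAction.mem_stabilizer_iff.2 (funext fun i => le_antisymm (torusInt_smul_le hg i) ?_)
  have h1 := torusInt_smul_le (inv_mem hg) i
  have h2 : (g • g⁻¹ • stdChain n 𝔽) i ≤ (g • stdChain n 𝔽) i := Submodule.map_mono h1
  rwa [smul_inv_smul] at h2

/-- The map `W̃ → GSp_{2n}(𝔽((u))) / I_GSp(𝔽)` induced by `N(𝔽((u))) ⊆ GSp_{2n}(𝔽((u)))`. -/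
def weylCoset : ExtWeyl n 𝔽 → GSp n 𝔽⸨X⸩ ⧸ Iwahori n 𝔽 :=
  Quotient.map' (fun w => (w : GSp n 𝔽⸨X⸩)) (by
    intro a b h
    rw [QuotientGroup.leftRel_apply] at h ⊢
    exact torusInt_le h)

/-- Extended alcoves for `GSp_{2n}`. A tuple `(x_i)_{i = 0}^{2n-1}` is extended to all `i ∈ ℤ` by
`x_{i + 2n} = x_i - (1, …, 1)`. -/
structure IsExtendedAlcove (x : ℤ → Fin (2 * n) → ℤ) : Prop where
  periodic : ∀ i j, x (i + (2 * n : ℕ)) j = x i j - 1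
  step : ∀ i, ∃ k, x i - x (i + 1) = Pi.single k 1
  dual : ∃ c : ℤ, ∀ i j, x i j + x (-i) (Fin.rev j) = c

/-- An element of `W̃` corresponds to the extended alcove `x` if it carries the standard alcove
`(ω_i)_i` to `x`; in terms of lattices, `w Λ̃_i` has the basis `(u^{x_i(j)} e_j)_j` for all `i`. -/
def HasAlcove (w : ExtWeyl n 𝔽) (x : ℤ → Fin (2 * n) → ℤ) : Prop :=
  ∀ i, flag (weylCoset w) i = diagLattice (x i)

/-- Permissibility (for the integer `e`) of an extended alcove. -/
structure IsPermissible (e : ℕ) (x : ℤ → Fin (2 * n) → ℤ) : Prop where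
  lower : ∀ i : ℤ, 0 ≤ i → i < (2 * n : ℕ) → ∀ j, omega n i j ≤ x i j
  upper : ∀ i : ℤ, 0 ≤ i → i < (2 * n : ℕ) → ∀ j, x i j ≤ omega n i j + e
  sum : ∀ i : ℤ, 0 ≤ i → i < (2 * n : ℕ) → ∑ j, x i j = n * e - i

variable (n 𝔽) in
/-- `Perm ⊆ W̃`, the set of permissible extended alcoves, `W̃` being identified with the set of
extended alcoves. -/
def Perm (e : ℕ) : Set (ExtWeyl n 𝔽) :=
  {w | ∃ x, IsExtendedAlcove x ∧ IsPermissible e x ∧ HasAlcove w x}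

end Flags

/-! ### The map `α̃` -/

section Embedding

variable {p : ℕ} [Fact p.Prime] {F : Type*} [Field F] [NumberField F]
  {𝔽 : Type*} [Field 𝔽] [Algebra ℤ_[p] 𝔽] {D : LocalDatum p F} {n : ℕ}

/-- The lattice chain `(α_i⁻¹(t_{i,σ}))_i`, where `α_i : Λ̃_i → Λ̄_i` reduces coordinates in the
basis `(u^{ω_i(j)} e_j)_j` modulo `u^e`. -/
def chainOf (Φ : OF p F 𝔽 ≃ₐ[𝔽] (Emb 𝔽 D → TruncRing 𝔽 D.e)) (t : MLoc 𝔽 D n) (σ : Emb 𝔽 D) :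
    Chain n 𝔽 := fun i =>
  { carrier := {x | ∃ c : Fin (2 * n) → 𝔽⟦X⟧, (∀ j, x j = c j • upow (omega n i j)) ∧
      (fun j => (Ideal.Quotient.mk _ (c j) : TruncRing 𝔽 D.e)) ∈ component Φ t σ i}
    add_mem' := by
      rintro x x' ⟨c, h, hc⟩ ⟨c', h', hc'⟩
      refine ⟨c + c', fun j => ?_, ?_⟩
      · simp [h, h', add_smul]
      · convert Submodule.add_mem _ hc hc' using 1
        ext j
        exact map_add (Ideal.Quotient.mk _) _ _
    zero_mem' := ⟨0, by simp, by
      convert Submodule.zero_mem _ using 1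
      ext j
      simp⟩
    smul_mem' := by
      rintro r x ⟨c, h, hc⟩
      refine ⟨fun j => r * c j, fun j => ?_, ?_⟩
      · simp [h, mul_smul]
      · convert Submodule.smul_mem _ (Ideal.Quotient.mk _ r : TruncRing 𝔽 D.e) hc using 1
        ext j
        exact map_mul (Ideal.Quotient.mk _) _ _ }

/-- `α̃ : M^loc(𝔽) → ∏_σ GSp_{2n}(𝔽((u))) / I_GSp(𝔽)`: the `σ`-component of `α̃(t)` is the class
`g I_GSp(𝔽)` with `g · (Λ̃_i)_i = (α_i⁻¹(t_{i,σ}))_i`. -/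
def alphaTilde (Φ : OF p F 𝔽 ≃ₐ[𝔽] (Emb 𝔽 D → TruncRing 𝔽 D.e)) (t : MLoc 𝔽 D n) (σ : Emb 𝔽 D) :
    GSp n 𝔽⸨X⸩ ⧸ Iwahori n 𝔽 :=
  Function.invFun flag (chainOf Φ t σ)

end Embedding

end SymplecticLocalModel

/-! The isomorphism `Φ` cuts a point `t` into independent pieces, one for each embedding `σ`. Since
`δ` generates the inverse different, the trace pairing may be replaced by the `𝒪_F ⊗ 𝔽`-bilinear
symplectic form (`eq_zero_of_traceDeltaF`). The determinant function of `V_{-i}` is the `n`-th power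
of the norm form, so the determinant condition says that each quotient at `σ` has dimension `ne`
(`determinant_iff_finrank_component`). A point is thus the same as a tuple of families in
`(𝔽[u]/u^e)^{2n}` satisfying `IsCompFamily`, and the preimages of such a family form a lattice chain
`L` with `L_i ⊆ Λ̃_i` and `L_i^∨ = L_{2ne-i}`.

The geometric core is `exists_common_basis`: `L` and the standard chain are split by a common
symplectic basis. It is found by a Gram–Schmidt process on hyperbolic pairs adapted to both chains.
Hence `L = g · (diagonal chain of x)` with `g ∈ I`, where `x` is an extended alcove, and
permissibility of `x` is read off from inclusion, duality and dimension. As every alcove comes from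
`W̃`, this shows that `α̃` is well defined and that each orbit meets `Perm`. Conversely a
permissible alcove defines a point of the local model.

The alcove `x` depends only on the relative position of the two chains, that is, on which inclusions
`Λ̃_{j+1} ⊆ L_i + Λ̃_j` hold (`alcove_eq_of_relPos`). This gives the disjointness of the double
cosets `I w I`. The same inclusions can be expressed through `t_i`, the images of the transition
maps and the idempotent of `σ`, all respected by `Aut(ℒ)(𝔽)`. So equivalent points have the same
alcoves and hence lie in the same `I`-orbits; no automorphism of the special fibre has to be lifted
to `𝔽⟦u⟧`.

In the other direction, elements `g_σ ∈ I` act on the reductions modulo `u^e` as similitudes with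
unit multiplier. For `p ≠ 2` and `𝔽` algebraically closed the inverse multiplier has a square root;
rescaling by it gives isometries without changing the action on submodules (`exists_localAut`).
Together with the injectivity of `α̃` this yields the bijection on orbits, and the other assertions
follow. -/

namespace SymplecticLocalModel

/-! ### Orders of vanishing in `𝔽((u))` and diagonal lattices. -/

section LaurentOrder

variable {𝔽 : Type*} [Field 𝔽]

/-- The fractional ideal `u^m 𝔽⟦u⟧` of `𝔽((u))`. -/
def fracIdeal (𝔽 : Type*) [Field 𝔽] (m : ℤ) : Submodule 𝔽⟦X⟧ 𝔽⸨X⸩ :=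
  Submodule.span 𝔽⟦X⟧ {upow m}

theorem upow_add (a b : ℤ) : (upow (a + b) : 𝔽⸨X⸩) = upow a * upow b := by
  simp [upow, HahnSeries.single_mul_single]

theorem upow_zero : (upow 0 : 𝔽⸨X⸩) = 1 := rfl

theorem upow_ne_zero (a : ℤ) : (upow a : 𝔽⸨X⸩) ≠ 0 := by
  simp [upow]

theorem upow_mul_upow_neg (a : ℤ) : (upow a : 𝔽⸨X⸩) * upow (-a) = 1 := by
  rw [← upow_add, add_neg_cancel, upow_zero]

theorem upow_natCast (a : ℕ) :
    (upow (a : ℤ) : 𝔽⸨X⸩) = algebraMap 𝔽⟦X⟧ 𝔽⸨X⸩ (PowerSeries.X ^ a) := by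
  induction a with
  | zero => simp [upow_zero]
  | succ a ih =>
    rw [Nat.cast_succ, upow_add, ih, pow_succ, map_mul]
    congr 1
    simp [upow, LaurentSeries.coe_algebraMap]

theorem mem_fracIdeal {m : ℤ} {z : 𝔽⸨X⸩} :
    z ∈ fracIdeal 𝔽 m ↔ ∃ c : 𝔽⟦X⟧, z = c • upow m := by
  simp only [fracIdeal, Submodule.mem_span_singleton, eq_comm]

theorem upow_mem_fracIdeal {a m : ℤ} (h : m ≤ a) : (upow a : 𝔽⸨X⸩) ∈ fracIdeal 𝔽 m := by
  obtain ⟨k, rfl⟩ := Int.le.dest h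
  refine mem_fracIdeal.2 ⟨PowerSeries.X ^ k, ?_⟩
  rw [Algebra.smul_def, ← upow_natCast, ← upow_add, add_comm]

theorem fracIdeal_anti {a m : ℤ} (h : m ≤ a) : fracIdeal 𝔽 a ≤ fracIdeal 𝔽 m := by
  rw [fracIdeal, Submodule.span_singleton_le_iff_mem]
  exact upow_mem_fracIdeal h

theorem mul_mem_fracIdeal {a b : ℤ} {y z : 𝔽⸨X⸩} (hy : y ∈ fracIdeal 𝔽 a)
    (hz : z ∈ fracIdeal 𝔽 b) : y * z ∈ fracIdeal 𝔽 (a + b) := by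
  obtain ⟨c, rfl⟩ := mem_fracIdeal.1 hy
  obtain ⟨d, rfl⟩ := mem_fracIdeal.1 hz
  exact mem_fracIdeal.2 ⟨c * d, by rw [upow_add, smul_mul_smul_comm]⟩

theorem upow_mul_mem_fracIdeal {a m : ℤ} {z : 𝔽⸨X⸩} :
    upow a * z ∈ fracIdeal 𝔽 m ↔ z ∈ fracIdeal 𝔽 (m - a) := by
  constructor <;> intro h
  · have := mul_mem_fracIdeal (upow_mem_fracIdeal (le_refl (-a))) h
    rwa [← mul_assoc, mul_comm (upow (-a)), upow_mul_upow_neg, one_mul,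
      show -a + m = m - a by ring] at this
  · have := mul_mem_fracIdeal (upow_mem_fracIdeal (le_refl a)) h
    rwa [add_sub_cancel] at this

theorem mem_fracIdeal_zero {z : 𝔽⸨X⸩} :
    z ∈ fracIdeal 𝔽 0 ↔ ∃ c : 𝔽⟦X⟧, algebraMap 𝔽⟦X⟧ 𝔽⸨X⸩ c = z := by
  simp [mem_fracIdeal, upow_zero, Algebra.smul_def, eq_comm]

theorem exists_eq_unit_smul_upow {z : 𝔽⸨X⸩} (hz : z ≠ 0) :
    ∃ (m : ℤ) (c : 𝔽⟦X⟧ˣ), z = (c : 𝔽⟦X⟧) • upow m := by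
  obtain ⟨⟨a, s⟩, h⟩ := IsLocalization.surj (nonZeroDivisors 𝔽⟦X⟧) z
  have hs : (s : 𝔽⟦X⟧) ≠ 0 := nonZeroDivisors.ne_zero s.2
  have hinj := FaithfulSMul.algebraMap_injective 𝔽⟦X⟧ 𝔽⸨X⸩
  have ha : a ≠ 0 := by
    rintro rfl
    simp only [map_zero, mul_eq_zero, hz, false_or] at h
    exact hs (hinj (h.trans (map_zero _).symm))
  obtain ⟨i, a', rfl⟩ := IsDiscreteValuationRing.eq_unit_mul_pow_irreducible ha
    PowerSeries.X_irreducible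
  obtain ⟨j, s', hs'⟩ := IsDiscreteValuationRing.eq_unit_mul_pow_irreducible hs
    PowerSeries.X_irreducible
  refine ⟨i - j, a' * s'⁻¹, ?_⟩
  have h1 : algebraMap 𝔽⟦X⟧ 𝔽⸨X⸩ s ≠ 0 := fun h0 => hs (hinj (h0.trans (map_zero _).symm))
  refine mul_right_cancel₀ h1 ?_
  rw [h, hs', map_mul, map_mul, ← upow_natCast, ← upow_natCast, Algebra.smul_def, sub_eq_add_neg,
    upow_add, Units.val_mul, map_mul]
  have h2 : algebraMap 𝔽⟦X⟧ 𝔽⸨X⸩ ((s'⁻¹ : 𝔽⟦X⟧ˣ) : 𝔽⟦X⟧) * algebraMap 𝔽⟦X⟧ 𝔽⸨X⸩ s' = 1 := by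
    rw [← map_mul, Units.inv_mul, map_one]
  have h3 := upow_mul_upow_neg (𝔽 := 𝔽) j
  linear_combination (-(algebraMap 𝔽⟦X⟧ 𝔽⸨X⸩ a' * upow (i : ℤ))) * h2 -
    (algebraMap 𝔽⟦X⟧ 𝔽⸨X⸩ a' * upow (i : ℤ) *
      (algebraMap 𝔽⟦X⟧ 𝔽⸨X⸩ ((s'⁻¹ : 𝔽⟦X⟧ˣ) : 𝔽⟦X⟧) * algebraMap 𝔽⟦X⟧ 𝔽⸨X⸩ s')) * h3

theorem upow_mem_fracIdeal_iff {a m : ℤ} : (upow a : 𝔽⸨X⸩) ∈ fracIdeal 𝔽 m ↔ m ≤ a := by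
  refine ⟨fun h => ?_, upow_mem_fracIdeal⟩
  by_contra hlt
  obtain ⟨c, hc⟩ := mem_fracIdeal.1 h
  -- If `a < m`, then `u^a = c u^m` forces `1 = c u^{m-a}` in `𝔽⟦u⟧`, which fails for the constant
  -- coefficient.
  have h0 : (1 : 𝔽⸨X⸩) = algebraMap 𝔽⟦X⟧ 𝔽⸨X⸩ (c * PowerSeries.X ^ (m - a).toNat) := by
    rw [map_mul, ← upow_natCast, Int.toNat_of_nonneg (by omega), ← upow_mul_upow_neg a, hc,
      Algebra.smul_def, mul_assoc, ← upow_add]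
    rfl
  have h1 : (1 : 𝔽⟦X⟧) = c * PowerSeries.X ^ (m - a).toNat :=
    FaithfulSMul.algebraMap_injective 𝔽⟦X⟧ 𝔽⸨X⸩ (by rw [← h0, map_one])
  have h2 := congrArg (PowerSeries.constantCoeff (R := 𝔽)) h1
  simp [zero_pow (show (m - a).toNat ≠ 0 by omega)] at h2

theorem smul_unit_mem_fracIdeal (c : 𝔽⟦X⟧ˣ) {z : 𝔽⸨X⸩} {m : ℤ} :
    (c : 𝔽⟦X⟧) • z ∈ fracIdeal 𝔽 m ↔ z ∈ fracIdeal 𝔽 m :=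
  Submodule.smul_mem_iff_of_isUnit _ c.isUnit

/-- An element of exact order `m` is a unit times `u^m`. -/
theorem eq_unit_smul_upow {z : 𝔽⸨X⸩} {m : ℤ} (h : z ∈ fracIdeal 𝔽 m)
    (h' : z ∉ fracIdeal 𝔽 (m + 1)) : ∃ c : 𝔽⟦X⟧ˣ, z = (c : 𝔽⟦X⟧) • upow m := by
  have hz : z ≠ 0 := fun h0 => h' (h0 ▸ Submodule.zero_mem _)
  obtain ⟨k, c, rfl⟩ := exists_eq_unit_smul_upow hz
  rw [smul_unit_mem_fracIdeal, upow_mem_fracIdeal_iff] at h h'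
  exact ⟨c, by rw [show k = m by omega]⟩

theorem inv_mem_fracIdeal {z : 𝔽⸨X⸩} {m : ℤ} (h : z ∈ fracIdeal 𝔽 m)
    (h' : z ∉ fracIdeal 𝔽 (m + 1)) : z⁻¹ ∈ fracIdeal 𝔽 (-m) := by
  obtain ⟨c, rfl⟩ := eq_unit_smul_upow h h'
  refine mem_fracIdeal.2 ⟨((c⁻¹ : 𝔽⟦X⟧ˣ) : 𝔽⟦X⟧), inv_eq_of_mul_eq_one_right ?_⟩
  rw [smul_mul_smul_comm, upow_mul_upow_neg, Units.mul_inv, one_smul]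

variable {n : ℕ}

theorem mem_diagLattice {a : Fin (2 * n) → ℤ} {x : Fin (2 * n) → 𝔽⸨X⸩} :
    x ∈ diagLattice a ↔ ∀ j, x j ∈ fracIdeal 𝔽 (a j) := by
  rw [diagLattice, Submodule.mem_span_range_iff_exists_fun]
  constructor
  · rintro ⟨c, rfl⟩ j
    simp only [Finset.sum_apply, Pi.smul_apply, Pi.single_apply, smul_ite, smul_zero,
      Finset.sum_ite_eq, Finset.mem_univ, if_true]
    exact Submodule.smul_mem _ _ (upow_mem_fracIdeal le_rfl)
  · intro h
    choose c hc using fun j => mem_fracIdeal.1 (h j)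
    refine ⟨c, funext fun j => ?_⟩
    simp [Finset.sum_apply, Pi.single_apply, hc]

theorem diagLattice_le_iff {a b : Fin (2 * n) → ℤ} :
    (diagLattice a : Submodule 𝔽⟦X⟧ (Fin (2 * n) → 𝔽⸨X⸩)) ≤ diagLattice b ↔ b ≤ a := by
  constructor
  · intro h j
    have := mem_diagLattice.1 (h (Submodule.subset_span ⟨j, rfl⟩)) j
    simpa [upow_mem_fracIdeal_iff] using this
  · intro h x hx
    exact mem_diagLattice.2 fun j => fracIdeal_anti (h j) (mem_diagLattice.1 hx j)

theorem diagLattice_injective : Function.Injective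
    (diagLattice : (Fin (2 * n) → ℤ) → Submodule 𝔽⟦X⟧ (Fin (2 * n) → 𝔽⸨X⸩)) :=
  fun _ _ h => le_antisymm (diagLattice_le_iff.1 h.ge) (diagLattice_le_iff.1 h.le)

theorem diagLattice_sup (a b : Fin (2 * n) → ℤ) :
    (diagLattice a ⊔ diagLattice b : Submodule 𝔽⟦X⟧ (Fin (2 * n) → 𝔽⸨X⸩)) =
      diagLattice (a ⊓ b) := by
  refine le_antisymm (sup_le (diagLattice_le_iff.2 inf_le_left)
    (diagLattice_le_iff.2 inf_le_right)) ?_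
  rw [diagLattice, Submodule.span_le]
  rintro _ ⟨j, rfl⟩
  rcases le_total (a j) (b j) with h | h
  · refine Submodule.mem_sup_left (mem_diagLattice.2 fun k => ?_)
    rcases eq_or_ne k j with rfl | hk
    · simp [h, upow_mem_fracIdeal_iff]
    · simp [hk]
  · refine Submodule.mem_sup_right (mem_diagLattice.2 fun k => ?_)
    rcases eq_or_ne k j with rfl | hk
    · simp [h, upow_mem_fracIdeal_iff]
    · simp [hk]

end LaurentOrder

end SymplecticLocalModel

namespace SymplecticLocalModel

/-! ### The symplectic form `J̃_{2n}` over a commutative ring. -/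

section SymplecticForm

variable {R : Type*} [CommRing R] {n : ℕ}

/-- The alternating form with matrix `J̃_{2n}`. -/
def symp (n : ℕ) (R : Type*) [CommRing R] : LinearMap.BilinForm R (Fin (2 * n) → R) :=
  Matrix.toBilin' (Jmat n R)

/-- The nonzero entry of `J̃_{2n}` in row `j`. -/
def jsign (n : ℕ) (R : Type*) [CommRing R] (j : Fin (2 * n)) : R := if (j : ℕ) < n then 1 else -1

theorem symp_apply (x y : Fin (2 * n) → R) : symp n R x y = x ⬝ᵥ (Jmat n R).mulVec y :=
  Matrix.toBilin'_apply' _ _ _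

theorem Jmat_apply (a b : Fin (2 * n)) :
    Jmat n R a b = if b = Fin.rev a then jsign n R a else 0 := by
  have h : (a : ℕ) + b + 1 = 2 * n ↔ b = Fin.rev a := by
    rw [Fin.ext_iff, Fin.val_rev]; omega
  simp only [Jmat, Matrix.of_apply, h, jsign]

theorem jsign_rev (j : Fin (2 * n)) : jsign n R (Fin.rev j) = -jsign n R j := by
  have := Fin.val_rev j
  unfold jsign
  split_ifs <;> first | omega | simp

theorem jsign_mul_self (j : Fin (2 * n)) : jsign n R j * jsign n R j = 1 := by
  unfold jsign; split_ifs <;> simp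

theorem symp_eq_sum (x y : Fin (2 * n) → R) :
    symp n R x y = ∑ j, jsign n R j * x j * y (Fin.rev j) := by
  simp only [symp_apply, dotProduct, Matrix.mulVec, Jmat_apply, ite_mul, zero_mul,
    Finset.sum_ite_eq', Finset.mem_univ, if_true]
  exact Finset.sum_congr rfl fun j _ => by ring

theorem symp_neg_swap (x y : Fin (2 * n) → R) : symp n R y x = -symp n R x y := by
  rw [symp_eq_sum, symp_eq_sum, ← Finset.sum_neg_distrib]
  refine Fintype.sum_equiv Fin.revPerm _ _ fun j => ?_
  rw [Fin.revPerm_apply, jsign_rev, Fin.rev_rev]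
  ring

theorem symp_self (x : Fin (2 * n) → R) : symp n R x x = 0 := by
  rw [symp_eq_sum]
  refine Finset.sum_involution (fun j _ => Fin.rev j) (fun j _ => ?_) (fun j _ _ h => ?_)
    (fun _ _ => Finset.mem_univ _) (fun j _ => Fin.rev_rev j)
  · rw [jsign_rev, Fin.rev_rev]; ring
  · have := congrArg Fin.val h
    rw [Fin.val_rev] at this
    omega

theorem symp_single_left (j : Fin (2 * n)) (a : R) (y : Fin (2 * n) → R) :
    symp n R (Pi.single j a) y = jsign n R j * a * y (Fin.rev j) := by
  rw [symp_eq_sum, Finset.sum_eq_single j]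
  · simp
  · intro k _ hk; simp [hk]
  · simp

theorem symp_single_single (j k : Fin (2 * n)) (a b : R) :
    symp n R (Pi.single j a) (Pi.single k b) = a * b * Jmat n R j k := by
  rw [symp_single_left, Jmat_apply, Pi.single_apply]
  by_cases h : k = Fin.rev j
  · simp [h]; ring
  · rw [if_neg (Ne.symm h), if_neg h]; ring

theorem Jmat_mul_self : Jmat n R * Jmat n R = -1 := by
  ext a b
  simp only [Matrix.mul_apply, Jmat_apply, ite_mul, zero_mul, Finset.sum_ite_eq',
    Finset.mem_univ, if_true, Fin.rev_rev, Matrix.neg_apply, Matrix.one_apply]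
  by_cases h : b = a
  · simp [h, jsign_rev, jsign_mul_self]
  · simp [h, Ne.symm h]

theorem isUnit_det_Jmat : IsUnit (Jmat n R).det := by
  have h : Jmat n R * (-Jmat n R) = 1 := by rw [mul_neg, Jmat_mul_self, neg_neg]
  exact Matrix.isUnit_det_of_right_inverse h

theorem symp_mulVec (g : Matrix (Fin (2 * n)) (Fin (2 * n)) R) (x y : Fin (2 * n) → R) :
    symp n R (g.mulVec x) (g.mulVec y) = x ⬝ᵥ (g.transpose * Jmat n R * g).mulVec y := by
  rw [symp_apply, Matrix.mul_assoc, ← Matrix.mulVec_mulVec, Matrix.dotProduct_mulVec x,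
    Matrix.vecMul_transpose, Matrix.mulVec_mulVec]

theorem symp_mulVec_of_eq {g : Matrix (Fin (2 * n)) (Fin (2 * n)) R} {c : R}
    (h : g.transpose * Jmat n R * g = c • Jmat n R) (x y : Fin (2 * n) → R) :
    symp n R (g.mulVec x) (g.mulVec y) = c * symp n R x y := by
  rw [symp_mulVec, h, Matrix.smul_mulVec, dotProduct_smul, symp_apply, smul_eq_mul]

theorem transpose_mul_Jmat_mul_apply (g : Matrix (Fin (2 * n)) (Fin (2 * n)) R)
    (a b : Fin (2 * n)) :
    (g.transpose * Jmat n R * g) a b = symp n R (g.col a) (g.col b) := by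
  rw [← Matrix.mulVec_single_one, ← Matrix.mulVec_single_one, symp_mulVec]
  simp [Matrix.col_apply]

end SymplecticForm

/-! ### Periodic self-dual lattice chains. -/

section LatticeChains

variable {𝔽 : Type*} [Field 𝔽] {n : ℕ}

/-- The exponent `⌈(τ - i) / N⌉`. -/
def cexp (N τ i : ℤ) : ℤ := -((i - τ) / N)

/-- So `cexp N τ i` is the least exponent `m` for which monotonicity and periodicity of a chain with
period `N` force `u^m M_τ ⊆ M_i`. -/
theorem cexp_le_iff {N : ℤ} (hN : 0 < N) {τ i m : ℤ} : cexp N τ i ≤ m ↔ τ ≤ i + N * m := by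
  rw [cexp, neg_le, Int.le_ediv_iff_mul_le hN]
  constructor <;> intro h <;> linarith

theorem le_add_cexp {N : ℤ} (hN : 0 < N) (τ i : ℤ) : τ ≤ i + N * cexp N τ i :=
  (cexp_le_iff hN).1 le_rfl

theorem cexp_add_self {N : ℤ} (hN : 0 < N) (τ i : ℤ) : cexp N τ (i + N) = cexp N τ i - 1 := by
  unfold cexp
  rw [show i + N - τ = i - τ + N by ring, Int.add_ediv_of_dvd_right (dvd_refl N),
    Int.ediv_self hN.ne']
  ring

theorem cexp_anti {N : ℤ} (hN : 0 < N) (τ : ℤ) {i i' : ℤ} (h : i ≤ i') :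
    cexp N τ i' ≤ cexp N τ i :=
  (cexp_le_iff hN).2 ((le_add_cexp hN τ i).trans (by linarith))

/-- If `(τ - i)/N` is not an integer, raising the numerator by one does not pass the next integer.
This is what lets the projections in `exists_hypSystem` drop one step of the standard chain. -/
theorem cexp_sub_one_le {N : ℤ} (hN : 0 < N) {τ i : ℤ} (h : ¬ N ∣ τ - i) :
    cexp N τ (i - 1) ≤ cexp N τ i := by
  rw [cexp_le_iff hN]
  have h1 := le_add_cexp hN τ i
  have h2 : τ ≠ i + N * cexp N τ i := fun h0 => h ⟨cexp N τ i, by linarith⟩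
  omega

/-- With `a = τ - i` the second term is `e + ⌈(1 - N - a)/N⌉`, and `⌈(1 - N - a)/N⌉ = -⌈a/N⌉`. This
becomes the duality condition of the alcove with thresholds `τ`. -/
theorem cexp_add_cexp_neg {N : ℤ} (hN : 0 < N) {τ τ' e : ℤ} (h : τ + τ' = N * e + 1 - N) (i : ℤ) :
    cexp N τ i + cexp N τ' (-i) = e := by
  refine le_antisymm ?_ ?_
  · have h1 : cexp N τ' (-i) ≤ e - cexp N τ i := by
      rw [cexp_le_iff hN]
      have h2 : ¬ cexp N τ i ≤ cexp N τ i - 1 := by omega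
      rw [cexp_le_iff hN] at h2
      nlinarith
    linarith
  · have h1 : ¬ cexp N τ' (-i) ≤ e - cexp N τ i - 1 := by
      rw [cexp_le_iff hN]
      have h2 := le_add_cexp hN τ i
      intro h3
      nlinarith
    omega

/-- Counting `j` from `0`, the vector `e_j` belongs to `Λ̃_i` exactly from `i = j + 1 - 2n` on. This
describes the standard chain by thresholds, in the form required by `eq_smul_diagChain`. -/
theorem omega_eq_cexp (i : ℤ) (j : Fin (2 * n)) :
    omega n i j = cexp (2 * n : ℕ) (j + 1 - (2 * n : ℕ)) i := by
  have hj := j.2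
  unfold omega cexp
  generalize hN : ((2 * n : ℕ) : ℤ) = N
  have hN0 : 0 < N := by omega
  have h1 := Int.emod_add_mul_ediv i N
  have h3 := Int.emod_nonneg i hN0.ne'
  have h4 := Int.emod_lt_of_pos i hN0
  set q := i / N
  set r := i % N
  have key : (i - (j + 1 - N)) / N = q + if (j : ℤ) < r then 1 else 0 := by
    rw [show i - ((j : ℤ) + 1 - N) = (r - j - 1 + N) + N * q by linarith,
      Int.add_mul_ediv_left _ _ hN0.ne']
    split_ifs with h
    · rw [show r - (j : ℤ) - 1 + N = (r - j - 1) + N * 1 by ring,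
        Int.add_mul_ediv_left _ _ hN0.ne', Int.ediv_eq_zero_of_lt (by omega) (by omega)]
      ring
    · rw [Int.ediv_eq_zero_of_lt (by omega) (by omega)]
      ring
  rw [key]
  ring

/-- A periodic lattice chain `(M_i)` with `M_i^∨ = M_{c - i}`. -/
structure IsDualChain (c : ℤ) (M : ℤ → Submodule 𝔽⟦X⟧ (Fin (2 * n) → 𝔽⸨X⸩)) : Prop where
  mono : ∀ i, M i ≤ M (i + 1)
  periodic : ∀ (i : ℤ) (x : Fin (2 * n) → 𝔽⸨X⸩), x ∈ M (i + (2 * n : ℕ)) ↔ (upow 1 : 𝔽⸨X⸩) • x ∈ M i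
  pairing : ∀ i, ∀ x ∈ M i, ∀ y ∈ M (c - i), symp n 𝔽⸨X⸩ x y ∈ fracIdeal 𝔽 0
  dual : ∀ i y, (∀ x ∈ M i, symp n 𝔽⸨X⸩ x y ∈ fracIdeal 𝔽 0) → y ∈ M (c - i)

namespace IsDualChain

variable {c : ℤ} {M : ℤ → Submodule 𝔽⟦X⟧ (Fin (2 * n) → 𝔽⸨X⸩)} (hM : IsDualChain c M)
include hM

theorem monotone : Monotone M := monotone_int_of_le_succ hM.mono

theorem upow_smul_mem_iff (q i : ℤ) (x : Fin (2 * n) → 𝔽⸨X⸩) :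
    (upow q : 𝔽⸨X⸩) • x ∈ M (i - (2 * n : ℕ) * q) ↔ x ∈ M i := by
  induction q using Int.induction_on generalizing i with
  | zero => simp [upow_zero]
  | succ k ih =>
    rw [upow_add, mul_comm (upow (k : ℤ)), mul_smul, ← hM.periodic,
      show i - (2 * n : ℕ) * ((k : ℤ) + 1) + (2 * n : ℕ) = i - (2 * n : ℕ) * k by ring, ih]
  | pred k ih =>
    rw [← ih i, show i - (2 * n : ℕ) * (-(k : ℤ) - 1) = i - (2 * n : ℕ) * (-(k : ℤ)) + (2 * n : ℕ)
      by ring, hM.periodic, ← mul_smul, ← upow_add, add_sub_cancel]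

theorem upow_smul_mem {q i k : ℤ} {x : Fin (2 * n) → 𝔽⸨X⸩} (hx : x ∈ M i)
    (h : i ≤ k + (2 * n : ℕ) * q) : (upow q : 𝔽⸨X⸩) • x ∈ M k :=
  hM.monotone (by linarith) ((hM.upow_smul_mem_iff q i x).2 hx)

theorem fracIdeal_smul_mem {q i k : ℤ} {x : Fin (2 * n) → 𝔽⸨X⸩} {z : 𝔽⸨X⸩} (hx : x ∈ M i)
    (h : i ≤ k + (2 * n : ℕ) * q) (hz : z ∈ fracIdeal 𝔽 q) : z • x ∈ M k := by
  obtain ⟨c, rfl⟩ := mem_fracIdeal.1 hz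
  rw [smul_assoc]
  exact Submodule.smul_mem _ _ (hM.upow_smul_mem hx h)

theorem pairing_mem {i k q : ℤ} {x y : Fin (2 * n) → 𝔽⸨X⸩} (hx : x ∈ M i) (hy : y ∈ M k)
    (h : i + k + (2 * n : ℕ) * q ≤ c) : symp n 𝔽⸨X⸩ x y ∈ fracIdeal 𝔽 q := by
  have h1 := hM.pairing i x hx ((upow (-q) : 𝔽⸨X⸩) • y) (hM.upow_smul_mem hy (by linarith))
  rw [map_smul, smul_eq_mul, upow_mul_mem_fracIdeal] at h1
  simpa using h1

/-- For `w ∈ M_k` and `v' ∈ M_{c+1-a}` the order of `u (w, v')` is at least `cexp (2n) a k`, hence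
at least `cexp (2n) a l`, and that power of `u` carries `v ∈ M_a` into `M_l`. The `+ 1` in `a + a' =
c + 1` goes with the normalization `(v, v') = u^{-1}`. -/
theorem projection_mem (hn : 0 < n) {a a' k l : ℤ} {v v' w : Fin (2 * n) → 𝔽⸨X⸩} (hv : v ∈ M a)
    (hv' : v' ∈ M a') (haa : a + a' = c + 1) (hw : w ∈ M k)
    (hl : cexp (2 * n : ℕ) a l ≤ cexp (2 * n : ℕ) a k) :
    (upow 1 * symp n 𝔽⸨X⸩ w v') • v ∈ M l := by
  have hN : (0 : ℤ) < (2 * n : ℕ) := by omega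
  refine hM.fracIdeal_smul_mem hv (le_add_cexp hN a l) ?_
  rw [upow_mul_mem_fracIdeal]
  refine hM.pairing_mem hw hv' ?_
  have h2 : ¬ cexp (2 * n : ℕ) a k ≤ cexp (2 * n : ℕ) a l - 1 := by omega
  rw [cexp_le_iff hN] at h2
  linarith

end IsDualChain

end LatticeChains

end SymplecticLocalModel

namespace SymplecticLocalModel

/-! ### Hyperbolic pairs adapted to two self-dual chains. -/

section CommonBasis

variable {𝔽 : Type*} [Field 𝔽] {n : ℕ}

theorem mem_stdChain {i : ℤ} {x : Fin (2 * n) → 𝔽⸨X⸩} :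
    x ∈ stdChain n 𝔽 i ↔ ∀ j, x j ∈ fracIdeal 𝔽 (omega n i j) := mem_diagLattice

theorem omega_sub_omega_succ (i : ℤ) (j : Fin (2 * n)) :
    omega n i j - omega n (i + 1) j = if ((j : ℕ) : ℤ) = i % (2 * n : ℕ) then 1 else 0 := by
  have hj := j.2
  unfold omega
  generalize hN : ((2 * n : ℕ) : ℤ) = N
  have hN0 : 0 < N := by omega
  have h1 := Int.emod_add_mul_ediv i N
  have h3 := Int.emod_nonneg i hN0.ne'
  have h4 := Int.emod_lt_of_pos i hN0
  set q := i / N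
  set r := i % N
  rcases eq_or_ne (r + 1) N with h | h
  · have e1 : i + 1 = 0 + N * (q + 1) := by linarith
    rw [e1, Int.add_mul_ediv_left _ _ hN0.ne', Int.add_mul_emod_self_left]
    simp only [Int.zero_ediv, Int.zero_emod]
    split_ifs <;> omega
  · have e1 : i + 1 = (r + 1) + N * q := by linarith
    rw [e1, Int.add_mul_ediv_left _ _ hN0.ne', Int.add_mul_emod_self_left,
      Int.ediv_eq_zero_of_lt (by omega) (by omega), Int.emod_eq_of_lt (by omega) (by omega)]
    split_ifs <;> omega

/-- By `omega_neg` the exponents of `e_j` in `Λ̃_i` and of its partner in `Λ̃_{-i}` cancel, so the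
two bases are dual up to sign. -/
theorem isDualChain_stdChain : IsDualChain 0 (stdChain n 𝔽) where
  mono i x hx := mem_stdChain.2 fun j => fracIdeal_anti (omega_anti i j) (mem_stdChain.1 hx j)
  periodic i x := by
    simp only [mem_stdChain]
    refine forall_congr' fun j => ?_
    rw [Pi.smul_apply, smul_eq_mul, upow_mul_mem_fracIdeal, add_comm i, omega_add]
  pairing i x hx y hy := by
    rw [symp_eq_sum]
    refine Submodule.sum_mem _ fun j _ => ?_
    have h1 := mul_mem_fracIdeal (mem_stdChain.1 hx j) (mem_stdChain.1 hy (Fin.rev j))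
    have hv := Fin.val_rev j
    have hj := j.2
    rw [zero_sub, omega_neg i j (Fin.rev j) (by omega)] at h1
    unfold jsign
    split_ifs
    · simpa using h1
    · simpa using h1
  dual i y h := by
    refine mem_stdChain.2 fun j => ?_
    have hv := Fin.val_rev j
    have hj := j.2
    have h1 := h (Pi.single (Fin.rev j) (upow (omega n i (Fin.rev j))))
      (Submodule.subset_span ⟨_, rfl⟩)
    have h2 := omega_neg i (Fin.rev j) j (by omega)
    rw [symp_single_left, Fin.rev_rev] at h1
    have h3 : upow (omega n i (Fin.rev j)) * y j ∈ fracIdeal 𝔽 0 := by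
      unfold jsign at h1
      split_ifs at h1
      · simpa using h1
      · simpa using h1
    rw [upow_mul_mem_fracIdeal] at h3
    rwa [zero_sub, show omega n (-i) j = 0 - omega n i (Fin.rev j) by omega]

theorem exists_mem_stdChain_notMem (hn : 0 < n) (i : ℤ) :
    ∃ w, w ∈ stdChain n 𝔽 i ∧ w ∉ stdChain n 𝔽 (i - 1) := by
  have hN : (0 : ℤ) < (2 * n : ℕ) := by omega
  have h1 := Int.emod_nonneg (i - 1) hN.ne'
  have h2 := Int.emod_lt_of_pos (i - 1) hN
  -- The only coordinate in which `Λ̃_{i-1}` and `Λ̃_i` differ.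
  set j : Fin (2 * n) := ⟨((i - 1) % (2 * n : ℕ)).toNat, by omega⟩
  refine ⟨Pi.single j (upow (omega n i j)), Submodule.subset_span ⟨j, rfl⟩, fun h => ?_⟩
  have h3 := mem_stdChain.1 h j
  have h4 := omega_sub_omega_succ (i - 1) j
  rw [Pi.single_eq_same, upow_mem_fracIdeal_iff] at h3
  rw [if_pos (Int.toNat_of_nonneg h1), sub_add_cancel] at h4
  omega

/-- `Λ̃_i / Λ̃_{i-1}` is a line, concentrated in one coordinate, and any `w` outside `Λ̃_{i-1}`
generates it; `c` is the quotient of the two entries there. -/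
theorem exists_sub_smul_mem_stdChain {i : ℤ} {w y : Fin (2 * n) → 𝔽⸨X⸩}
    (hw : w ∈ stdChain n 𝔽 i) (hw' : w ∉ stdChain n 𝔽 (i - 1)) (hy : y ∈ stdChain n 𝔽 i) :
    ∃ c : 𝔽⟦X⟧, y - c • w ∈ stdChain n 𝔽 (i - 1) := by
  have hex : ∃ j, w j ∉ fracIdeal 𝔽 (omega n (i - 1) j) := by
    by_contra! h
    exact hw' (mem_stdChain.2 h)
  obtain ⟨j, hj⟩ := hex
  have hwj := mem_stdChain.1 hw j
  have hstep := fun k => omega_sub_omega_succ (n := n) (i - 1) k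
  simp only [sub_add_cancel] at hstep
  have hji : ((j : ℕ) : ℤ) = (i - 1) % (2 * n : ℕ) := by
    by_contra h0
    have := hstep j
    rw [if_neg h0, sub_eq_zero] at this
    exact hj (this ▸ hwj)
  have hsj : omega n (i - 1) j = omega n i j + 1 := by
    have := hstep j
    rw [if_pos hji] at this
    omega
  rw [hsj] at hj
  have hz := mul_mem_fracIdeal (mem_stdChain.1 hy j) (inv_mem_fracIdeal hwj hj)
  rw [add_neg_cancel] at hz
  obtain ⟨c, hc⟩ := mem_fracIdeal_zero.1 hz
  refine ⟨c, mem_stdChain.2 fun k => ?_⟩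
  rcases eq_or_ne k j with rfl | hk
  · have hw0 : w k ≠ 0 := fun h0 => hj (h0 ▸ Submodule.zero_mem _)
    rw [Pi.sub_apply, Pi.smul_apply, Algebra.smul_def, hc, mul_assoc, inv_mul_cancel₀ hw0]
    simp
  · have hsk : omega n (i - 1) k = omega n i k := by
      have := hstep k
      rw [if_neg (fun h0 => hk (Fin.ext (by omega)))] at this
      omega
    rw [hsk]
    exact Submodule.sub_mem _ (mem_stdChain.1 hy k)
      (Submodule.smul_mem _ _ (mem_stdChain.1 hw k))

/-- The form pairs the lines `Λ̃_i/Λ̃_{i-1}` and `Λ̃_{1-i}/Λ̃_{-i}` perfectly into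
`u^{-1}𝔽⟦u⟧/𝔽⟦u⟧`: if `(w, w')` were integral, `w'` would pair integrally with `𝔽⟦u⟧ w + Λ̃_{i-1} =
Λ̃_i` and so lie in the dual lattice `Λ̃_{-i}`. -/
theorem symp_mem_and_notMem {i : ℤ} (hn : 0 < n) {w w' : Fin (2 * n) → 𝔽⸨X⸩}
    (hw : w ∈ stdChain n 𝔽 i) (hw1 : w ∉ stdChain n 𝔽 (i - 1))
    (hw' : w' ∈ stdChain n 𝔽 (1 - i)) (hw1' : w' ∉ stdChain n 𝔽 (-i)) :
    symp n 𝔽⸨X⸩ w w' ∈ fracIdeal 𝔽 (-1) ∧ symp n 𝔽⸨X⸩ w w' ∉ fracIdeal 𝔽 0 := by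
  have hS := isDualChain_stdChain (𝔽 := 𝔽) (n := n)
  refine ⟨hS.pairing_mem hw hw' (by omega), fun h => hw1' ?_⟩
  have := hS.dual i w' fun x hx => ?_
  · rwa [zero_sub] at this
  · obtain ⟨c, hc⟩ := exists_sub_smul_mem_stdChain hw hw1 hx
    have h1 := hS.pairing_mem (q := 0) hc hw' (by omega)
    have h2 : symp n 𝔽⸨X⸩ x w' = symp n 𝔽⸨X⸩ (x - c • w) w' + c • symp n 𝔽⸨X⸩ w w' := by
      rw [map_sub, LinearMap.sub_apply, LinearMap.map_smul_of_tower, LinearMap.smul_apply]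
      abel
    rw [h2]
    exact Submodule.add_mem _ h1 (Submodule.smul_mem _ _ h)

instance isLattice_diagLattice (a : Fin (2 * n) → ℤ) :
    Submodule.IsLattice 𝔽⸨X⸩ (diagLattice a : Submodule 𝔽⟦X⟧ (Fin (2 * n) → 𝔽⸨X⸩)) where
  fg := Submodule.fg_span (Set.finite_range _)
  span_eq_top := by
    rw [eq_top_iff]
    intro x _
    have hx : x = ∑ j, (x j * upow (-a j)) • (Pi.single j (upow (a j)) : Fin (2 * n) → 𝔽⸨X⸩) := by
      ext k
      simp only [Finset.sum_apply, Pi.smul_apply, Pi.single_apply, smul_ite, smul_zero,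
        Finset.sum_ite_eq, Finset.mem_univ, if_true]
      rw [smul_eq_mul, mul_assoc, mul_comm (upow _), upow_mul_upow_neg, mul_one]
    rw [hx]
    exact Submodule.sum_mem _ fun j _ => Submodule.smul_mem _ _
      (Submodule.subset_span (Submodule.subset_span ⟨j, rfl⟩))

theorem symp_nondegenerate {K : Type*} [Field K] : (symp n K).Nondegenerate :=
  LinearMap.BilinForm.nondegenerate_toBilin'_of_det_ne_zero' _ isUnit_det_Jmat.ne_zero

/-- Biduality of lattices: `M` is free over `𝔽⟦u⟧`, and taking the dual basis twice returns the
basis. -/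
theorem mem_of_forall_dual (M : Submodule 𝔽⟦X⟧ (Fin (2 * n) → 𝔽⸨X⸩))
    [Submodule.IsLattice 𝔽⸨X⸩ M] (y : Fin (2 * n) → 𝔽⸨X⸩)
    (h : ∀ x, (∀ m ∈ M, symp n 𝔽⸨X⸩ x m ∈ fracIdeal 𝔽 0) → symp n 𝔽⸨X⸩ x y ∈ fracIdeal 𝔽 0) :
    y ∈ M := by
  have h1 : ∀ z : 𝔽⸨X⸩, z ∈ (1 : Submodule 𝔽⟦X⟧ 𝔽⸨X⸩) ↔ z ∈ fracIdeal 𝔽 0 := fun z => by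
    rw [Submodule.mem_one, mem_fracIdeal_zero]
  let b := (Module.Free.chooseBasis 𝔽⟦X⟧ M)
  let b' := b.extendOfIsLattice 𝔽⸨X⸩
  have hb : Submodule.span 𝔽⟦X⟧ (Set.range b') = M := by
    have : (b' : _ → Fin (2 * n) → 𝔽⸨X⸩) = M.subtype ∘ b := by
      ext k : 1
      exact Module.Basis.extendOfIsLattice_apply 𝔽⸨X⸩ b k
    rw [this, Set.range_comp, ← Submodule.map_span, b.span_eq, Submodule.map_top,
      Submodule.range_subtype]
  have key := LinearMap.BilinForm.dualSubmodule_flip_dualSubmodule_of_basis (R := 𝔽⟦X⟧)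
    (symp n 𝔽⸨X⸩) symp_nondegenerate b'
  rw [hb] at key
  rw [← key, LinearMap.BilinForm.mem_dualSubmodule]
  intro x hx
  rw [h1]
  exact h x fun m hm => (h1 _).1 (hx m hm)

variable {c : ℤ} {L : ℤ → Submodule 𝔽⟦X⟧ (Fin (2 * n) → 𝔽⸨X⸩)}

/-- Obtained by dualizing `L_{c-i} ⊆ Λ̃_{c-i}`. -/
theorem IsDualChain.stdChain_sub_le (hL : IsDualChain c L) (hup : ∀ i, L i ≤ stdChain n 𝔽 i)
    (i : ℤ) : stdChain n 𝔽 (i - c) ≤ L i := by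
  intro y hy
  have := hL.dual (c - i) y fun x hx => isDualChain_stdChain.pairing_mem (hup _ hx) hy (by omega)
  rwa [sub_sub_cancel] at this

/-- Take `k` minimal such that `L_k` contains a generator `w` of `Λ̃_i/Λ̃_{i-1}`. Minimality means
`Λ̃_i ∩ L_{k-1} ⊆ Λ̃_{i-1}`; dually `Λ̃_{1-i} ⊆ Λ̃_{-i} + L_{c+1-k}`, so the dual line has a
generator `w'` in `L_{c+1-k}`. These are the complementary positions that `projection_mem` needs. -/
theorem IsDualChain.exists_adapted_pair (hn : 0 < n) (hL : IsDualChain c L)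
    (hup : ∀ i, L i ≤ stdChain n 𝔽 i) (i : ℤ) :
    ∃ k w w', w ∈ stdChain n 𝔽 i ∧ w ∉ stdChain n 𝔽 (i - 1) ∧ w ∈ L k ∧
      w' ∈ stdChain n 𝔽 (1 - i) ∧ w' ∉ stdChain n 𝔽 (-i) ∧ w' ∈ L (c + 1 - k) := by
  have hS := isDualChain_stdChain (𝔽 := 𝔽) (n := n)
  -- The set of such `k` is bounded below by `i` because `L_z ⊆ Λ̃_z`, and contains `i + c` because
  -- `Λ̃_i ⊆ L_{i+c}`.
  obtain ⟨k, ⟨w, hw, hw1, hwL⟩, hk⟩ := Int.exists_least_of_bdd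
    (P := fun k => ∃ w, w ∈ stdChain n 𝔽 i ∧ w ∉ stdChain n 𝔽 (i - 1) ∧ w ∈ L k)
    ⟨i, fun z ⟨w, _, h1, h2⟩ => by
      by_contra hz
      exact h1 (hS.monotone (show z ≤ i - 1 by omega) (hup _ h2))⟩
    (by
      obtain ⟨w, h1, h2⟩ := exists_mem_stdChain_notMem (𝔽 := 𝔽) hn i
      refine ⟨i + c, w, h1, h2, hL.stdChain_sub_le hup _ ?_⟩
      rwa [add_sub_cancel_right])
  obtain ⟨w0, hw0, hw0'⟩ := exists_mem_stdChain_notMem (𝔽 := 𝔽) hn (1 - i)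
  have hfg : (stdChain n 𝔽 (-i) ⊔ L (c + 1 - k)).FG := by
    have hle : stdChain n 𝔽 (-i) ⊔ L (c + 1 - k) ≤
        stdChain n 𝔽 (-i) ⊔ stdChain n 𝔽 (c + 1 - k) := sup_le_sup_left (hup _) _
    have h1 : (stdChain n 𝔽 (-i) ⊔ stdChain n 𝔽 (c + 1 - k)).FG :=
      Submodule.FG.sup (isLattice_diagLattice _).fg (isLattice_diagLattice _).fg
    have := isNoetherian_of_fg_of_noetherian _ h1
    exact Submodule.FG.of_le h1 hle
  have : Submodule.IsLattice 𝔽⸨X⸩ (stdChain n 𝔽 (-i)) := isLattice_diagLattice _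
  have : Submodule.IsLattice 𝔽⸨X⸩ (stdChain n 𝔽 (-i) ⊔ L (c + 1 - k)) :=
    Submodule.IsLattice.of_le_of_isLattice_of_fg _ le_sup_left hfg
  -- By biduality it suffices to pair `w0` with the dual of the sum, which lies in `Λ̃_i ∩ L_{k-1}`
  -- and hence in `Λ̃_{i-1}`.
  have hmem : w0 ∈ stdChain n 𝔽 (-i) ⊔ L (c + 1 - k) := by
    refine mem_of_forall_dual _ _ fun x hx => ?_
    have h1 : x ∈ stdChain n 𝔽 i := by
      have := hS.dual (-i) x fun m hm => by
        rw [symp_neg_swap]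
        exact Submodule.neg_mem _ (hx m (Submodule.mem_sup_left hm))
      rwa [zero_sub, neg_neg] at this
    have h2 : x ∈ L (k - 1) := by
      have := hL.dual (c + 1 - k) x fun m hm => by
        rw [symp_neg_swap]
        exact Submodule.neg_mem _ (hx m (Submodule.mem_sup_right hm))
      rwa [show c - (c + 1 - k) = k - 1 by ring] at this
    have h3 : x ∈ stdChain n 𝔽 (i - 1) := by
      by_contra h3
      have := hk _ ⟨x, h1, h3, h2⟩
      omega
    exact hS.pairing_mem h3 hw0 (by omega)
  obtain ⟨a, ha, b, hb, hab⟩ := Submodule.mem_sup.1 hmem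
  rw [show 1 - i - 1 = -i by ring] at hw0'
  have hba : b = w0 - a := by rw [← hab]; abel
  refine ⟨k, w, b, hw, hw1, hwL, ?_, fun h => hw0' ?_, hb⟩
  · rw [hba]
    exact Submodule.sub_mem _ hw0 (hS.monotone (by omega) ha)
  · rw [← hab]
    exact Submodule.add_mem _ ha h

end CommonBasis

end SymplecticLocalModel

namespace SymplecticLocalModel

/-! ### Gram–Schmidt for adapted hyperbolic pairs. -/

section GramSchmidt

variable {𝔽 : Type*} [Field 𝔽] {n : ℕ} {c : ℤ}
  {L : ℤ → Submodule 𝔽⟦X⟧ (Fin (2 * n) → 𝔽⸨X⸩)}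

/-- The orthogonal projection to the span of the hyperbolic pairs `(v_j, v'_j)`, `j < m`, where
`(v_j, v'_j) = u^{-1}`. -/
def hypProj (m : ℕ) (v v' : ℕ → Fin (2 * n) → 𝔽⸨X⸩) (w : Fin (2 * n) → 𝔽⸨X⸩) :
    Fin (2 * n) → 𝔽⸨X⸩ :=
  ∑ j ∈ Finset.range m, ((upow 1 * symp n 𝔽⸨X⸩ w (v' j)) • v j -
    (upow 1 * symp n 𝔽⸨X⸩ w (v j)) • v' j)

/-- The pairs `(v_j, v'_j)`, `j < m`, are orthogonal hyperbolic pairs with `(v_j, v'_j) = u^{-1}`. -/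
structure IsHypSystem (m : ℕ) (v v' : ℕ → Fin (2 * n) → 𝔽⸨X⸩) : Prop where
  left : ∀ j < m, ∀ k < m, symp n 𝔽⸨X⸩ (v j) (v k) = 0
  right : ∀ j < m, ∀ k < m, symp n 𝔽⸨X⸩ (v' j) (v' k) = 0
  mixed : ∀ j < m, ∀ k < m, symp n 𝔽⸨X⸩ (v j) (v' k) = if j = k then upow (-1) else 0

theorem IsHypSystem.sub_hypProj_left {m : ℕ} {v v' : ℕ → Fin (2 * n) → 𝔽⸨X⸩}
    (h : IsHypSystem m v v') (w : Fin (2 * n) → 𝔽⸨X⸩) {k : ℕ} (hk : k < m) :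
    symp n 𝔽⸨X⸩ (w - hypProj m v v' w) (v k) = 0 := by
  rw [map_sub, LinearMap.sub_apply, hypProj, map_sum, LinearMap.sum_apply,
    Finset.sum_eq_single_of_mem k (Finset.mem_range.2 hk)]
  · rw [map_sub, LinearMap.sub_apply, map_smul, map_smul, LinearMap.smul_apply,
      LinearMap.smul_apply, h.left k hk k hk, symp_neg_swap (v k) (v' k), h.mixed k hk k hk, if_pos rfl]
    simp only [smul_eq_mul]
    linear_combination (-symp n 𝔽⸨X⸩ w (v k)) * upow_mul_upow_neg (𝔽 := 𝔽) 1
  · intro j hj hjk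
    rw [map_sub, LinearMap.sub_apply, map_smul, map_smul, LinearMap.smul_apply,
      LinearMap.smul_apply, h.left j (Finset.mem_range.1 hj) k hk, symp_neg_swap (v k) (v' j),
      h.mixed k hk j (Finset.mem_range.1 hj), if_neg hjk.symm]
    simp

theorem IsHypSystem.sub_hypProj_right {m : ℕ} {v v' : ℕ → Fin (2 * n) → 𝔽⸨X⸩}
    (h : IsHypSystem m v v') (w : Fin (2 * n) → 𝔽⸨X⸩) {k : ℕ} (hk : k < m) :
    symp n 𝔽⸨X⸩ (w - hypProj m v v' w) (v' k) = 0 := by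
  rw [map_sub, LinearMap.sub_apply, hypProj, map_sum, LinearMap.sum_apply,
    Finset.sum_eq_single_of_mem k (Finset.mem_range.2 hk)]
  · rw [map_sub, LinearMap.sub_apply, map_smul, map_smul, LinearMap.smul_apply,
      LinearMap.smul_apply, h.right k hk k hk, h.mixed k hk k hk, if_pos rfl]
    simp only [smul_eq_mul]
    linear_combination (-symp n 𝔽⸨X⸩ w (v' k)) * upow_mul_upow_neg (𝔽 := 𝔽) 1
  · intro j hj hjk
    rw [map_sub, LinearMap.sub_apply, map_smul, map_smul, LinearMap.smul_apply,
      LinearMap.smul_apply, h.right j (Finset.mem_range.1 hj) k hk,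
      h.mixed j (Finset.mem_range.1 hj) k hk, if_neg hjk]
    simp

theorem IsDualChain.hypProj_mem (hL : IsDualChain c L) (hn : 0 < n) {m : ℕ}
    {v v' : ℕ → Fin (2 * n) → 𝔽⸨X⸩} {κ : ℕ → ℤ} (hv : ∀ j < m, v j ∈ L (κ j))
    (hv' : ∀ j < m, v' j ∈ L (c + 1 - κ j)) {k l : ℤ} {w : Fin (2 * n) → 𝔽⸨X⸩} (hw : w ∈ L k)
    (h1 : ∀ j < m, cexp (2 * n : ℕ) (κ j) l ≤ cexp (2 * n : ℕ) (κ j) k)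
    (h2 : ∀ j < m, cexp (2 * n : ℕ) (c + 1 - κ j) l ≤ cexp (2 * n : ℕ) (c + 1 - κ j) k) :
    hypProj m v v' w ∈ L l := by
  refine Submodule.sum_mem _ fun j hj => ?_
  have hj := Finset.mem_range.1 hj
  exact Submodule.sub_mem _
    (hL.projection_mem hn (hv j hj) (hv' j hj) (by omega) hw (h1 j hj))
    (hL.projection_mem hn (hv' j hj) (hv j hj) (by omega) hw (h2 j hj))

theorem not_dvd_of_abs_lt {N a : ℤ} (h0 : a ≠ 0) (h1 : a < N) (h2 : -N < a) : ¬ N ∣ a :=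
  fun h => h0 (Int.eq_zero_of_abs_lt_dvd h (abs_lt.2 ⟨h2, h1⟩))

/-- Induction on the number of pairs: an adapted pair for the next step of the standard chain is
made orthogonal to the earlier ones. The projection preserves the members of `L` and drops one step
in the standard chain, so the new vectors still generate their lines, and their pairing can be
normalized to `u^{-1}`. -/
theorem IsDualChain.exists_hypSystem (hL : IsDualChain c L)
    (hup : ∀ i, L i ≤ stdChain n 𝔽 i) (m : ℕ) (hm : m ≤ n) :
    ∃ (v v' : ℕ → Fin (2 * n) → 𝔽⸨X⸩) (κ : ℕ → ℤ), IsHypSystem m v v' ∧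
      ∀ j < m, v j ∈ stdChain n 𝔽 (j + 1) ∧ v' j ∈ stdChain n 𝔽 (-j) ∧
        v j ∈ L (κ j) ∧ v' j ∈ L (c + 1 - κ j) := by
  induction m with
  | zero => exact ⟨0, 0, 0, ⟨by simp, by simp, by simp⟩, by simp⟩
  | succ m ih =>
    obtain ⟨v, v', κ, hs, hv⟩ := ih (by omega)
    have hn : 0 < n := by omega
    have hN : (0 : ℤ) < (2 * n : ℕ) := by omega
    have hS := isDualChain_stdChain (𝔽 := 𝔽) (n := n)
    obtain ⟨k, w, w', hw, hw1, hwL, hw', hw1', hwL'⟩ := hL.exists_adapted_pair hn hup (m + 1)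
    rw [show (1 : ℤ) - (m + 1) = -m by ring] at hw'
    rw [show (m : ℤ) + 1 - 1 = m by ring] at hw1
    have hS' : ∀ j < m, v' j ∈ stdChain n 𝔽 (0 + 1 - ((j : ℤ) + 1)) := fun j hj => by
      rw [show (0 : ℤ) + 1 - (j + 1) = -j by ring]
      exact (hv j hj).2.1
    -- For `j < m < n` neither `j + 1` nor `-j` is congruent to `m + 1` modulo `2n`, so `cexp` does
    -- not grow from index `m + 1` to index `m`.
    have hP : hypProj m v v' w ∈ stdChain n 𝔽 m := by
      refine hS.hypProj_mem hn (κ := fun j => j + 1) (fun j hj => (hv j hj).1) hS' hw ?_ ?_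
      · intro j hj
        have := cexp_sub_one_le hN (τ := (j : ℤ) + 1) (i := m + 1)
          (not_dvd_of_abs_lt (by omega) (by omega) (by omega))
        rwa [add_sub_cancel_right] at this
      · intro j hj
        have := cexp_sub_one_le hN (τ := 0 + 1 - ((j : ℤ) + 1)) (i := m + 1)
          (not_dvd_of_abs_lt (by omega) (by omega) (by omega))
        rwa [add_sub_cancel_right] at this
    have hP' : hypProj m v v' w' ∈ stdChain n 𝔽 (-(m + 1)) := by
      refine hS.hypProj_mem hn (κ := fun j => j + 1) (fun j hj => (hv j hj).1) hS' hw' ?_ ?_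
      · intro j hj
        have := cexp_sub_one_le hN (τ := (j : ℤ) + 1) (i := -m)
          (not_dvd_of_abs_lt (by omega) (by omega) (by omega))
        rwa [show -(m : ℤ) - 1 = -(m + 1) by ring] at this
      · intro j hj
        have := cexp_sub_one_le hN (τ := 0 + 1 - ((j : ℤ) + 1)) (i := -m)
          (not_dvd_of_abs_lt (by omega) (by omega) (by omega))
        rwa [show -(m : ℤ) - 1 = -(m + 1) by ring] at this
    have hPL : hypProj m v v' w ∈ L k :=
      hL.hypProj_mem hn (fun j hj => (hv j hj).2.2.1) (fun j hj => (hv j hj).2.2.2) hwL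
        (fun _ _ => le_rfl) (fun _ _ => le_rfl)
    have hPL' : hypProj m v v' w' ∈ L (c + 1 - k) :=
      hL.hypProj_mem hn (fun j hj => (hv j hj).2.2.1) (fun j hj => (hv j hj).2.2.2) hwL'
        (fun _ _ => le_rfl) (fun _ _ => le_rfl)
    set x := w - hypProj m v v' w with hx
    set x' := w' - hypProj m v v' w' with hx'
    have hxS : x ∈ stdChain n 𝔽 (m + 1) := Submodule.sub_mem _ hw (hS.mono _ hP)
    have hxS' : x' ∈ stdChain n 𝔽 (-m) :=
      Submodule.sub_mem _ hw' (hS.monotone (by omega) hP')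
    obtain ⟨hq, hq'⟩ := symp_mem_and_notMem (i := m + 1) hn hxS
      (by
        rw [add_sub_cancel_right]
        exact fun h => hw1 ((Submodule.sub_mem_iff_left _ hP).1 h))
      (by rwa [show (1 : ℤ) - (m + 1) = -m by ring])
      (fun h => hw1' ((Submodule.sub_mem_iff_left _ hP').1 h))
    obtain ⟨r, hr⟩ := eq_unit_smul_upow hq hq'
    -- The pairing of `x` and `x'` has exact order `-1`; removing its unit part keeps `x'` in the
    -- same lattices.
    set y := ((r⁻¹ : 𝔽⟦X⟧ˣ) : 𝔽⟦X⟧) • x' with hy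
    have hsmul : ∀ (a : 𝔽⟦X⟧) (z z' : Fin (2 * n) → 𝔽⸨X⸩),
        symp n 𝔽⸨X⸩ (a • z) z' = a • symp n 𝔽⸨X⸩ z z' := fun a z z' => by
      rw [LinearMap.map_smul_of_tower, LinearMap.smul_apply]
    have hxy : symp n 𝔽⸨X⸩ x y = upow (-1) := by
      rw [hy, LinearMap.map_smul_of_tower, hr, smul_smul, Units.inv_mul, one_smul]
    have hxv : ∀ j < m, symp n 𝔽⸨X⸩ x (v j) = 0 := fun j hj => hs.sub_hypProj_left w hj
    have hxv' : ∀ j < m, symp n 𝔽⸨X⸩ x (v' j) = 0 := fun j hj => hs.sub_hypProj_right w hj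
    have hyv : ∀ j < m, symp n 𝔽⸨X⸩ y (v j) = 0 := fun j hj => by
      rw [hy, hsmul, hs.sub_hypProj_left w' hj, smul_zero]
    have hyv' : ∀ j < m, symp n 𝔽⸨X⸩ y (v' j) = 0 := fun j hj => by
      rw [hy, hsmul, hs.sub_hypProj_right w' hj, smul_zero]
    refine ⟨Function.update v m x, Function.update v' m y, Function.update κ m k,
      ⟨?_, ?_, ?_⟩, ?_⟩
    · intro j hj i hi
      rcases eq_or_ne j m with hjm | hjm <;> rcases eq_or_ne i m with him | him
      · simp [hjm, him, symp_self]
      · simp [hjm, Function.update_of_ne him, hxv i (by omega)]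
      · simp [him, Function.update_of_ne hjm, symp_neg_swap x (v j), hxv j (by omega)]
      · simp [Function.update_of_ne him, Function.update_of_ne hjm,
          hs.left j (by omega) i (by omega)]
    · intro j hj i hi
      rcases eq_or_ne j m with hjm | hjm <;> rcases eq_or_ne i m with him | him
      · simp [hjm, him, symp_self]
      · simp [hjm, Function.update_of_ne him, hyv' i (by omega)]
      · simp [him, Function.update_of_ne hjm, symp_neg_swap y (v' j), hyv' j (by omega)]
      · simp [Function.update_of_ne him, Function.update_of_ne hjm,
          hs.right j (by omega) i (by omega)]
    · intro j hj i hi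
      rcases eq_or_ne j m with hjm | hjm <;> rcases eq_or_ne i m with him | him
      · simp [hjm, him, hxy]
      · simp [hjm, Function.update_of_ne him, hxv' i (by omega), him.symm]
      · simp [him, symp_neg_swap y (v j), hyv j (by omega), hjm]
      · simp [Function.update_of_ne him, Function.update_of_ne hjm,
          hs.mixed j (by omega) i (by omega)]
    · intro j hj
      rcases eq_or_ne j m with rfl | hjm
      · simp only [Function.update_self]
        exact ⟨hxS, Submodule.smul_mem _ _ hxS', Submodule.sub_mem _ hwL hPL,
          Submodule.smul_mem _ _ (Submodule.sub_mem _ hwL' hPL')⟩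
      · simp only [Function.update_of_ne hjm]
        exact hv j (by omega)

end GramSchmidt

end SymplecticLocalModel

namespace SymplecticLocalModel

/-! ### The group action on chains and the common symplectic basis. -/

section GroupAction

variable {𝔽 : Type*} [Field 𝔽] {n : ℕ}

theorem mem_smul_chain {g : GSp n 𝔽⸨X⸩} {M : Chain n 𝔽} {i : ℤ} {y : Fin (2 * n) → 𝔽⸨X⸩} :
    y ∈ (g • M) i ↔ ∃ x ∈ M i, (g : GL (Fin (2 * n)) 𝔽⸨X⸩).val.mulVec x = y := Iff.rfl

theorem GSp.mulVec_inv_mulVec (g : GSp n 𝔽⸨X⸩) (x : Fin (2 * n) → 𝔽⸨X⸩) :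
    (g : GL (Fin (2 * n)) 𝔽⸨X⸩).val.mulVec
      (((g⁻¹ : GSp n 𝔽⸨X⸩) : GL (Fin (2 * n)) 𝔽⸨X⸩).val.mulVec x) = x := by
  rw [Matrix.mulVec_mulVec, ← Units.val_mul, ← Subgroup.coe_mul, mul_inv_cancel]
  simp

theorem GSp.inv_mulVec_mulVec (g : GSp n 𝔽⸨X⸩) (x : Fin (2 * n) → 𝔽⸨X⸩) :
    ((g⁻¹ : GSp n 𝔽⸨X⸩) : GL (Fin (2 * n)) 𝔽⸨X⸩).val.mulVec
      ((g : GL (Fin (2 * n)) 𝔽⸨X⸩).val.mulVec x) = x := by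
  rw [Matrix.mulVec_mulVec, ← Units.val_mul, ← Subgroup.coe_mul, inv_mul_cancel]
  simp

theorem mulVec_mem_smul_chain_iff {g : GSp n 𝔽⸨X⸩} {M : Chain n 𝔽} {i : ℤ}
    {x : Fin (2 * n) → 𝔽⸨X⸩} :
    (g : GL (Fin (2 * n)) 𝔽⸨X⸩).val.mulVec x ∈ (g • M) i ↔ x ∈ M i := by
  refine ⟨fun h => ?_, fun h => ⟨x, h, rfl⟩⟩
  obtain ⟨x', hx', h⟩ := mem_smul_chain.1 h
  rw [← GSp.inv_mulVec_mulVec g x, ← h, GSp.inv_mulVec_mulVec]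
  exact hx'

theorem mem_Iwahori_iff {g : GSp n 𝔽⸨X⸩} : g ∈ Iwahori n 𝔽 ↔ g • stdChain n 𝔽 = stdChain n 𝔽 :=
  MulAction.mem_stabilizer_iff

theorem flag_injective : Function.Injective (flag : GSp n 𝔽⸨X⸩ ⧸ Iwahori n 𝔽 → Chain n 𝔽) :=
  MulAction.injective_ofQuotientStabilizer _ _

theorem mem_orbit_Iwahori_iff {x y : GSp n 𝔽⸨X⸩ ⧸ Iwahori n 𝔽} :
    y ∈ MulAction.orbit (Iwahori n 𝔽) x ↔ ∃ g ∈ Iwahori n 𝔽, flag y = g • flag x := by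
  obtain ⟨a, rfl⟩ := QuotientGroup.mk_surjective x
  have h : ∀ g : Iwahori n 𝔽, flag (g • (QuotientGroup.mk a : GSp n 𝔽⸨X⸩ ⧸ Iwahori n 𝔽)) =
      (g : GSp n 𝔽⸨X⸩) • flag (QuotientGroup.mk a) := fun g => mul_smul (g : GSp n 𝔽⸨X⸩) a _
  constructor
  · rintro ⟨g, rfl⟩
    exact ⟨g, g.2, h g⟩
  · rintro ⟨g, hg, hy⟩
    exact ⟨⟨g, hg⟩, flag_injective ((h ⟨g, hg⟩).trans hy.symm)⟩

theorem toDouble_eq_iff {x y : GSp n 𝔽⸨X⸩ ⧸ Iwahori n 𝔽} :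
    toDouble x = toDouble y ↔ x ∈ MulAction.orbit (Iwahori n 𝔽) y :=
  Quotient.eq''

/-- The chain of lattices with bases `(u^{x_i(j)} e_j)_j`. -/
def diagChain (𝔽 : Type*) [Field 𝔽] {n : ℕ} (x : ℤ → Fin (2 * n) → ℤ) : Chain n 𝔽 :=
  fun i => diagLattice (x i)

theorem diagChain_injective :
    Function.Injective (diagChain 𝔽 : (ℤ → Fin (2 * n) → ℤ) → Chain n 𝔽) :=
  fun _ _ h => funext fun i => diagLattice_injective (congrFun h i)

theorem stdChain_eq_diagChain : stdChain n 𝔽 = diagChain 𝔽 (omega n) := rfl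

theorem smul_chain_mono {g : GSp n 𝔽⸨X⸩} {M M' : Chain n 𝔽} {i k : ℤ} (h : M i ≤ M' k) :
    (g • M) i ≤ (g • M') k := Submodule.map_mono h

theorem smul_chain_le_sup_iff {g : GSp n 𝔽⸨X⸩} {M M' M'' : Chain n 𝔽} {i k l : ℤ} :
    (g • M) i ≤ (g • M') k ⊔ (g • M'') l ↔ M i ≤ M' k ⊔ M'' l := by
  have h : (g • M') k ⊔ (g • M'') l = (M' k ⊔ M'' l).map ((Matrix.mulVecLin
      (g : GL (Fin (2 * n)) 𝔽⸨X⸩).val).restrictScalars 𝔽⟦X⟧) :=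
    (Submodule.map_sup _ _ _).symm
  rw [h]
  refine Submodule.map_le_map_iff_of_injective (fun x y hxy => ?_) _ _
  have hxy : (g : GL (Fin (2 * n)) 𝔽⸨X⸩).val.mulVec x =
    (g : GL (Fin (2 * n)) 𝔽⸨X⸩).val.mulVec y := hxy
  rw [← GSp.inv_mulVec_mulVec g x, hxy, GSp.inv_mulVec_mulVec]

theorem exists_GSp_of_symp {f : Fin (2 * n) → Fin (2 * n) → 𝔽⸨X⸩} {κ : 𝔽⸨X⸩ˣ}
    (hf : ∀ a b, symp n 𝔽⸨X⸩ (f a) (f b) = κ * Jmat n 𝔽⸨X⸩ a b) :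
    ∃ g : GSp n 𝔽⸨X⸩, (g : GL (Fin (2 * n)) 𝔽⸨X⸩).val = Matrix.of fun a b => f b a := by
  set A : Matrix (Fin (2 * n)) (Fin (2 * n)) 𝔽⸨X⸩ := Matrix.of fun a b => f b a
  have hA : A.transpose * Jmat n 𝔽⸨X⸩ * A = (κ : 𝔽⸨X⸩) • Jmat n 𝔽⸨X⸩ := by
    ext a b
    rw [transpose_mul_Jmat_mul_apply, Matrix.smul_apply, smul_eq_mul, ← hf a b]
    rfl
  have hdet : IsUnit A.det := by
    have h1 : IsUnit (A.transpose * Jmat n 𝔽⸨X⸩ * A).det := by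
      rw [hA, Matrix.det_smul]
      exact (κ.isUnit.pow _).mul isUnit_det_Jmat
    rw [Matrix.det_mul] at h1
    exact isUnit_of_mul_isUnit_right h1
  exact ⟨⟨Matrix.GeneralLinearGroup.mk'' A hdet, κ, hA⟩, rfl⟩

theorem mulVec_eq_sum_smul {f : Fin (2 * n) → Fin (2 * n) → 𝔽⸨X⸩} (x : Fin (2 * n) → 𝔽⸨X⸩) :
    (Matrix.of fun a b => f b a).mulVec x = ∑ j, x j • f j := by
  ext a
  simp [Matrix.mulVec, dotProduct, mul_comm]

variable {e : ℤ}

/-- The multiples `u^{⌈(τ_j - i)/2n⌉} f_j` lie in `M_i`. Conversely the coefficient of `f_j` in `y ∈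
M_i` is, up to sign, the pairing of `y` with `f_{rev j}`, and the condition on `τ` makes the order
bound exactly the same. -/
theorem IsDualChain.eq_smul_diagChain {M : ℤ → Submodule 𝔽⟦X⟧ (Fin (2 * n) → 𝔽⸨X⸩)}
    (hM : IsDualChain ((2 * n : ℕ) * e) M)
    {f : Fin (2 * n) → Fin (2 * n) → 𝔽⸨X⸩}
    (hf : ∀ a b, symp n 𝔽⸨X⸩ (f a) (f b) = Jmat n 𝔽⸨X⸩ a b) {τ : Fin (2 * n) → ℤ}
    (hτ : ∀ j, τ j + τ (Fin.rev j) = (2 * n : ℕ) * e + 1 - (2 * n : ℕ))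
    (hfM : ∀ j, f j ∈ M (τ j)) {g : GSp n 𝔽⸨X⸩}
    (hg : (g : GL (Fin (2 * n)) 𝔽⸨X⸩).val = Matrix.of fun a b => f b a) :
    M = g • diagChain 𝔽 fun i j => cexp (2 * n : ℕ) (τ j) i := by
  funext i
  ext y
  constructor
  · intro hy
    rw [mem_smul_chain, hg]
    refine ⟨_, ?_, by rw [← hg]; exact GSp.mulVec_inv_mulVec g y⟩
    set x := ((g⁻¹ : GSp n 𝔽⸨X⸩) : GL (Fin (2 * n)) 𝔽⸨X⸩).val.mulVec y with hx
    have hyx : y = ∑ k, x k • f k := by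
      rw [← mulVec_eq_sum_smul, ← hg, GSp.mulVec_inv_mulVec]
    refine mem_diagLattice.2 fun j => ?_
    have hN : (0 : ℤ) < (2 * n : ℕ) := by have := j.2; omega
    have h1 : symp n 𝔽⸨X⸩ y (f (Fin.rev j)) = x j * jsign n _ j := by
      rw [hyx, map_sum, LinearMap.sum_apply, Finset.sum_eq_single j]
      · rw [map_smul, LinearMap.smul_apply, hf, Jmat_apply, if_pos rfl, smul_eq_mul]
      · intro k _ hk
        rw [map_smul, LinearMap.smul_apply, hf, Jmat_apply,
          if_neg (fun h => hk (Fin.rev_injective h.symm)), smul_zero]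
      · simp
    have h2 : symp n 𝔽⸨X⸩ y (f (Fin.rev j)) ∈ fracIdeal 𝔽 (cexp (2 * n : ℕ) (τ j) i) := by
      refine hM.pairing_mem hy (hfM _) ?_
      have h3 : ¬ cexp (2 * n : ℕ) (τ j) i ≤ cexp (2 * n : ℕ) (τ j) i - 1 := by omega
      rw [cexp_le_iff hN] at h3
      have h4 := hτ j
      linarith
    rw [h1] at h2
    unfold jsign at h2
    split_ifs at h2
    · simpa using h2
    · simpa using h2
  · rintro ⟨x, hx, rfl⟩
    rw [LinearMap.restrictScalars_apply, Matrix.mulVecLin_apply, hg, mulVec_eq_sum_smul]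
    refine Submodule.sum_mem _ fun j _ => ?_
    have hN : (0 : ℤ) < (2 * n : ℕ) := by have := j.2; omega
    exact hM.fracIdeal_smul_mem (hfM j) (le_add_cexp hN _ _) (mem_diagLattice.1 hx j)

/-- A self-dual lattice chain below the standard one and the standard chain have a common
symplectic basis. -/
theorem IsDualChain.exists_common_basis {L : ℤ → Submodule 𝔽⟦X⟧ (Fin (2 * n) → 𝔽⸨X⸩)}
    (hL : IsDualChain ((2 * n : ℕ) * e) L) (hup : ∀ i, L i ≤ stdChain n 𝔽 i) :
    ∃ g ∈ Iwahori n 𝔽, ∃ τ : Fin (2 * n) → ℤ,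
      (∀ j, τ j + τ (Fin.rev j) = (2 * n : ℕ) * e + 1 - (2 * n : ℕ)) ∧
      L = g • diagChain 𝔽 fun i j => cexp (2 * n : ℕ) (τ j) i := by
  obtain ⟨v, v', κ, hs, hv⟩ := hL.exists_hypSystem hup n le_rfl
  have hS := isDualChain_stdChain (𝔽 := 𝔽) (n := n)
  -- The factor `u` cancels `(v_j, v'_j) = u^{-1}` and gives a standard symplectic basis. It moves
  -- `v_j` down by a full period, whence the shift by `2n` in `τ`.
  set f : Fin (2 * n) → Fin (2 * n) → 𝔽⸨X⸩ := fun j =>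
    if (j : ℕ) < n then (upow 1 : 𝔽⸨X⸩) • v j else v' (Fin.rev j) with hf
  set τ : Fin (2 * n) → ℤ := fun j =>
    if (j : ℕ) < n then κ j - (2 * n : ℕ) else (2 * n : ℕ) * e + 1 - κ (Fin.rev j) with hτ
  have hlt : ∀ j : Fin (2 * n), ¬ (j : ℕ) < n → (Fin.rev j : ℕ) < n := fun j hj => by
    have := Fin.val_rev j; omega
  have hlt' : ∀ j : Fin (2 * n), (j : ℕ) < n → ¬ (Fin.rev j : ℕ) < n := fun j hj => by
    have := Fin.val_rev j; omega
  have hff : ∀ a b, symp n 𝔽⸨X⸩ (f a) (f b) = Jmat n 𝔽⸨X⸩ a b := by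
    intro a b
    rw [Jmat_apply, jsign]
    by_cases ha : (a : ℕ) < n <;> by_cases hb : (b : ℕ) < n
    · have hne : b ≠ Fin.rev a := fun h => hlt' a ha (h ▸ hb)
      simp [hf, ha, hb, hs.left a ha b hb, hne]
    · simp only [hf, ha, hb, if_true, if_false, map_smul, LinearMap.smul_apply,
        hs.mixed a ha _ (hlt b hb)]
      by_cases h : b = Fin.rev a
      · simp [h, upow_mul_upow_neg]
      · rw [if_neg (fun h' => h ?_), if_neg h, smul_zero]
        rw [Fin.ext h', Fin.rev_rev]
    · simp only [hf, ha, hb, if_true, if_false, map_smul,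
        symp_neg_swap (v b), hs.mixed b hb _ (hlt a ha)]
      by_cases h : b = Fin.rev a
      · simp [h, upow_mul_upow_neg]
      · rw [if_neg (fun h' => h (Fin.ext h')), if_neg h, neg_zero, smul_zero]
    · have hne : b ≠ Fin.rev a := fun h => hb (h ▸ hlt a ha)
      rw [if_neg hne]
      simp only [hf, ha, hb, if_false]
      exact hs.right _ (hlt a ha) _ (hlt b hb)
  obtain ⟨g, hg⟩ := exists_GSp_of_symp (f := f) (κ := 1) (by simpa using hff)
  refine ⟨g, ?_, τ, ?_, ?_⟩
  · rw [mem_Iwahori_iff]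
    -- The same basis splits the standard chain, now with `e = 0` and thresholds `j + 1 - 2n`; so
    -- `g` stabilizes that chain.
    have hS0 : IsDualChain ((2 * n : ℕ) * (0 : ℤ)) (stdChain n 𝔽) := by rwa [mul_zero]
    have := hS0.eq_smul_diagChain hff (τ := fun j => j + 1 - (2 * n : ℕ)) ?_ ?_ hg
    · nth_rewrite 1 [stdChain_eq_diagChain]
      rw [show omega n = fun i (j : Fin (2 * n)) => cexp (2 * n : ℕ) (((j : ℕ) : ℤ) + 1 - (2 * n : ℕ)) i from
        funext fun i => funext fun j => omega_eq_cexp i j]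
      exact this.symm
    · intro j
      have := Fin.val_rev j
      have := j.2
      push_cast
      omega
    · intro j
      have hj2 := Fin.val_rev j
      have hj3 := j.2
      by_cases hj : (j : ℕ) < n
      · simp only [hf, hj, if_true]
        exact hS.upow_smul_mem (hv _ hj).1 (by push_cast; omega)
      · simp only [hf, hj, if_false]
        have := (hv _ (hlt j hj)).2.1
        rwa [show -((Fin.rev j : ℕ) : ℤ) = j + 1 - (2 * n : ℕ) by omega] at this
  · intro j
    by_cases hj : (j : ℕ) < n
    · simp only [hτ, hj, hlt' j hj, if_true, if_false, Fin.rev_rev]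
      ring
    · simp only [hτ, hj, hlt j hj, if_true, if_false]
      ring
  · refine hL.eq_smul_diagChain hff ?_ ?_ hg
    · intro j
      by_cases hj : (j : ℕ) < n
      · simp only [hτ, hj, hlt' j hj, if_true, if_false, Fin.rev_rev]
        ring
      · simp only [hτ, hj, hlt j hj, if_true, if_false]
        ring
    · intro j
      by_cases hj : (j : ℕ) < n
      · simp only [hf, hτ, hj, if_true]
        exact hL.upow_smul_mem (hv _ hj).2.2.1 (by push_cast; omega)
      · simp only [hf, hτ, hj, if_false]
        exact (hv _ (hlt j hj)).2.2.2

end GroupAction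

end SymplecticLocalModel

namespace SymplecticLocalModel

/-! ### The extended affine Weyl group and extended alcoves. -/

section Weyl

variable {𝔽 : Type*} [Field 𝔽] {n : ℕ}

/-- The matrix of an element of `GSp_{2n}(𝔽((u)))`. -/
abbrev GSpMat (g : GSp n 𝔽⸨X⸩) : Matrix (Fin (2 * n)) (Fin (2 * n)) 𝔽⸨X⸩ :=
  (g : GL (Fin (2 * n)) 𝔽⸨X⸩).val

theorem GSpMat_mul (g h : GSp n 𝔽⸨X⸩) : (GSpMat (g * h)) = (GSpMat g) * (GSpMat h) := rfl

theorem GSpMat_mul_inv (g : GSp n 𝔽⸨X⸩) : (GSpMat g) * (GSpMat (g⁻¹)) = 1 := by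
  rw [← GSpMat_mul, mul_inv_cancel]; rfl

theorem GSpMat_inv_mul (g : GSp n 𝔽⸨X⸩) : (GSpMat (g⁻¹)) * (GSpMat g) = 1 := by
  rw [← GSpMat_mul, inv_mul_cancel]; rfl

theorem mem_torus_iff {g : GSp n 𝔽⸨X⸩} : g ∈ torus n 𝔽 ↔ ∃ d, (GSpMat g) = Matrix.diagonal d := by
  constructor
  · rintro ⟨d, hd⟩
    exact ⟨d, (congrArg Units.val hd).symm⟩
  · rintro ⟨d, hd⟩
    have hdet : IsUnit (GSpMat g).det := 
      (Matrix.isUnit_iff_isUnit_det _).1 (Units.isUnit (g : GL (Fin (2 * n)) 𝔽⸨X⸩))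
    rw [hd, Matrix.det_diagonal] at hdet
    have hd0 : IsUnit d := Pi.isUnit_iff.2 fun j =>
      isUnit_iff_ne_zero.2 (Finset.prod_ne_zero_iff.1 hdet.ne_zero j (Finset.mem_univ j))
    exact ⟨hd0.unit, Units.ext hd.symm⟩

theorem mem_torusInt_of_eq {g : GSp n 𝔽⸨X⸩} {r : Fin (2 * n) → 𝔽⟦X⟧ˣ}
    (h : (GSpMat g) = Matrix.diagonal fun j => algebraMap 𝔽⟦X⟧ 𝔽⸨X⸩ (r j)) : g ∈ torusInt n 𝔽 :=
  ⟨MulEquiv.piUnits.symm r, Units.ext h.symm⟩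

/-- `g` is the monomial matrix with entries `g_{τ(b), b} = r_b u^{m_b}`. -/
def IsMonomial (g : GSp n 𝔽⸨X⸩) (τ : Equiv.Perm (Fin (2 * n))) (r : Fin (2 * n) → 𝔽⟦X⟧ˣ)
    (m : Fin (2 * n) → ℤ) : Prop :=
  ∀ a b, (GSpMat g) a b = if a = τ b then (r b : 𝔽⟦X⟧) • upow (m b) else 0

variable {g : GSp n 𝔽⸨X⸩} {τ : Equiv.Perm (Fin (2 * n))} {r : Fin (2 * n) → 𝔽⟦X⟧ˣ}
  {m : Fin (2 * n) → ℤ}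

theorem unit_smul_upow_ne_zero (c : 𝔽⟦X⟧ˣ) (k : ℤ) : (c : 𝔽⟦X⟧) • (upow k : 𝔽⸨X⸩) ≠ 0 := by
  intro h
  have : (upow k : 𝔽⸨X⸩) ∈ fracIdeal 𝔽 (k + 1) := by
    rw [← smul_unit_mem_fracIdeal c, h]
    exact Submodule.zero_mem _
  rw [upow_mem_fracIdeal_iff] at this
  omega

theorem unit_smul_upow_mem_iff (c : 𝔽⟦X⟧ˣ) (k l : ℤ) :
    (c : 𝔽⟦X⟧) • (upow k : 𝔽⸨X⸩) ∈ fracIdeal 𝔽 l ↔ l ≤ k := by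
  rw [smul_unit_mem_fracIdeal, upow_mem_fracIdeal_iff]

theorem eq_of_unit_smul_upow_eq {c d : 𝔽⟦X⟧ˣ} {k l : ℤ}
    (h : (c : 𝔽⟦X⟧) • (upow k : 𝔽⸨X⸩) = (d : 𝔽⟦X⟧) • upow l) : k = l :=
  le_antisymm ((unit_smul_upow_mem_iff d l k).1 (h ▸ (unit_smul_upow_mem_iff c k k).2 le_rfl))
    ((unit_smul_upow_mem_iff c k l).1 (h ▸ (unit_smul_upow_mem_iff d l l).2 le_rfl))

theorem IsMonomial.mulVec_apply (h : IsMonomial g τ r m) (x : Fin (2 * n) → 𝔽⸨X⸩)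
    (b : Fin (2 * n)) : (GSpMat g).mulVec x (τ b) = (r b : 𝔽⟦X⟧) • (upow (m b) * x b) := by
  rw [Matrix.mulVec, dotProduct, Finset.sum_eq_single b]
  · rw [h, if_pos rfl, smul_mul_assoc]
  · intro k _ hk
    rw [h, if_neg (fun h0 => hk (τ.injective h0).symm), zero_mul]
  · simp

theorem IsMonomial.smul_diagChain (h : IsMonomial g τ r m) (x : ℤ → Fin (2 * n) → ℤ) :
    g • diagChain 𝔽 x = diagChain 𝔽 fun i a => x i (τ.symm a) + m (τ.symm a) := by
  have key : ∀ i (z : Fin (2 * n) → 𝔽⸨X⸩), (GSpMat g).mulVec z ∈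
      diagChain 𝔽 (fun i a => x i (τ.symm a) + m (τ.symm a)) i ↔ z ∈ diagChain 𝔽 x i := by
    intro i z
    refine mem_diagLattice.trans (Iff.trans ?_ mem_diagLattice.symm)
    rw [← τ.forall_congr_right]
    refine forall_congr' fun b => ?_
    rw [h.mulVec_apply, smul_unit_mem_fracIdeal, upow_mul_mem_fracIdeal]
    simp only [Equiv.symm_apply_apply, add_sub_cancel_right]
  funext i
  ext y
  constructor
  · rintro ⟨z, hz, rfl⟩
    exact (key i z).2 hz
  · intro hy
    refine ⟨(GSpMat (g⁻¹)).mulVec y, (key i _).1 ?_, GSp.mulVec_inv_mulVec g y⟩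
    rwa [GSp.mulVec_inv_mulVec g y]

/-- The diagonal similitude `s = diag(1, u, …, u^{2n-1})` has distinct entries. If `g s g⁻¹ =
diag(d)`, then `d_a g_{ab} = g_{ab} u^b`, so each row of `g` has at most one nonzero entry;
invertibility makes `g` monomial. -/
theorem exists_isMonomial (hg : g ∈ normTorus n 𝔽) : ∃ τ r m, IsMonomial g τ r m := by
  obtain ⟨s, hs⟩ := exists_GSp_of_symp (𝔽 := 𝔽) (n := n)
    (f := fun b => Pi.single b (upow ((b : ℕ) : ℤ)))
    (κ := (isUnit_iff_ne_zero.2 (upow_ne_zero (((2 * n : ℕ) : ℤ) - 1))).unit) (by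
      intro a b
      rw [symp_single_single, Jmat_apply]
      split_ifs with h
      · rw [← upow_add, h]
        congr 2
        have := Fin.val_rev a
        have := a.2
        omega
      · simp)
  have hs' : (GSpMat s) = Matrix.diagonal fun b : Fin (2 * n) => upow ((b : ℕ) : ℤ) := by
    refine hs.trans ?_
    ext a b
    rw [Matrix.of_apply, Matrix.diagonal_apply, Pi.single_apply]
    split_ifs with h
    · rw [h]
    · rfl
  have h1 := (Subgroup.mem_normalizer_iff.1 hg s).1 (mem_torus_iff.2 ⟨_, hs'⟩)
  obtain ⟨d, hd⟩ := mem_torus_iff.1 h1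
  have h2 : Matrix.diagonal d * (GSpMat g) = (GSpMat g) * (GSpMat s) := by
    rw [← hd, ← GSpMat_mul, inv_mul_cancel_right, GSpMat_mul]
  have hrow : ∀ a b b', (GSpMat g) a b ≠ 0 → (GSpMat g) a b' ≠ 0 → b = b' := by
    have h3 : ∀ a b, (GSpMat g) a b ≠ 0 → d a = upow ((b : ℕ) : ℤ) := fun a b hab => by
      have := congrFun (congrFun h2 a) b
      rw [hs', Matrix.diagonal_mul, Matrix.mul_diagonal, mul_comm] at this
      exact mul_left_cancel₀ hab this
    intro a b b' hb hb'
    have h4 := (h3 a b hb).symm.trans (h3 a b' hb')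
    have h5 := eq_of_unit_smul_upow_eq (c := 1) (d := 1)
      (k := ((b : ℕ) : ℤ)) (l := ((b' : ℕ) : ℤ)) (by rw [h4])
    exact Fin.ext (by omega)
  have hcol : ∀ b, ∃ a, (GSpMat g) a b ≠ 0 := by
    intro b
    by_contra! h
    have h3 := GSp.inv_mulVec_mulVec g (Pi.single b 1)
    have h4 : (GSpMat g).mulVec (Pi.single b 1) = 0 := by
      ext a
      simp [Matrix.col_apply, h a]
    rw [h4, Matrix.mulVec_zero] at h3
    simpa using congrFun h3 b
  choose f hf using hcol
  have hfi : Function.Injective f := fun b b' hbb => hrow (f b) b b' (hf b) (hbb ▸ hf b')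
  choose m r hr using fun b => exists_eq_unit_smul_upow (hf b)
  refine ⟨Equiv.ofBijective f (Finite.injective_iff_bijective.1 hfi), r, m, fun a b => ?_⟩
  rw [Equiv.ofBijective_apply]
  split_ifs with h
  · rw [h, hr]
  · by_contra h3
    obtain ⟨b', rfl⟩ := (Finite.injective_iff_surjective.1 hfi) a
    exact h (by rw [hrow _ _ _ h3 (hf b')])

theorem IsMonomial.symp_col (h : IsMonomial g τ r m) (a b : Fin (2 * n)) :
    symp n 𝔽⸨X⸩ ((GSpMat g).col a) ((GSpMat g).col b) =
      ((r a * r b : 𝔽⟦X⟧ˣ) : 𝔽⟦X⟧) • upow (m a + m b) * Jmat n 𝔽⸨X⸩ (τ a) (τ b) := by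
  have hc : ∀ b, (GSpMat g).col b = Pi.single (τ b) ((r b : 𝔽⟦X⟧) • upow (m b)) := fun b => by
    ext k
    rw [Matrix.col_apply, h, Pi.single_apply]
  rw [hc, hc, symp_single_single, smul_mul_smul_comm, ← upow_add, Units.val_mul]

/-- In `gᵗ J g = κ J` the entries at `(a, rev a)` are nonzero on the right, which forces `τ` to
commute with `rev`; comparing orders there gives the constant sum. -/
theorem IsMonomial.rev (h : IsMonomial g τ r m) :
    (∀ a, τ (Fin.rev a) = Fin.rev (τ a)) ∧ ∃ c, ∀ a, m a + m (Fin.rev a) = c := by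
  obtain ⟨κ, hκ⟩ := g.2
  obtain ⟨k, u, hu⟩ := exists_eq_unit_smul_upow κ.ne_zero
  have key : ∀ a, ((r a * r (Fin.rev a) : 𝔽⟦X⟧ˣ) : 𝔽⟦X⟧) • upow (m a + m (Fin.rev a)) *
      Jmat n 𝔽⸨X⸩ (τ a) (τ (Fin.rev a)) = (u : 𝔽⟦X⟧) • upow k * jsign n _ a := fun a => by
    rw [← h.symp_col, ← transpose_mul_Jmat_mul_apply]
    refine (congrFun (congrFun hκ a) (Fin.rev a)).trans ?_
    rw [Matrix.smul_apply, Jmat_apply, if_pos rfl, ← hu, smul_eq_mul]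
  have hj : ∀ a, jsign n 𝔽⸨X⸩ a = ((if (a : ℕ) < n then 1 else -1 : 𝔽⟦X⟧ˣ) : 𝔽⟦X⟧) • 1 := by
    intro a
    unfold jsign
    split_ifs <;> simp
  have hτ : ∀ a, τ (Fin.rev a) = Fin.rev (τ a) := fun a => by
    by_contra hne
    have := key a
    rw [Jmat_apply, if_neg hne, mul_zero, hj, smul_mul_smul_comm, mul_one, ← Units.val_mul] at this
    exact unit_smul_upow_ne_zero _ _ this.symm
  refine ⟨hτ, k, fun a => ?_⟩
  have := key a
  rw [Jmat_apply, if_pos (hτ a), hj, hj, smul_mul_smul_comm, mul_one, ← Units.val_mul,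
    smul_mul_smul_comm, mul_one, ← Units.val_mul] at this
  exact eq_of_unit_smul_upow_eq this

theorem omega_add_omega_neg_rev (i : ℤ) (a : Fin (2 * n)) :
    omega n i a + omega n (-i) (Fin.rev a) = 0 :=
  omega_neg i a _ (by have := Fin.val_rev a; have := a.2; omega)

theorem exists_omega_step (hn : 0 < n) (i : ℤ) :
    ∃ k : Fin (2 * n), ((k : ℕ) : ℤ) = i % (2 * n : ℕ) := by
  have hN : (0 : ℤ) < (2 * n : ℕ) := by omega
  have h1 := Int.emod_nonneg i hN.ne'
  have h2 := Int.emod_lt_of_pos i hN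
  exact ⟨⟨(i % (2 * n : ℕ)).toNat, by omega⟩, Int.toNat_of_nonneg h1⟩

theorem IsMonomial.isExtendedAlcove (hn : 0 < n) (h : IsMonomial g τ r m) :
    IsExtendedAlcove fun i a => omega n i (τ.symm a) + m (τ.symm a) where
  periodic i a := by rw [add_comm i, omega_add]; ring
  step i := by
    obtain ⟨k, hk⟩ := exists_omega_step hn i
    refine ⟨τ k, funext fun a => ?_⟩
    have := omega_sub_omega_succ i (τ.symm a)
    rw [Pi.sub_apply, Pi.single_apply, add_sub_add_right_eq_sub, this, ← hk]
    refine if_congr ?_ rfl rfl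
    rw [← Equiv.symm_apply_eq, Fin.ext_iff]
    norm_cast
  dual := by
    obtain ⟨h1, c, hc⟩ := h.rev
    refine ⟨c, fun i a => ?_⟩
    have h2 : τ.symm (Fin.rev a) = Fin.rev (τ.symm a) := by
      rw [Equiv.symm_apply_eq, h1, Equiv.apply_symm_apply]
    have h3 := omega_add_omega_neg_rev i (τ.symm a)
    have h4 := hc (τ.symm a)
    rw [h2]
    linarith

theorem hasAlcove_mk_iff {w : normTorus n 𝔽} {x : ℤ → Fin (2 * n) → ℤ} :
    HasAlcove (QuotientGroup.mk w : ExtWeyl n 𝔽) x ↔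
      (w : GSp n 𝔽⸨X⸩) • stdChain n 𝔽 = diagChain 𝔽 x :=
  funext_iff.symm

theorem HasAlcove.flag_eq {w : ExtWeyl n 𝔽} {x : ℤ → Fin (2 * n) → ℤ} (h : HasAlcove w x) :
    flag (weylCoset w) = diagChain 𝔽 x := funext h

theorem existsUnique_alcove (hn : 0 < n) (w : ExtWeyl n 𝔽) :
    ∃! x, IsExtendedAlcove x ∧ HasAlcove w x := by
  obtain ⟨w, rfl⟩ := QuotientGroup.mk_surjective w
  obtain ⟨τ, r, m, h⟩ := exists_isMonomial w.2
  refine ⟨_, ⟨h.isExtendedAlcove hn, hasAlcove_mk_iff.2 (h.smul_diagChain _)⟩, ?_⟩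
  rintro y ⟨-, hy⟩
  exact diagChain_injective ((hasAlcove_mk_iff.1 hy).symm.trans (h.smul_diagChain _))

/-- A monomial matrix fixing the standard chain fixes each `ω_i`. The step from `ω_b` to `ω_{b+1}`
occurs in coordinate `b` alone, so the permutation is trivial, and then so are the exponents. -/
theorem mem_torusInt_of_mem (hg : g ∈ normTorus n 𝔽) (hg' : g ∈ Iwahori n 𝔽) :
    g ∈ torusInt n 𝔽 := by
  obtain ⟨τ, r, m, h⟩ := exists_isMonomial hg
  have h1 : (fun i a => omega n i (τ.symm a) + m (τ.symm a)) = omega n :=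
    diagChain_injective ((h.smul_diagChain _).symm.trans (mem_Iwahori_iff.1 hg'))
  have h2 : ∀ i b, omega n i b + m b = omega n i (τ b) := fun i b => by
    have := congrFun (congrFun h1 i) (τ b)
    simpa using this
  have hτ : ∀ b, τ b = b := fun b => by
    have e1 := omega_sub_omega_succ ((b : ℕ) : ℤ) b
    have e2 := omega_sub_omega_succ ((b : ℕ) : ℤ) (τ b)
    rw [← h2, ← h2, add_sub_add_right_eq_sub, e1, Int.emod_eq_of_lt (by omega)
      (by exact_mod_cast b.2), if_pos rfl] at e2
    by_contra hne
    rw [if_neg (fun h0 => hne (Fin.ext (by omega)))] at e2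
    omega
  refine mem_torusInt_of_eq (r := r) ?_
  ext a b
  have hm : m b = 0 := by
    have := h2 0 b
    rw [hτ] at this
    omega
  rw [h, hτ, hm, Matrix.diagonal_apply, upow_zero, Algebra.smul_def, mul_one]
  split_ifs with hab
  · rw [hab]
  · rfl

theorem hasAlcove_injective {w w' : ExtWeyl n 𝔽} {x : ℤ → Fin (2 * n) → ℤ}
    (h : HasAlcove w x) (h' : HasAlcove w' x) : w = w' := by
  have h1 : weylCoset w = weylCoset w' := flag_injective (h.flag_eq.trans h'.flag_eq.symm)
  obtain ⟨a, rfl⟩ := QuotientGroup.mk_surjective w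
  obtain ⟨b, rfl⟩ := QuotientGroup.mk_surjective w'
  have h2 : (a : GSp n 𝔽⸨X⸩)⁻¹ * b ∈ Iwahori n 𝔽 := QuotientGroup.eq.1 h1
  refine QuotientGroup.eq.2 (Subgroup.mem_subgroupOf.2 ?_)
  exact mem_torusInt_of_mem (a⁻¹ * b).2 h2

theorem IsMonomial.conj_mem_torus (h : IsMonomial g τ r m) {t : GSp n 𝔽⸨X⸩}
    (ht : t ∈ torus n 𝔽) : g * t * g⁻¹ ∈ torus n 𝔽 := by
  obtain ⟨d, hd⟩ := mem_torus_iff.1 ht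
  refine mem_torus_iff.2 ⟨fun a => d (τ.symm a), ?_⟩
  have h1 : (GSpMat g) * Matrix.diagonal d = Matrix.diagonal (fun a => d (τ.symm a)) * (GSpMat g) := by
    ext a b
    rw [Matrix.mul_diagonal, Matrix.diagonal_mul, h]
    split_ifs with hab
    · rw [hab, Equiv.symm_apply_apply, mul_comm]
    · simp
  rw [GSpMat_mul, GSpMat_mul, hd, h1, Matrix.mul_assoc, GSpMat_mul_inv, Matrix.mul_one]

theorem IsMonomial.inv (h : IsMonomial g τ r m) :
    IsMonomial g⁻¹ τ.symm (fun a => (r (τ.symm a))⁻¹) (fun a => -m (τ.symm a)) := by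
  intro a b
  have h1 := congrFun (congrFun (GSpMat_inv_mul g) a) (τ.symm b)
  rw [Matrix.mul_apply, Finset.sum_eq_single b, h, if_pos (by simp)] at h1
  · have h2 : (r (τ.symm b) : 𝔽⟦X⟧) • (upow (m (τ.symm b)) : 𝔽⸨X⸩) *
        (((r (τ.symm b))⁻¹ : 𝔽⟦X⟧ˣ) : 𝔽⟦X⟧) • upow (-m (τ.symm b)) = 1 := by
      rw [smul_mul_smul_comm, upow_mul_upow_neg, Units.mul_inv, one_smul]
    have h3 := congrArg (· * ((((r (τ.symm b))⁻¹ : 𝔽⟦X⟧ˣ) : 𝔽⟦X⟧) •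
      (upow (-m (τ.symm b)) : 𝔽⸨X⸩))) h1
    simp only [mul_assoc, h2, mul_one] at h3
    rw [h3, Matrix.one_apply]
    split_ifs <;> simp
  · intro k _ hk
    rw [h, if_neg (fun h0 => hk (by rw [h0, Equiv.apply_symm_apply])), mul_zero]
  · simp

theorem IsMonomial.mem_normTorus (h : IsMonomial g τ r m) : g ∈ normTorus n 𝔽 := by
  refine Subgroup.mem_normalizer_iff.2 fun t => ⟨h.conj_mem_torus, fun ht => ?_⟩
  have := h.inv.conj_mem_torus ht
  rwa [inv_inv, mul_assoc, mul_assoc, inv_mul_cancel, mul_one, inv_mul_cancel_left] at this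

/-- Let `κ i` be the coordinate that drops from `x_i` to `x_{i+1}`. It is periodic, satisfies
`κ(-i-1) = rev (κ i)`, and takes each value over one period. So `κ` defines a permutation commuting
with `rev`, and the required element is the monomial matrix with this permutation and exponents from
`x_0`, with signs adjusted. -/
theorem exists_hasAlcove {x : ℤ → Fin (2 * n) → ℤ} (hx : IsExtendedAlcove x) :
    ∃ w : ExtWeyl n 𝔽, HasAlcove w x := by
  choose κ hκ using hx.step
  obtain ⟨c, hc⟩ := hx.dual
  have hκ' : ∀ i a, x i a - x (i + 1) a = if a = κ i then 1 else 0 := fun i a => by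
    have := congrFun (hκ i) a
    rwa [Pi.sub_apply, Pi.single_apply] at this
  have hper : ∀ i, κ (i + (2 * n : ℕ)) = κ i := fun i => by
    have h1 := hκ' (i + (2 * n : ℕ)) (κ i)
    have h2 := hκ' i (κ i)
    rw [hx.periodic, show i + ((2 * n : ℕ) : ℤ) + 1 = i + 1 + (2 * n : ℕ) by ring, hx.periodic] at h1
    by_contra hne
    rw [if_neg (Ne.symm hne)] at h1
    rw [if_pos rfl] at h2
    omega
  have hmod : ∀ i, κ (i % (2 * n : ℕ)) = κ i := fun i => by
    have hp : Function.Periodic κ ((2 * n : ℕ) : ℤ) := hper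
    have := hp.sub_zsmul_eq (i / (2 * n : ℕ)) (x := i)
    rwa [smul_eq_mul, mul_comm (i / _), ← Int.emod_def] at this
  have hrev : ∀ i, κ (-i - 1) = Fin.rev (κ i) := fun i => by
    have h1 := hκ' (-i - 1) (Fin.rev (κ i))
    have h2 := hκ' i (κ i)
    rw [if_pos rfl] at h2
    have h3 := hc i (κ i)
    have h4 := hc (i + 1) (κ i)
    rw [show -(i + 1) = -i - 1 by ring] at h4
    rw [sub_add_cancel] at h1
    by_contra hne
    rw [if_neg (Ne.symm hne)] at h1
    omega
  have hsurj : Function.Surjective fun j : Fin (2 * n) => κ ((j : ℕ) : ℤ) := by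
    intro a
    -- A coordinate that never drops would be constant over a period, against `x_{i+2n} = x_i - 1`.
    by_contra! hne
    have h1 : ∀ k : ℕ, k ≤ 2 * n → x k a = x 0 a := by
      intro k
      induction k with
      | zero => simp
      | succ k ih =>
        intro hk
        have h2 := hκ' k a
        rw [if_neg (fun h0 => hne ⟨k, hk⟩ h0.symm), ih (by omega)] at h2
        push_cast
        omega
    have h2 := h1 (2 * n) le_rfl
    have h3 := hx.periodic 0 a
    rw [zero_add] at h3
    omega
  set τ : Equiv.Perm (Fin (2 * n)) :=
    Equiv.ofBijective _ (Finite.surjective_iff_bijective.1 hsurj) with hτ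
  have hτa : ∀ j, τ j = κ ((j : ℕ) : ℤ) := fun j => rfl
  have hτrev : ∀ j, τ (Fin.rev j) = Fin.rev (τ j) := fun j => by
    rw [hτa, hτa, ← hrev, ← hper (-((j : ℕ) : ℤ) - 1)]
    congr 1
    have := Fin.val_rev j
    have := j.2
    omega
  have hxω : ∀ i j, x i (τ j) = omega n i j + x 0 (τ j) := by
    intro i j
    have hstep : ∀ i, x i (τ j) - x (i + 1) (τ j) = omega n i j - omega n (i + 1) j := fun i => by
      rw [hκ', omega_sub_omega_succ, ← hmod i]
      obtain ⟨k, hk⟩ := exists_omega_step (n := n) (by have := j.2; omega) i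
      rw [← hk, ← hτa k]
      refine if_congr ?_ rfl rfl
      rw [τ.apply_eq_iff_eq, Fin.ext_iff]
      norm_cast
    induction i using Int.induction_on with
    | zero => simp [omega]
    | succ i ih => have := hstep i; linarith
    | pred i ih =>
      have := hstep (-(i : ℤ) - 1)
      rw [sub_add_cancel] at this
      linarith
  -- When `τ` exchanges the halves containing `a` and `rev a`, the entry of `J` changes sign; one
  -- sign on the index `a < n` compensates for it.
  set s : Fin (2 * n) → 𝔽⟦X⟧ˣ := fun a => if (a : ℕ) < n then
    (if (τ a : ℕ) < n then 1 else -1) else 1 with hs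
  obtain ⟨g, hg⟩ := exists_GSp_of_symp (𝔽 := 𝔽) (n := n)
    (f := fun b => Pi.single (τ b) ((s b : 𝔽⟦X⟧) • upow (x 0 (τ b))))
    (κ := (isUnit_iff_ne_zero.2 (upow_ne_zero c)).unit) (by
      intro a b
      rw [symp_single_single, Jmat_apply, Jmat_apply, ← hτrev]
      simp only [EmbeddingLike.apply_eq_iff_eq]
      split_ifs with h
      · have h1 := hc 0 (τ a)
        rw [neg_zero, ← hτrev] at h1
        rw [h, smul_mul_smul_comm, ← upow_add, h1]
        have hv := Fin.val_rev a
        have hv' := Fin.val_rev (τ a)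
        have ha := a.2
        have ha' := (τ a).2
        by_cases h2 : (a : ℕ) < n
        · have h3 : ¬ (Fin.rev a : ℕ) < n := by omega
          by_cases h4 : (τ a : ℕ) < n <;> simp [hs, h2, h3, h4, jsign, -Fin.val_rev]
        · have h3 : (Fin.rev a : ℕ) < n := by omega
          by_cases h4 : (τ a : ℕ) < n
          · have h5 : ¬ (Fin.rev (τ a) : ℕ) < n := by omega
            simp [hs, h2, h3, h4, h5, hτrev, jsign, -Fin.val_rev]
          · have h5 : (Fin.rev (τ a) : ℕ) < n := by omega
            simp [hs, h2, h3, h4, h5, hτrev, jsign, -Fin.val_rev]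
      · simp)
  have hmono : IsMonomial g τ s fun b => x 0 (τ b) := fun a b => by
    rw [GSpMat, hg, Matrix.of_apply, Pi.single_apply]
  refine ⟨QuotientGroup.mk ⟨g, hmono.mem_normTorus⟩, hasAlcove_mk_iff.2 ?_⟩
  refine (hmono.smul_diagChain _).trans (congrArg _ (funext fun i => funext fun a => ?_))
  have := hxω i (τ.symm a)
  rw [Equiv.apply_symm_apply] at this
  rw [this, Equiv.apply_symm_apply]

end Weyl

/-! ### Relative position with respect to the standard chain. -/

section RelativePosition

variable {𝔽 : Type*} [Field 𝔽] {n : ℕ}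

/-- As `g` fixes the standard chain, it can be removed. All lattices are then diagonal, and
`Λ̃_{j+1}` exceeds `Λ̃_j` only in coordinate `k`. -/
theorem stdChain_le_sup_iff {g : GSp n 𝔽⸨X⸩} (hg : g ∈ Iwahori n 𝔽) (x : ℤ → Fin (2 * n) → ℤ)
    (i j : ℤ) {k : Fin (2 * n)} (hk : ((k : ℕ) : ℤ) = j % (2 * n : ℕ)) :
    stdChain n 𝔽 (j + 1) ≤ (g • diagChain 𝔽 x) i ⊔ stdChain n 𝔽 j ↔
      x i k ≤ omega n (j + 1) k := by
  nth_rewrite 1 [← mem_Iwahori_iff.1 hg]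
  nth_rewrite 2 [← mem_Iwahori_iff.1 hg]
  rw [smul_chain_le_sup_iff]
  change diagLattice _ ≤ diagLattice _ ⊔ diagLattice _ ↔ _
  rw [diagLattice_sup, diagLattice_le_iff]
  constructor
  · intro h
    have h1 := h k
    have h2 := omega_sub_omega_succ j k
    rw [if_pos hk] at h2
    rw [Pi.inf_apply] at h1
    rcases inf_le_iff.1 h1 with h3 | h3
    · exact h3
    · have h3 : omega n j k ≤ omega n (j + 1) k := h3
      omega
  · intro h b
    rw [Pi.inf_apply]
    have h2 := omega_sub_omega_succ j b
    split_ifs at h2 with hb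
    · obtain rfl : b = k := Fin.ext (by omega)
      exact inf_le_of_left_le h
    · have h3 : omega n j b ≤ omega n (j + 1) b := by omega
      exact inf_le_of_right_le h3

/-- The alcove of a lattice chain is determined by its relative position to the standard chain. -/
theorem alcove_eq_of_relPos {g g' : GSp n 𝔽⸨X⸩} (hg : g ∈ Iwahori n 𝔽) (hg' : g' ∈ Iwahori n 𝔽)
    {x x' : ℤ → Fin (2 * n) → ℤ}
    (h : ∀ i j, stdChain n 𝔽 (j + 1) ≤ (g • diagChain 𝔽 x) i ⊔ stdChain n 𝔽 j ↔
      stdChain n 𝔽 (j + 1) ≤ (g' • diagChain 𝔽 x') i ⊔ stdChain n 𝔽 j) : x = x' := by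
  funext i k
  have hN : (0 : ℤ) < (2 * n : ℕ) := by have := k.2; omega
  have key : ∀ m, x i k ≤ m ↔ x' i k ≤ m := fun m => by
    -- This `j` is congruent to `k` modulo `2n` and satisfies `ω_{j+1}(k) = m`, so `x_i(k)` gets
    -- compared with every integer `m`.
    set j : ℤ := k + (2 * n : ℕ) * (-(m + 1)) with hj
    have hk : ((k : ℕ) : ℤ) = j % (2 * n : ℕ) := by
      rw [hj, Int.add_mul_emod_self_left, Int.emod_eq_of_lt (by omega) (by exact_mod_cast k.2)]
    have hm : omega n (j + 1) k = m := by
      rw [omega_eq_cexp, cexp, show j + 1 - (((k : ℕ) : ℤ) + 1 - (2 * n : ℕ)) =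
        (2 * n : ℕ) * (-m) by rw [hj]; ring, Int.mul_ediv_cancel_left _ hN.ne', neg_neg]
    rw [← hm, ← stdChain_le_sup_iff hg x i j hk, ← stdChain_le_sup_iff hg' x' i j hk]
    exact h i j
  exact le_antisymm ((key _).2 le_rfl) ((key _).1 le_rfl)

end RelativePosition

end SymplecticLocalModel

namespace SymplecticLocalModel

/-! ### Integral bases of `𝒪_F ⊗ ℤ_p` and `𝒪_F ⊗ 𝔽`. -/

section IntegralStructure

variable {p : ℕ} [Fact p.Prime] {F : Type*} [Field F] [NumberField F]

variable (p F) in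
/-- The basis of `F ⊗ ℚ_p` over `ℚ_p` given by a `ℤ`-basis of `𝒪_F`. -/
def kpBasis : Module.Basis (Module.Free.ChooseBasisIndex ℤ (𝓞 F)) ℚ_[p] (Kp p F) :=
  Algebra.TensorProduct.basis ℚ_[p] (NumberField.integralBasis F)

theorem kpBasis_apply (k) :
    kpBasis p F k = inclF p F (NumberField.RingOfIntegers.basis F k : F) := by
  rw [kpBasis, Algebra.TensorProduct.basis_apply, NumberField.integralBasis_apply]
  rfl

variable (p F) in
/-- `inclO` as a ring homomorphism. -/
def inclOHom : 𝓞 F →+* Op p F where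
  toFun := inclO p F
  map_one' := Subtype.ext (map_one (inclF p F))
  map_mul' a b := Subtype.ext (map_mul (inclF p F) (a : F) b)
  map_zero' := Subtype.ext (map_zero (inclF p F))
  map_add' a b := Subtype.ext (map_add (inclF p F) (a : F) b)

theorem inclOHom_apply (a : 𝓞 F) : inclOHom p F a = inclO p F a := rfl

/-- The image of `𝒪_F` is already closed under multiplication. -/
theorem Op_toSubmodule : Subalgebra.toSubmodule (Op p F) =
    Submodule.span ℤ_[p] (Set.range fun a : 𝓞 F => inclF p F (a : F)) := by
  rw [Op, Algebra.adjoin_eq_span]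
  congr 1
  have := Submonoid.closure_eq (MonoidHom.mrange
    ((inclF p F).toRingHom.comp (algebraMap (𝓞 F) F) : 𝓞 F →* Kp p F))
  exact congrArg (fun S : Submonoid (Kp p F) => (S : Set (Kp p F))) this

theorem span_inclO : Submodule.span ℤ_[p] (Set.range (inclO p F)) = ⊤ := by
  apply Submodule.map_injective_of_injective
    (f := (Subalgebra.toSubmodule (Op p F)).subtype) Subtype.val_injective
  rw [Submodule.map_span, Submodule.map_top, Submodule.range_subtype, ← Set.range_comp]
  exact Op_toSubmodule.symm

theorem inclO_eq_sum (a : 𝓞 F) : inclO p F a =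
    ∑ k, (((NumberField.RingOfIntegers.basis F).repr a k : ℤ) : ℤ_[p]) •
      inclO p F (NumberField.RingOfIntegers.basis F k) := by
  conv_lhs => rw [← (NumberField.RingOfIntegers.basis F).sum_repr a, ← inclOHom_apply, map_sum]
  refine Finset.sum_congr rfl fun k _ => ?_
  rw [map_zsmul, Int.cast_smul_eq_zsmul]
  rfl

variable (p F) in
/-- The `ℤ_p`-basis of `𝒪_F ⊗ ℤ_p` given by a `ℤ`-basis of `𝒪_F`. -/
def opBasis : Module.Basis (Module.Free.ChooseBasisIndex ℤ (𝓞 F)) ℤ_[p] (Op p F) :=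
  Module.Basis.mk (v := fun k => inclO p F (NumberField.RingOfIntegers.basis F k)) (by
      have h1 : LinearIndependent ℤ_[p] (kpBasis p F) :=
        (kpBasis p F).linearIndependent.restrict_scalars' ℤ_[p]
      refine LinearIndependent.of_comp (Subalgebra.toSubmodule (Op p F)).subtype ?_
      have h2 : (Subalgebra.toSubmodule (Op p F)).subtype ∘ (fun k =>
          inclO p F (NumberField.RingOfIntegers.basis F k)) = kpBasis p F :=
        funext fun k => (kpBasis_apply k).symm
      exact h2 ▸ h1)
    (by
      rw [← span_inclO, Submodule.span_le]
      rintro _ ⟨a, rfl⟩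
      rw [inclO_eq_sum]
      exact Submodule.sum_mem _ fun k _ => Submodule.smul_mem _ _ (Submodule.subset_span ⟨k, rfl⟩))

theorem opBasis_apply (k) :
    opBasis p F k = inclO p F (NumberField.RingOfIntegers.basis F k) := by
  rw [opBasis, Module.Basis.mk_apply]

section SpecialFibre

variable (𝔽 : Type*) [Field 𝔽] [Algebra ℤ_[p] 𝔽]

variable (p F) in
/-- The `𝔽`-basis of `𝒪_F ⊗ 𝔽` given by a `ℤ`-basis of `𝒪_F`. -/
def ofBasis : Module.Basis (Module.Free.ChooseBasisIndex ℤ (𝓞 F)) 𝔽 (OF p F 𝔽) :=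
  Algebra.TensorProduct.basis 𝔽 (opBasis p F)

theorem ofBasis_apply (k) :
    ofBasis p F 𝔽 k = 1 ⊗ₜ inclO p F (NumberField.RingOfIntegers.basis F k) := by
  rw [ofBasis, Algebra.TensorProduct.basis_apply, opBasis_apply]

instance : Module.Finite 𝔽 (OF p F 𝔽) := Module.Finite.of_basis (ofBasis p F 𝔽)

end SpecialFibre

/-! ### The trace pairing -/

variable (D : LocalDatum p F)

/-- The map `a ↦ tr(a δ)`. -/
def traceDelta : Op p F →ₗ[ℤ_[p]] ℤ_[p] where
  toFun a := ⟨Algebra.trace ℚ_[p] (Kp p F) (a * D.delta), by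
    have := (D.delta_spec (a * D.delta)).2 ⟨a, a.2, rfl⟩ 1 (Subalgebra.one_mem _)
    rwa [mul_one] at this⟩
  map_add' a b := Subtype.ext (by
    change Algebra.trace ℚ_[p] (Kp p F) ((a + b : Kp p F) * D.delta) = _
    rw [add_mul, map_add]; rfl)
  map_smul' c a := Subtype.ext (by
    change Algebra.trace ℚ_[p] (Kp p F) ((c • (a : Kp p F)) * D.delta) = _
    rw [smul_mul_assoc, ← algebraMap_smul ℚ_[p] c, map_smul]
    rfl)

theorem coe_traceDelta (a : Op p F) :
    (traceDelta D a : ℚ_[p]) = Algebra.trace ℚ_[p] (Kp p F) (a * D.delta) := rfl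

theorem trace_inclF (x : F) :
    Algebra.trace ℚ_[p] (Kp p F) (inclF p F x) = algebraMap ℚ ℚ_[p] (Algebra.trace ℚ F x) := by
  rw [Algebra.trace_apply, Algebra.trace_apply, ← LinearMap.trace_baseChange]
  congr 1
  ext y
  simp [inclF]

/-- The trace-dual of an integral basis pairs `𝒪_F ⊗ ℤ_p` into `ℤ_p`; it therefore lies in the
inverse different and consists of multiples of `δ`. -/
theorem exists_dual_family : ∃ y : Module.Free.ChooseBasisIndex ℤ (𝓞 F) → Op p F,
    ∀ k l, traceDelta D (opBasis p F l * y k) = if k = l then 1 else 0 := by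
  have h : ∀ k, ∃ y ∈ Op p F,
      inclF p F ((NumberField.integralBasis F).traceDual k) = y * D.delta := by
    intro k
    refine (D.delta_spec _).1 fun z hz => ?_
    obtain ⟨z, rfl⟩ : ∃ z' : Op p F, (z' : Kp p F) = z := ⟨⟨z, hz⟩, rfl⟩
    have h1 : Algebra.trace ℚ_[p] (Kp p F)
        (inclF p F ((NumberField.integralBasis F).traceDual k) * z) =
        ((opBasis p F).repr z k : ℚ_[p]) := by
      conv_lhs => rw [← (opBasis p F).sum_repr z]
      have h2 : ((∑ l, (opBasis p F).repr z l • opBasis p F l : Op p F) : Kp p F) =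
          ∑ l, ((opBasis p F).repr z l : ℚ_[p]) •
            inclF p F (NumberField.integralBasis F l) := by
        rw [AddSubmonoidClass.coe_finsetSum]
        refine Finset.sum_congr rfl fun l _ => ?_
        rw [opBasis_apply, NumberField.integralBasis_apply]
        exact (algebraMap_smul ℚ_[p] ((opBasis p F).repr z l) _).symm
      rw [h2, Finset.mul_sum, map_sum, Finset.sum_eq_single k]
      · rw [mul_smul_comm, map_smul, ← map_mul, trace_inclF,
          Module.Basis.trace_traceDual_mul, if_pos rfl, map_one, smul_eq_mul, mul_one]
      · intro l _ hl
        rw [mul_smul_comm, map_smul, ← map_mul, trace_inclF,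
          Module.Basis.trace_traceDual_mul, if_neg hl, map_zero, smul_zero]
      · simp
    rw [h1]
    exact PadicInt.norm_le_one _
  choose y hy hyd using h
  refine ⟨fun k => ⟨y k, hy k⟩, fun k l => Subtype.ext ?_⟩
  change Algebra.trace ℚ_[p] (Kp p F) ((opBasis p F l : Kp p F) * y k * D.delta) = _
  rw [mul_assoc, ← hyd, opBasis_apply]
  have hb : ((inclO p F (NumberField.RingOfIntegers.basis F l) : Op p F) : Kp p F) =
      inclF p F (NumberField.integralBasis F l) := by
    rw [NumberField.integralBasis_apply]; rfl
  rw [hb, ← map_mul, trace_inclF, Module.Basis.trace_mul_traceDual]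
  rcases eq_or_ne k l with rfl | h
  · simp
  · simp [h, h.symm]

section SpecialFibre

variable (𝔽 : Type*) [Field 𝔽] [Algebra ℤ_[p] 𝔽]

/-- The `𝔽`-linear extension of `a ↦ tr(a δ)` to `𝒪_F ⊗ 𝔽`. -/
def traceDeltaF : OF p F 𝔽 →ₗ[𝔽] 𝔽 :=
  LinearMap.liftBaseChange 𝔽 ((Algebra.linearMap ℤ_[p] 𝔽).comp (traceDelta D))

theorem traceDeltaF_tmul (c : 𝔽) (a : Op p F) :
    traceDeltaF D 𝔽 (c ⊗ₜ a) = c * algebraMap ℤ_[p] 𝔽 (traceDelta D a) := by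
  simp [traceDeltaF]

/-- The reduction of the dual family reads off the coordinates of `a`. This nondegeneracy turns
statements about the trace pairing into statements about the `𝒪_F ⊗ 𝔽`-bilinear form. -/
theorem eq_zero_of_traceDeltaF {a : OF p F 𝔽} (h : ∀ b, traceDeltaF D 𝔽 (a * b) = 0) :
    a = 0 := by
  obtain ⟨y, hy⟩ := exists_dual_family D
  refine (ofBasis p F 𝔽).ext_elem fun k => ?_
  have h1 := h (1 ⊗ₜ y k)
  rw [← (ofBasis p F 𝔽).sum_repr a, Finset.sum_mul, map_sum, Finset.sum_eq_single k] at h1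
  · rw [smul_mul_assoc, map_smul, ofBasis_apply, ← opBasis_apply,
      Algebra.TensorProduct.tmul_mul_tmul, traceDeltaF_tmul, hy, if_pos rfl] at h1
    simpa using h1
  · intro l _ hl
    rw [smul_mul_assoc, map_smul, ofBasis_apply, ← opBasis_apply,
      Algebra.TensorProduct.tmul_mul_tmul, traceDeltaF_tmul, hy, if_neg hl.symm]
    simp
  · simp

end SpecialFibre

end IntegralStructure

end SymplecticLocalModel

namespace SymplecticLocalModel


/-! ### The special fibre of the chain in the given bases. -/

section Coordinates

variable {p : ℕ} [Fact p.Prime] {F : Type*} [Field F] [NumberField F]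
  {𝔽 : Type*} [Field 𝔽] [Algebra ℤ_[p] 𝔽] (D : LocalDatum p F) (n : ℕ)

theorem smul_tm (i : ℤ) (c d : 𝔽) (a : Op p F) (x : Lam D n i) :
    (c ⊗ₜ[ℤ_[p]] a : OF p F 𝔽) • tm D n i d x = tm D n i (c * d) (a • x) := by
  change actOF D n i (c ⊗ₜ a) (d ⊗ₜ x) = _
  rw [actOF, Algebra.TensorProduct.lift_tmul]
  change c • (d ⊗ₜ[ℤ_[p]] (a • x)) = _
  rw [TensorProduct.smul_tmul']
  rfl

@[elab_as_elim]
theorem LamF_induction {i : ℤ} {P : LamF 𝔽 D n i → Prop} (x : LamF 𝔽 D n i) (h0 : P 0)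
    (hadd : ∀ x y, P x → P y → P (x + y)) (htm : ∀ c x, P (tm D n i c x)) : P x :=
  TensorProduct.induction_on (motive := P) x h0 (fun c x => htm c x) (fun x y => hadd x y)

theorem pairingF_tm (i : ℤ) (c d : 𝔽) (x : Lam D n i) (y : Lam D n (-i)) :
    pairingF D n i (tm D n i c x) (tm D n (-i) d y) =
      c * d * algebraMap ℤ_[p] 𝔽 (pairing D n i x y) := by
  change c • (pairing D n i x y • d) = _
  rw [Algebra.smul_def (pairing D n i x y) d, smul_eq_mul]
  ring

theorem rhoF_tm (i : ℤ) (c : 𝔽) (x : Lam D n i) :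
    rhoF D n i (tm D n i c x) = tm D n (i + 1) c (rho D n i x) := rfl

theorem thetaF_tm (i : ℤ) (c : 𝔽) (x : Lam D n ((2 * n : ℕ) + i)) :
    thetaF D n i (tm D n _ c x) = tm D n i c (theta D n i x) := rfl

theorem zero_smul_LamF (i : ℤ) (x : LamF 𝔽 D n i) : (0 : OF p F 𝔽) • x = 0 :=
  zero_smul (OF p F 𝔽) x

theorem smul_zero_LamF (i : ℤ) (a : OF p F 𝔽) : a • (0 : LamF 𝔽 D n i) = 0 := smul_zero a

theorem rhoF_smul (i : ℤ) (a : OF p F 𝔽) (x : LamF 𝔽 D n i) :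
    rhoF D n i (a • x) = a • rhoF D n i x := by
  induction a using TensorProduct.induction_on with
  | zero => simp only [zero_smul_LamF, map_zero]
  | add a b ha hb => simp only [add_smul, map_add, ha, hb]
  | tmul c a =>
    induction x using LamF_induction with
    | h0 => simp only [smul_zero_LamF, map_zero]
    | hadd x y hx hy => simp only [smul_add, map_add, hx, hy]
    | htm d x => rw [smul_tm, rhoF_tm, map_smul, rhoF_tm, smul_tm]

theorem thetaF_smul (i : ℤ) (a : OF p F 𝔽) (x : LamF 𝔽 D n ((2 * n : ℕ) + i)) :
    thetaF D n i (a • x) = a • thetaF D n i x := by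
  induction a using TensorProduct.induction_on with
  | zero => simp only [zero_smul_LamF, map_zero]
  | add a b ha hb => simp only [add_smul, map_add, ha, hb]
  | tmul c a =>
    induction x using LamF_induction with
    | h0 => simp only [smul_zero_LamF, map_zero]
    | hadd x y hx hy => simp only [smul_add, map_add, hx, hy]
    | htm d x => rw [smul_tm, thetaF_tm, map_smul, thetaF_tm, smul_tm]

/-- The basis vector number `j` of `Λ_{i,𝔽}`. -/
def basisF (𝔽 : Type*) [Field 𝔽] [Algebra ℤ_[p] 𝔽] (i : ℤ) (j : Fin (2 * n)) : LamF 𝔽 D n i :=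
  tm D n i 1 ⟨frameVec D n i j, frameVec_mem D n i j⟩

theorem frameF_apply (i : ℤ) (z : Fin (2 * n) → OF p F 𝔽) :
    frameF D n i z = ∑ j, z j • basisF D n 𝔽 i j :=
  Fintype.linearCombination_apply _ _ _

theorem frameF_single (i : ℤ) (j : Fin (2 * n)) (a : OF p F 𝔽) :
    frameF D n i (Pi.single j a) = a • basisF D n 𝔽 i j :=
  Fintype.linearCombination_apply_single _ _ _ _

variable {D n}

theorem Jmat_eq_intCast {R : Type*} [CommRing R] (j k : Fin (2 * n)) :
    Jmat n R j k = ((Jmat n ℤ j k : ℤ) : R) := by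
  simp only [Jmat, Matrix.of_apply]
  split_ifs <;> simp

/-- For partner indices the powers of `π` cancel by `omega_neg`, and exactly one of the two vectors
carries `δ`. -/
theorem frameVec_dotProduct (i : ℤ) (j k : Fin (2 * n)) :
    frameVec D n i j ⬝ᵥ (Jmat n (Kp p F)).mulVec (frameVec D n (-i) k) =
      Jmat n (Kp p F) j k * D.delta := by
  unfold frameVec
  rw [single_dotProduct, Matrix.mulVec_single]
  change _ * (Jmat n (Kp p F) j k * (_ * _)) = _
  by_cases h : (j : ℕ) + (k : ℕ) + 1 = 2 * n
  · have hw : inclF p F (D.unif ^ omega n i j) * inclF p F (D.unif ^ omega n (-i) k) = 1 := by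
      rw [← map_mul, ← zpow_add₀ (unif_ne_zero D), omega_neg i j k h, zpow_zero, map_one]
    by_cases hj : (j : ℕ) < n
    · have hk : ¬ (k : ℕ) < n := by omega
      simp only [Jmat, Matrix.of_apply, h, hj, hk, if_true, if_false]
      linear_combination D.delta * hw
    · have hk : (k : ℕ) < n := by omega
      simp only [Jmat, Matrix.of_apply, h, hj, hk, if_true, if_false]
      linear_combination (-D.delta) * hw
  · simp [Jmat, h]

theorem pairing_smul_smul (i : ℤ) (j k : Fin (2 * n)) (a b : Op p F) :
    pairing D n i (a • ⟨frameVec D n i j, frameVec_mem D n i j⟩)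
      (b • ⟨frameVec D n (-i) k, frameVec_mem D n (-i) k⟩) =
      traceDelta D (a * b * Jmat n (Op p F) j k) := by
  apply Subtype.ext
  rw [coe_traceDelta]
  change Algebra.trace ℚ_[p] (Kp p F) (((a : Kp p F) • frameVec D n i j) ⬝ᵥ
    (Jmat n (Kp p F)).mulVec ((b : Kp p F) • frameVec D n (-i) k)) = _
  rw [Matrix.mulVec_smul, dotProduct_smul, smul_dotProduct, frameVec_dotProduct]
  congr 1
  have : ((Jmat n (Op p F) j k : Op p F) : Kp p F) = Jmat n (Kp p F) j k := by
    rw [Jmat_eq_intCast, Jmat_eq_intCast (R := Kp p F)]; simp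
  simp only [smul_eq_mul, Subalgebra.coe_mul, this]
  ring

theorem pairingF_smul_basisF (i : ℤ) (j k : Fin (2 * n)) (a b : OF p F 𝔽) :
    pairingF D n i (a • basisF D n 𝔽 i j) (b • basisF D n 𝔽 (-i) k) =
      traceDeltaF D 𝔽 (a * b * Jmat n (OF p F 𝔽) j k) := by
  induction a using TensorProduct.induction_on with
  | zero => simp only [zero_smul_LamF, map_zero, zero_mul, LinearMap.zero_apply]
  | add a a' ha ha' => simp only [add_smul, map_add, add_mul, ha, ha', LinearMap.add_apply]
  | tmul c a =>
    induction b using TensorProduct.induction_on with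
    | zero => simp only [zero_smul_LamF, map_zero, zero_mul, mul_zero]
    | add b b' hb hb' => simp only [add_smul, map_add, mul_add, add_mul, hb, hb']
    | tmul d b =>
      have h : Jmat n (OF p F 𝔽) j k = 1 ⊗ₜ Jmat n (Op p F) j k := by
        rw [Jmat_eq_intCast, Jmat_eq_intCast (R := Op p F)]
        exact (map_intCast (Algebra.TensorProduct.includeRight :
          Op p F →ₐ[ℤ_[p]] OF p F 𝔽) _).symm
      rw [basisF, basisF, smul_tm, smul_tm, pairingF_tm, pairing_smul_smul, h,
        Algebra.TensorProduct.tmul_mul_tmul, Algebra.TensorProduct.tmul_mul_tmul,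
        traceDeltaF_tmul, mul_one, mul_one, mul_one]

theorem pairingF_frameF (i : ℤ) (z w : Fin (2 * n) → OF p F 𝔽) :
    pairingF D n i (frameF D n i z) (frameF D n (-i) w) =
      traceDeltaF D 𝔽 (symp n (OF p F 𝔽) z w) := by
  simp only [frameF_apply, map_sum, LinearMap.sum_apply, pairingF_smul_basisF]
  simp only [symp_apply, dotProduct, Matrix.mulVec, Finset.mul_sum, map_sum]
  rw [Finset.sum_comm]
  exact Finset.sum_congr rfl fun j _ => Finset.sum_congr rfl fun k _ => by congr 1; ring

/-- Pairing a kernel element with multiples of the partner of basis vector `j` shows that the trace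
form kills its `j`-th coordinate. -/
theorem frameF_injective (i : ℤ) : Function.Injective (frameF (𝔽 := 𝔽) D n i) := by
  rw [← LinearMap.ker_eq_bot, LinearMap.ker_eq_bot']
  intro z hz
  funext j
  refine eq_zero_of_traceDeltaF D 𝔽 fun b => ?_
  have h := pairingF_frameF (D := D) i z (Pi.single (Fin.rev j) (jsign n _ j * b))
  rw [hz, map_zero, LinearMap.zero_apply, symp_neg_swap, symp_single_left, Fin.rev_rev,
    jsign_rev] at h
  rw [h]
  congr 1
  linear_combination (- z j * b) * jsign_mul_self (R := OF p F 𝔽) j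

theorem frameF_surjective (i : ℤ) : Function.Surjective (frameF (𝔽 := 𝔽) D n i) := by
  rw [← LinearMap.range_eq_top, eq_top_iff]
  rintro x -
  induction x using LamF_induction with
  | h0 => exact zero_mem _
  | hadd x y hx hy => exact add_mem hx hy
  | htm c x =>
    obtain ⟨x, hx⟩ := x
    induction hx using Submodule.span_induction with
    | zero =>
      have : tm D n i c 0 = 0 := TensorProduct.tmul_zero _ _
      exact this ▸ zero_mem (LinearMap.range (frameF D n i))
    | mem x hx =>
      obtain ⟨j, rfl⟩ := hx
      refine ⟨Pi.single j (c ⊗ₜ 1), ?_⟩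
      rw [frameF_single, basisF, smul_tm, mul_one, one_smul]
    | add x y hx' hy' hx hy =>
      have : tm D n i c ⟨x + y, add_mem hx' hy'⟩ = tm D n i c ⟨x, hx'⟩ + tm D n i c ⟨y, hy'⟩ :=
        TensorProduct.tmul_add c (⟨x, hx'⟩ : Lam D n i) (⟨y, hy'⟩ : Lam D n i)
      exact this ▸ add_mem hx hy
    | smul a x hx' hx =>
      have : tm D n i c ⟨a • x, Submodule.smul_mem _ a hx'⟩ =
          (1 ⊗ₜ[ℤ_[p]] a : OF p F 𝔽) • tm D n i c ⟨x, hx'⟩ := by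
        rw [smul_tm, one_mul]; rfl
      rw [this]
      exact Submodule.smul_mem _ _ hx

variable (D n 𝔽) in
/-- `frameF` as an isomorphism. -/
def frameEquiv (i : ℤ) : (Fin (2 * n) → OF p F 𝔽) ≃ₗ[OF p F 𝔽] LamF 𝔽 D n i :=
  LinearEquiv.ofBijective (frameF D n i) ⟨frameF_injective i, frameF_surjective i⟩

variable (D 𝔽) in
/-- The uniformizer as an element of `𝒪_F ⊗ 𝔽`. -/
def unifF : OF p F 𝔽 := 1 ⊗ₜ unifO D

theorem rhoF_basisF (i : ℤ) (j : Fin (2 * n)) :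
    rhoF D n i (basisF D n 𝔽 i j) =
      unifF 𝔽 D ^ (omega n i j - omega n (i + 1) j).toNat • basisF D n 𝔽 (i + 1) j := by
  have h : 0 ≤ omega n i j - omega n (i + 1) j := sub_nonneg.2 (omega_anti i j)
  have h1 : (unifF 𝔽 D) ^ (omega n i j - omega n (i + 1) j).toNat =
      1 ⊗ₜ (⟨_, unif_zpow_mem D h⟩ : Op p F) := by
    rw [unifF, Algebra.TensorProduct.tmul_pow, one_pow]
    congr 1
    apply Subtype.ext
    obtain ⟨m, hm⟩ := Int.eq_ofNat_of_zero_le h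
    simp only [hm]
    simp [unifO]
  rw [h1, basisF, basisF, smul_tm, rhoF_tm, mul_one]
  congr 1
  exact Subtype.ext (frameVec_eq_smul D n i (i + 1) j h)

theorem rhoF_frameF (i : ℤ) (z : Fin (2 * n) → OF p F 𝔽) :
    rhoF D n i (frameF D n i z) =
      frameF D n (i + 1) fun j =>
        unifF 𝔽 D ^ (omega n i j - omega n (i + 1) j).toNat * z j := by
  simp only [frameF_apply, map_sum, rhoF_smul, rhoF_basisF, smul_smul, mul_comm]

theorem thetaF_frameF (i : ℤ) (z : Fin (2 * n) → OF p F 𝔽) :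
    thetaF D n i (frameF D n ((2 * n : ℕ) + i) z) = frameF D n i z := by
  simp only [frameF_apply, map_sum, thetaF_smul]
  refine Finset.sum_congr rfl fun j _ => congrArg _ ?_
  rw [basisF, basisF, thetaF_tm]
  congr 1
  apply Subtype.ext
  change unifO D • frameVec D n ((2 * n : ℕ) + i) j = frameVec D n i j
  unfold frameVec
  rw [← Pi.single_smul]
  congr 1
  change inclF p F _ * _ = _
  rw [← mul_assoc, ← map_mul, omega_add, ← zpow_one_add₀ (unif_ne_zero D), add_sub_cancel]

end Coordinates

end SymplecticLocalModel

namespace SymplecticLocalModel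


/-! ### The ring `𝔽[u]/(u^e)` and evaluation at a nilpotent element. -/

section TruncRing

variable {𝔽 : Type*} [Field 𝔽] {e : ℕ}

variable (𝔽 e) in
/-- The reduction map `𝔽⟦u⟧ → 𝔽[u]/(u^e)`. -/
abbrev truncMk : 𝔽⟦X⟧ →+* TruncRing 𝔽 e := Ideal.Quotient.mk _

theorem truncMk_eq_zero_iff {f : 𝔽⟦X⟧} : truncMk 𝔽 e f = 0 ↔ (PowerSeries.X : 𝔽⟦X⟧) ^ e ∣ f := by
  rw [Ideal.Quotient.eq_zero_iff_mem, Ideal.mem_span_singleton]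

theorem truncMk_eq_iff {f g : 𝔽⟦X⟧} :
    truncMk 𝔽 e f = truncMk 𝔽 e g ↔ (PowerSeries.X : 𝔽⟦X⟧) ^ e ∣ f - g := by
  rw [← sub_eq_zero, ← map_sub, truncMk_eq_zero_iff]

theorem truncMk_surjective : Function.Surjective (truncMk 𝔽 e) := Ideal.Quotient.mk_surjective

theorem truncMk_X_pow : truncMk 𝔽 e PowerSeries.X ^ e = 0 := by
  rw [← map_pow, truncMk_eq_zero_iff]

theorem truncMk_C (c : 𝔽) : truncMk 𝔽 e (PowerSeries.C c) = algebraMap 𝔽 _ c := rfl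

variable (𝔽 e) in
/-- The coefficients of `u^0, …, u^{e-1}`. -/
def truncCoeff : TruncRing 𝔽 e ≃ₗ[𝔽] (Fin e → 𝔽) :=
  LinearEquiv.ofBijective
    (Submodule.liftQ ((Ideal.span {(PowerSeries.X : 𝔽⟦X⟧) ^ e}).restrictScalars 𝔽)
      (LinearMap.pi fun m : Fin e => PowerSeries.coeff (R := 𝔽) m) (by
        intro f hf
        obtain ⟨g, rfl⟩ := Ideal.mem_span_singleton.1 hf
        rw [LinearMap.mem_ker]
        funext m
        exact PowerSeries.X_pow_dvd_iff.1 (dvd_mul_right _ g) m m.2) :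
      (𝔽⟦X⟧ ⧸ (Ideal.span {(PowerSeries.X : 𝔽⟦X⟧) ^ e}).restrictScalars 𝔽) →ₗ[𝔽] (Fin e → 𝔽)) (by
    constructor
    · rw [← LinearMap.ker_eq_bot, LinearMap.ker_eq_bot']
      intro x hx
      obtain ⟨f, rfl⟩ := Submodule.Quotient.mk_surjective _ x
      refine (Submodule.Quotient.mk_eq_zero _).2 (Ideal.mem_span_singleton.2 ?_)
      exact PowerSeries.X_pow_dvd_iff.2 fun m hm => congrFun hx ⟨m, hm⟩
    · intro c
      refine ⟨Submodule.Quotient.mk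
        (PowerSeries.mk fun m => if h : m < e then c ⟨m, h⟩ else 0), ?_⟩
      funext m
      exact (PowerSeries.coeff_mk (R := 𝔽) (m : ℕ)
        fun m => if h : m < e then c ⟨m, h⟩ else 0).trans (dif_pos m.2))

instance : Module.Finite 𝔽 (TruncRing 𝔽 e) := Module.Finite.equiv (truncCoeff 𝔽 e).symm

theorem finrank_truncRing : Module.finrank 𝔽 (TruncRing 𝔽 e) = e := by
  rw [(truncCoeff 𝔽 e).finrank_eq, Module.finrank_fin_fun]

section Eval

variable {B : Type*} [CommRing B] [Algebra 𝔽 B]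

theorem aeval_trunc_coe {π : B} (hπ : π ^ e = 0) (f : 𝔽[X]) :
    Polynomial.aeval π (PowerSeries.trunc e (f : 𝔽⟦X⟧)) = Polynomial.aeval π f := by
  have h : Polynomial.X ^ e ∣ f - PowerSeries.trunc e (f : 𝔽⟦X⟧) := by
    refine Polynomial.X_pow_dvd_iff.2 fun d hd => ?_
    rw [Polynomial.coeff_sub, PowerSeries.coeff_trunc, if_pos hd, Polynomial.coeff_coe, sub_self]
  obtain ⟨g, hg⟩ := h
  have h1 := congrArg (Polynomial.aeval π) hg
  rw [map_sub, map_mul, map_pow, Polynomial.aeval_X, hπ, zero_mul, sub_eq_zero] at h1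
  exact h1.symm

/-- Evaluation of power series at a nilpotent element. -/
def nilEval (π : B) (hπ : π ^ e = 0) : 𝔽⟦X⟧ →ₐ[𝔽] B where
  toFun f := Polynomial.aeval π (PowerSeries.trunc e f)
  map_one' := by
    have h := aeval_trunc_coe hπ (1 : 𝔽[X])
    rw [Polynomial.coe_one] at h
    exact h.trans (map_one _)
  map_mul' f g := by
    rw [← PowerSeries.trunc_trunc_mul_trunc, ← Polynomial.coe_mul, aeval_trunc_coe hπ, map_mul]
  map_zero' := by rw [map_zero, map_zero]
  map_add' f g := by rw [map_add, map_add]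
  commutes' c := by
    have h := aeval_trunc_coe hπ (Polynomial.C c)
    rwa [Polynomial.coe_C, Polynomial.aeval_C] at h

theorem nilEval_X (π : B) (hπ : π ^ e = 0) : nilEval (𝔽 := 𝔽) π hπ PowerSeries.X = π := by
  have h := aeval_trunc_coe hπ (Polynomial.X : 𝔽[X])
  rwa [Polynomial.coe_X, Polynomial.aeval_X] at h

/-- Evaluation of truncated power series at a nilpotent element. -/
def truncEval (π : B) (hπ : π ^ e = 0) : TruncRing 𝔽 e →ₐ[𝔽] B :=
  Ideal.Quotient.liftₐ _ (nilEval π hπ) (by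
    intro f hf
    obtain ⟨g, rfl⟩ := Ideal.mem_span_singleton.1 hf
    rw [map_mul, map_pow, nilEval_X, hπ, zero_mul])

theorem truncEval_X (π : B) (hπ : π ^ e = 0) :
    truncEval (𝔽 := 𝔽) π hπ (truncMk 𝔽 e PowerSeries.X) = π := nilEval_X π hπ

end Eval

end TruncRing

end SymplecticLocalModel

namespace SymplecticLocalModel


/-! ### Ramification at `p` and the nilpotent uniformizer. -/

section Ramification

variable {p : ℕ} [Fact p.Prime] {F : Type*} [Field F] [NumberField F] (D : LocalDatum p F)

omit [Fact p.Prime] in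
theorem absNorm_span_p : Ideal.absNorm (Ideal.span {(p : 𝓞 F)}) = p ^ Module.finrank ℚ F := by
  rw [Ideal.absNorm_span_singleton, ← NumberField.RingOfIntegers.rank]
  have := Algebra.norm_algebraMap (R := ℤ) (S := 𝓞 F) (p : ℤ)
  rw [show algebraMap ℤ (𝓞 F) p = (p : 𝓞 F) by simp] at this
  rw [this, Int.natAbs_pow, Int.natAbs_natCast]

theorem absNorm_P_pow : Ideal.absNorm D.P ^ D.e = p ^ Module.finrank ℚ F := by
  rw [← absNorm_span_p, D.span_p, map_pow]

theorem e_ne_zero : D.e ≠ 0 := by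
  intro h
  have h1 := absNorm_P_pow D
  rw [h, pow_zero] at h1
  exact (Nat.one_lt_pow (Module.finrank_pos (R := ℚ) (M := F)).ne'
    (Fact.out : p.Prime).one_lt).ne h1

theorem P_ne_bot : D.P ≠ ⊥ := by
  intro h
  have h1 := absNorm_P_pow D
  rw [h, Ideal.absNorm_bot, zero_pow (e_ne_zero D)] at h1
  exact pow_ne_zero _ (Fact.out : p.Prime).ne_zero h1.symm

instance : D.P.IsPrime := D.isPrime

instance : D.P.IsMaximal := D.isPrime.isMaximal (P_ne_bot D)

instance : Finite (𝓞 F ⧸ D.P) := Ideal.finiteQuotientOfFreeOfNeBot _ (P_ne_bot D)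

instance : Field (𝓞 F ⧸ D.P) := Ideal.Quotient.field _

instance : Fintype (𝓞 F ⧸ D.P) := Fintype.ofFinite _

theorem card_residue : Fintype.card (𝓞 F ⧸ D.P) ^ D.e = p ^ Module.finrank ℚ F := by
  rw [← absNorm_P_pow, Ideal.absNorm_apply, Submodule.cardQuot_apply, Nat.card_eq_fintype_card]

theorem p_mem_P : (p : 𝓞 F) ∈ D.P := by
  have h : (p : 𝓞 F) ∈ D.P ^ D.e := D.span_p ▸ Ideal.mem_span_singleton_self _
  exact Ideal.pow_le_self (e_ne_zero D) h

instance : CharP (𝓞 F ⧸ D.P) p := by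
  refine (CharP.charP_iff_prime_eq_zero (Fact.out : p.Prime)).2 ?_
  rw [← map_natCast (Ideal.Quotient.mk D.P)]
  exact Ideal.Quotient.eq_zero_iff_mem.2 (p_mem_P D)

instance : Algebra (ZMod p) (𝓞 F ⧸ D.P) := ZMod.algebra _ p

/-- The relation `f e = [F : ℚ]`, from the norm of the ideal `(p) = 𝒫^e`. -/
theorem finrank_residue_mul : Module.finrank (ZMod p) (𝓞 F ⧸ D.P) * D.e = Module.finrank ℚ F := by
  have h := card_residue D
  rw [Module.card_eq_pow_finrank (K := ZMod p), ZMod.card, ← pow_mul] at h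
  exact Nat.pow_right_injective (Fact.out : p.Prime).two_le h

/-- The ideal `(a) + (p)` contains `(p) = 𝒫^e`, so it is a power of `𝒫`; from `a ∈ 𝒫`, `a ∉ 𝒫²` and
`p ∈ 𝒫` it is `𝒫` itself. Since `p` dies in `𝔽`, the images of elements of `𝒫` become multiples of
`π`. -/
theorem exists_generator : ∃ a ∈ D.P, ∃ s : ℤ, ¬ (p : ℤ) ∣ s ∧ inclO p F a = s • unifO D ∧
    ∀ b ∈ D.P, ∃ x y : 𝓞 F, b = x * a + y * p := by
  obtain ⟨a, ha, ha2, s, hs, h⟩ := D.unif_spec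
  refine ⟨a, ha, s, hs, ?_, ?_⟩
  · apply Subtype.ext
    change inclF p F a = ((s • unifO D : Op p F) : Kp p F)
    rw [← h, map_mul, map_intCast, zsmul_eq_mul]
    rfl
  · have hP : Prime D.P := Ideal.prime_of_isPrime (P_ne_bot D) D.isPrime
    have h1 : Ideal.span {a} ⊔ Ideal.span {(p : 𝓞 F)} = D.P := by
      have hd : Ideal.span {a} ⊔ Ideal.span {(p : 𝓞 F)} ∣ D.P ^ D.e := by
        rw [Ideal.dvd_iff_le, ← D.span_p]
        exact le_sup_right
      obtain ⟨m, -, hm⟩ := (dvd_prime_pow hP _).1 hd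
      rw [associated_iff_eq] at hm
      have ham : a ∈ D.P ^ m := hm ▸ Ideal.mem_sup_left (Ideal.mem_span_singleton_self a)
      rcases m with _ | _ | m
      · exfalso
        rw [pow_zero, Ideal.one_eq_top] at hm
        refine D.isPrime.ne_top (top_le_iff.1 (hm ▸ sup_le ?_ ?_)) <;>
          rw [Ideal.span_singleton_le_iff_mem]
        exacts [ha, p_mem_P D]
      · rwa [zero_add, pow_one] at hm
      · exact absurd (Ideal.pow_le_pow_right (by omega) ham) ha2
    intro b hb
    rw [← h1, Ideal.mem_span_singleton_sup] at hb
    obtain ⟨x, b', hb', rfl⟩ := hb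
    obtain ⟨y, rfl⟩ := Ideal.mem_span_singleton'.1 hb'
    exact ⟨x, y, rfl⟩

variable (𝔽 : Type*) [Field 𝔽] [Algebra ℤ_[p] 𝔽]

/-- The map `𝒪_F → 𝒪_F ⊗ 𝔽`. -/
def inclOF : 𝓞 F →+* OF p F 𝔽 :=
  (Algebra.TensorProduct.includeRight : Op p F →ₐ[ℤ_[p]] OF p F 𝔽).toRingHom.comp (inclOHom p F)

theorem inclOF_apply (a : 𝓞 F) : inclOF 𝔽 a = (1 ⊗ₜ inclO p F a : OF p F 𝔽) := rfl

theorem finrank_OF : Module.finrank 𝔽 (OF p F 𝔽) = Module.finrank ℚ F := by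
  rw [Module.finrank_eq_card_basis (ofBasis p F 𝔽), ← NumberField.RingOfIntegers.rank,
    Module.finrank_eq_card_basis (NumberField.RingOfIntegers.basis F)]

instance : Nontrivial (OF p F 𝔽) :=
  Module.nontrivial_of_finrank_pos (R := 𝔽) (by rw [finrank_OF]; exact Module.finrank_pos)

variable [CharP 𝔽 p]

instance : CharP (OF p F 𝔽) p := charP_of_injective_algebraMap (algebraMap 𝔽 (OF p F 𝔽)).injective p

variable {𝔽}

omit [Fact p.Prime] [Algebra ℤ_[p] 𝔽] in
theorem intCast_ne_zero_of_not_dvd {s : ℤ} (hs : ¬ (p : ℤ) ∣ s) : (s : 𝔽) ≠ 0 :=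
  fun h => hs ((CharP.intCast_eq_zero_iff 𝔽 p s).1 h)

/-- Up to an integer prime to `p`, `π` is the image of some `a ∈ 𝒫`, and `a^e ∈ 𝒫^e = (p)`. -/
theorem unifF_pow_e : unifF 𝔽 D ^ D.e = 0 := by
  obtain ⟨a, ha, s, hs, h, -⟩ := exists_generator D
  have h1 : a ^ D.e ∈ Ideal.span {(p : 𝓞 F)} := D.span_p ▸ Ideal.pow_mem_pow ha _
  obtain ⟨y, hy⟩ := Ideal.mem_span_singleton'.1 h1
  have h2 : inclOF 𝔽 a = (s : OF p F 𝔽) * unifF 𝔽 D := by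
    rw [inclOF_apply, h, TensorProduct.tmul_smul, zsmul_eq_mul]
    rfl
  have h3 : ((s : OF p F 𝔽) * unifF 𝔽 D) ^ D.e = 0 := by
    rw [← h2, ← map_pow, ← hy, map_mul, map_natCast, CharP.cast_eq_zero, mul_zero]
  rw [mul_pow] at h3
  have hu : IsUnit (s : OF p F 𝔽) := by
    have := (IsUnit.mk0 _ (intCast_ne_zero_of_not_dvd (𝔽 := 𝔽) hs)).map (algebraMap 𝔽 (OF p F 𝔽))
    rwa [map_intCast] at this
  exact (hu.pow _).mul_right_eq_zero.1 h3

theorem exists_inclOF_eq {b : 𝓞 F} (hb : b ∈ D.P) : ∃ y, inclOF 𝔽 b = unifF 𝔽 D * y := by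
  obtain ⟨a, -, s, -, h, hP⟩ := exists_generator D
  obtain ⟨x, y, rfl⟩ := hP b hb
  refine ⟨inclOF 𝔽 x * (s : OF p F 𝔽), ?_⟩
  have h2 : inclOF 𝔽 a = (s : OF p F 𝔽) * unifF 𝔽 D := by
    rw [inclOF_apply, h, TensorProduct.tmul_smul, zsmul_eq_mul]
    rfl
  rw [map_add, map_mul, map_mul, map_natCast, CharP.cast_eq_zero, h2]
  ring

end Ramification

end SymplecticLocalModel

namespace SymplecticLocalModel


/-! ### Embeddings of a finite field and independence of characters. -/

section Characters

variable (p : ℕ) [Fact p.Prime] {k 𝔽 : Type*} [Field k] [Finite k] [CharP k p] [Field 𝔽] [CharP 𝔽 p]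

theorem ringHom_apply_algebraMap_zmod {R S : Type*} [CommRing R] [CommRing S] [Algebra (ZMod p) R]
    [Algebra (ZMod p) S] (f : R →+* S) (r : ZMod p) :
    f (algebraMap (ZMod p) R r) = algebraMap (ZMod p) S r :=
  RingHom.congr_fun (Subsingleton.elim (f.comp (algebraMap (ZMod p) R)) (algebraMap (ZMod p) S)) r

/-- Ring homomorphisms between algebras over the prime field are algebra homomorphisms. -/
def ringHomEquivAlgHom [Algebra (ZMod p) k] [Algebra (ZMod p) 𝔽] :
    (k →+* 𝔽) ≃ (k →ₐ[ZMod p] 𝔽) where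
  toFun f := { f with commutes' := ringHom_apply_algebraMap_zmod p f }
  invFun f := f
  left_inv _ := rfl
  right_inv _ := rfl

include p in
theorem finite_ringHom : Finite (k →+* 𝔽) := by
  let := ZMod.algebra k p
  let := ZMod.algebra 𝔽 p
  exact Finite.of_equiv _ (ringHomEquivAlgHom p).symm

omit [CharP k p] in
theorem card_ringHom [IsAlgClosed 𝔽] [Algebra (ZMod p) k] :
    Nat.card (k →+* 𝔽) = Module.finrank (ZMod p) k := by
  let := ZMod.algebra 𝔽 p
  rw [Nat.card_congr (ringHomEquivAlgHom p), Nat.card_eq_fintype_card, AlgHom.card]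

include p in
/-- A homomorphism from a finite field `k` to an `𝔽`-algebra extends to the algebra of functions on
the set of embeddings `k → 𝔽`. -/
theorem exists_extension_to_functions [IsAlgClosed 𝔽] {B : Type*} [CommRing B] [Algebra 𝔽 B]
    (s : k →+* B) : ∃ E : ((k →+* 𝔽) → 𝔽) →ₐ[𝔽] B, ∀ x, E (fun σ => σ x) = s x := by
  classical
  let := ZMod.algebra k p
  let := ZMod.algebra 𝔽 p
  let : Algebra (ZMod p) B := Algebra.compHom B (algebraMap (ZMod p) 𝔽)
  have : IsScalarTower (ZMod p) 𝔽 B := IsScalarTower.of_algebraMap_eq fun _ => rfl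
  have := finite_ringHom p (k := k) (𝔽 := 𝔽)
  let := Fintype.ofFinite (k →+* 𝔽)
  let ev₀ : k →+* ((k →+* 𝔽) → 𝔽) := RingHom.pi fun σ => σ
  let ev : k →ₐ[ZMod p] ((k →+* 𝔽) → 𝔽) :=
    { ev₀ with commutes' := ringHom_apply_algebraMap_zmod p ev₀ }
  let T : 𝔽 ⊗[ZMod p] k →ₐ[𝔽] ((k →+* 𝔽) → 𝔽) :=
    Algebra.TensorProduct.lift (Algebra.ofId 𝔽 _) ev fun _ _ => Commute.all _ _
  have hT : ∀ x, T (1 ⊗ₜ x) = fun σ => σ x := fun x => by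
    simp only [T, Algebra.TensorProduct.lift_tmul, map_one, one_mul]
    rfl
  -- A functional vanishing on the image would be a linear relation between distinct embeddings,
  -- which independence of characters excludes.
  have hsurj : Function.Surjective T := by
    rw [← AlgHom.coe_toLinearMap, ← LinearMap.range_eq_top]
    by_contra hne
    obtain ⟨f, hf0, hf⟩ := Submodule.exists_le_ker_of_lt_top _ (lt_top_iff_ne_top.2 hne)
    apply hf0
    have hf1 : ∀ v, f v = ∑ σ, v σ * f (Pi.single σ 1) := fun v => by
      conv_lhs => rw [← Finset.univ_sum_single v, map_sum]
      refine Finset.sum_congr rfl fun σ _ => ?_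
      rw [← smul_eq_mul, ← map_smul, ← Pi.single_smul, smul_eq_mul, mul_one]
    have hind := (linearIndependent_monoidHom k 𝔽).comp (fun σ : k →+* 𝔽 => (σ : k →* 𝔽))
      (fun σ τ h => RingHom.ext fun x => DFunLike.congr_fun h x)
    rw [Fintype.linearIndependent_iff] at hind
    have h0 := hind (fun σ => f (Pi.single σ 1)) (by
      funext x
      have : f (T (1 ⊗ₜ x)) = 0 :=
        LinearMap.mem_ker.1 (hf (LinearMap.mem_range_self T.toLinearMap (1 ⊗ₜ x)))
      rw [hT, hf1] at this
      simpa [mul_comm] using this)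
    refine LinearMap.ext fun v => ?_
    rw [hf1]
    simp [h0]
  -- Both sides have dimension `[k : 𝔽_p]`, since an algebraically closed field receives that many
  -- embeddings of `k`.
  have hinj : Function.Injective T := by
    rw [← AlgHom.coe_toLinearMap] at hsurj ⊢
    refine (LinearMap.injective_iff_surjective_of_finrank_eq_finrank ?_).2 hsurj
    rw [Module.finrank_baseChange, Module.finrank_fintype_fun_eq_card, ← card_ringHom p (𝔽 := 𝔽),
      Nat.card_eq_fintype_card]
  let T' := AlgEquiv.ofBijective T ⟨hinj, hsurj⟩
  let s' : k →ₐ[ZMod p] B := { s with commutes' := ringHom_apply_algebraMap_zmod p s }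
  refine ⟨(Algebra.TensorProduct.lift (Algebra.ofId 𝔽 B) s' fun _ _ => Commute.all _ _).comp
    T'.symm, fun x => ?_⟩
  have : T'.symm (fun σ => σ x) = 1 ⊗ₜ x := by
    rw [AlgEquiv.symm_apply_eq]
    exact (hT x).symm
  rw [AlgHom.comp_apply]
  erw [this]
  rw [Algebra.TensorProduct.lift_tmul, map_one, one_mul]
  rfl

end Characters

end SymplecticLocalModel

namespace SymplecticLocalModel


/-! ### The canonical decomposition of `𝒪_F ⊗ 𝔽`. -/

section Decomposition

variable {p : ℕ} [Fact p.Prime] {F : Type*} [Field F] [NumberField F]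
  {𝔽 : Type*} [Field 𝔽] [Algebra ℤ_[p] 𝔽] [CharP 𝔽 p] (D : LocalDatum p F)

theorem e_le_pow : D.e ≤ p ^ Module.finrank ℚ F := by
  have h : D.e ≤ Module.finrank ℚ F := by
    rw [← finrank_residue_mul D]
    exact Nat.le_mul_of_pos_left _ Module.finrank_pos
  exact h.trans (Nat.lt_pow_self (Fact.out : p.Prime).one_lt).le

theorem unifF_pow_card : unifF 𝔽 D ^ p ^ Module.finrank ℚ F = 0 :=
  pow_eq_zero_of_le (e_le_pow D) (unifF_pow_e D)

variable (𝔽) in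
/-- The embedding of the residue field into `𝒪_F ⊗ 𝔽`. -/
def teich : (𝓞 F ⧸ D.P) →+* OF p F 𝔽 :=
  Ideal.Quotient.lift D.P
    -- Images of elements of `𝒫` are multiples of `π`, and `π^e = 0` with `e ≤ p^{[F:ℚ]}`; so this
    -- Frobenius power kills `𝒫` and factors through the residue field.
    ((iterateFrobenius (OF p F 𝔽) p (Module.finrank ℚ F)).comp (inclOF 𝔽)) (by
      intro a ha
      obtain ⟨y, hy⟩ := exists_inclOF_eq (𝔽 := 𝔽) D ha
      rw [RingHom.comp_apply, iterateFrobenius_def, hy, mul_pow, unifF_pow_card, zero_mul])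

theorem teich_mk (a : 𝓞 F) :
    teich 𝔽 D (Ideal.Quotient.mk D.P a) = (inclOF 𝔽 a : OF p F 𝔽) ^ p ^ Module.finrank ℚ F := rfl

/-- As `p^{[F:ℚ]} = q^e` with `q` the order of the residue field, the Frobenius power is the
identity there; `teich` is therefore a section modulo `π`. -/
theorem exists_teich_eq (a : 𝓞 F) :
    ∃ y, inclOF 𝔽 a = teich 𝔽 D (Ideal.Quotient.mk D.P a) + unifF 𝔽 D * y := by
  have h : a - a ^ p ^ Module.finrank ℚ F ∈ D.P := by
    rw [← Ideal.Quotient.eq_zero_iff_mem, map_sub, map_pow, ← card_residue D,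
      FiniteField.pow_card_pow, sub_self]
  obtain ⟨y, hy⟩ := exists_inclOF_eq (𝔽 := 𝔽) D h
  refine ⟨y, ?_⟩
  rw [teich_mk, ← hy, map_sub, map_pow]
  ring

/-- Every element is congruent modulo `π` to an element of `S`; iterating `e` times leaves the error
`π^e = 0`. -/
theorem subalgebra_eq_top {S : Subalgebra 𝔽 (OF p F 𝔽)} (hπ : unifF 𝔽 D ∈ S)
    (hs : ∀ x, teich 𝔽 D x ∈ S) : S = ⊤ := by
  have h1 : ∀ b : OF p F 𝔽, ∃ r ∈ S, ∃ y, b = r + unifF 𝔽 D * y := by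
    intro b
    rw [← (ofBasis p F 𝔽).sum_repr b]
    choose y hy using fun k => exists_teich_eq (𝔽 := 𝔽) D (NumberField.RingOfIntegers.basis F k)
    refine ⟨∑ k, (ofBasis p F 𝔽).repr b k • teich 𝔽 D (Ideal.Quotient.mk D.P
      (NumberField.RingOfIntegers.basis F k)), S.sum_mem fun k _ => S.smul_mem (hs _) _,
      ∑ k, (ofBasis p F 𝔽).repr b k • y k, ?_⟩
    rw [Finset.mul_sum, ← Finset.sum_add_distrib]
    refine Finset.sum_congr rfl fun k _ => ?_
    rw [mul_smul_comm, ← smul_add, ← hy, ofBasis_apply, inclOF_apply]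
  have h2 : ∀ m (b : OF p F 𝔽), ∃ r ∈ S, ∃ y, b = r + unifF 𝔽 D ^ m * y := by
    intro m
    induction m with
    | zero => exact fun b => ⟨0, S.zero_mem, b, by simp⟩
    | succ m ih =>
      intro b
      obtain ⟨r, hr, y, rfl⟩ := h1 b
      obtain ⟨r', hr', y', rfl⟩ := ih y
      exact ⟨r + unifF 𝔽 D * r', S.add_mem hr (S.mul_mem hπ hr'), y', by ring⟩
  refine eq_top_iff.2 fun b _ => ?_
  obtain ⟨r, hr, y, rfl⟩ := h2 D.e b
  rw [unifF_pow_e, zero_mul, add_zero]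
  exact hr

instance : Finite (Emb 𝔽 D) := finite_ringHom p

instance : Fintype (Emb 𝔽 D) := Fintype.ofFinite _

omit [Algebra ℤ_[p] 𝔽] in
theorem card_emb_mul [IsAlgClosed 𝔽] : Fintype.card (Emb 𝔽 D) * D.e = Module.finrank ℚ F := by
  rw [← finrank_residue_mul D, ← card_ringHom p (𝔽 := 𝔽), Nat.card_eq_fintype_card]

-- Extending `teich` to functions on the embeddings gives orthogonal idempotents with sum `1`; on
-- each factor `u` is sent to `π`. The image contains `π` and `teich`, so the map is onto, and it is
-- bijective because `|𝔖| e = [F : ℚ]`.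
open scoped Classical in
theorem exists_inverse_decomp [IsAlgClosed 𝔽] :
    ∃ Ψ : (Emb 𝔽 D → TruncRing 𝔽 D.e) ≃ₐ[𝔽] OF p F 𝔽,
      Ψ (fun _ => truncMk 𝔽 D.e PowerSeries.X) = unifF 𝔽 D ∧
      ∀ x, Ψ (fun σ => algebraMap 𝔽 _ (σ x)) = teich 𝔽 D x := by
  obtain ⟨E, hE⟩ := exists_extension_to_functions (𝔽 := 𝔽) p (teich 𝔽 D)
  set ev : TruncRing 𝔽 D.e →ₐ[𝔽] OF p F 𝔽 := truncEval (unifF 𝔽 D) (unifF_pow_e D) with hev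
  have hsum : ∑ σ, E (Pi.single σ 1) = 1 := by
    rw [← map_sum, Finset.univ_sum_single (fun _ => (1 : 𝔽))]
    exact map_one E
  have hsq : ∀ σ, E (Pi.single σ 1) * E (Pi.single σ 1) = E (Pi.single σ 1) := fun σ => by
    rw [← map_mul, ← Pi.single_mul, mul_one]
  have horth : ∀ σ τ, σ ≠ τ → E (Pi.single σ 1) * E (Pi.single τ 1) = 0 := fun σ τ h => by
    have h0 : (Pi.single σ 1 * Pi.single τ 1 : Emb 𝔽 D → 𝔽) = 0 := by
      funext ρ
      rcases eq_or_ne ρ σ with rfl | hρ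
      · rw [Pi.mul_apply, Pi.single_eq_of_ne h, mul_zero, Pi.zero_apply]
      · rw [Pi.mul_apply, Pi.single_eq_of_ne hρ, zero_mul, Pi.zero_apply]
    rw [← map_mul, h0, map_zero]
  have hdecomp : ∀ c : Emb 𝔽 D → 𝔽, E c = ∑ σ, c σ • E (Pi.single σ 1) := fun c => by
    conv_lhs => rw [← Finset.univ_sum_single c, map_sum]
    refine Finset.sum_congr rfl fun σ _ => ?_
    rw [← map_smul, ← Pi.single_smul, smul_eq_mul, mul_one]
  let Ψ : (Emb 𝔽 D → TruncRing 𝔽 D.e) →ₐ[𝔽] OF p F 𝔽 := AlgHom.ofLinearMap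
    { toFun := fun f => ∑ σ, E (Pi.single σ 1) * ev (f σ)
      map_add' := fun f g => by
        simp only [Pi.add_apply, map_add, mul_add, Finset.sum_add_distrib]
      map_smul' := fun c f => by
        simp only [Pi.smul_apply, map_smul, mul_smul_comm, Finset.smul_sum, RingHom.id_apply] }
    (by simp [hsum])
    (by
      intro f g
      change ∑ σ, E (Pi.single σ 1) * ev ((f * g) σ) =
        (∑ σ, E (Pi.single σ 1) * ev (f σ)) * ∑ σ, E (Pi.single σ 1) * ev (g σ)
      rw [Finset.sum_mul_sum]
      refine Finset.sum_congr rfl fun σ _ => ?_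
      rw [Finset.sum_eq_single σ]
      · rw [Pi.mul_apply, map_mul]
        linear_combination (-ev (f σ) * ev (g σ)) * hsq σ
      · intro τ _ h
        linear_combination (ev (f σ) * ev (g τ)) * horth σ τ h.symm
      · exact fun h => absurd (Finset.mem_univ _) h)
  have hΨ : ∀ f, Ψ f = ∑ σ, E (Pi.single σ 1) * ev (f σ) := fun f => rfl
  have hX : Ψ (fun _ => truncMk 𝔽 D.e PowerSeries.X) = unifF 𝔽 D := by
    rw [hΨ, ← Finset.sum_mul, hsum, one_mul, hev, truncEval_X]
  have hc : ∀ c : Emb 𝔽 D → 𝔽, Ψ (fun σ => algebraMap 𝔽 _ (c σ)) = E c := fun c => by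
    rw [hΨ, hdecomp]
    refine Finset.sum_congr rfl fun σ _ => ?_
    rw [AlgHom.commutes, mul_comm]
    exact (Algebra.smul_def _ _).symm
  have hsurj : Function.Surjective Ψ := by
    rw [← AlgHom.range_eq_top]
    refine subalgebra_eq_top D ⟨_, hX⟩ fun x => ⟨_, (hc _).trans (hE x)⟩
  have hinj : Function.Injective Ψ := by
    rw [← AlgHom.coe_toLinearMap] at hsurj ⊢
    refine (LinearMap.injective_iff_surjective_of_finrank_eq_finrank ?_).2 hsurj
    rw [finrank_OF, Module.finrank_pi_fintype]
    simp only [finrank_truncRing, Finset.sum_const, Finset.card_univ, smul_eq_mul, card_emb_mul]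
  exact ⟨AlgEquiv.ofBijective Ψ ⟨hinj, hsurj⟩, hX, fun x => (hc _).trans (hE x)⟩

variable {D}

omit [CharP 𝔽 p] in
theorem IsCanonicalDecomp.map_unifF {Φ : OF p F 𝔽 ≃ₐ[𝔽] (Emb 𝔽 D → TruncRing 𝔽 D.e)}
    (h : IsCanonicalDecomp D Φ) : Φ (unifF 𝔽 D) = fun _ => truncMk 𝔽 D.e PowerSeries.X :=
  funext h.map_unif

/-- The Frobenius power removes the unknown multiple of `u` in the `σ`-component. Hence any two
canonical decompositions agree on `π` and `teich`, which generate, and this is the uniqueness. -/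
theorem IsCanonicalDecomp.map_teich {Φ : OF p F 𝔽 ≃ₐ[𝔽] (Emb 𝔽 D → TruncRing 𝔽 D.e)}
    (h : IsCanonicalDecomp D Φ) (x : 𝓞 F ⧸ D.P) :
    Φ (teich 𝔽 D x) = fun σ => algebraMap 𝔽 _ (σ x) ^ p ^ Module.finrank ℚ F := by
  obtain ⟨a, rfl⟩ := Ideal.Quotient.mk_surjective x
  funext σ
  obtain ⟨y, hy⟩ := Ideal.mem_span_singleton.1 (h.map_residue a σ)
  rw [teich_mk, map_pow, Pi.pow_apply, inclOF_apply, eq_add_of_sub_eq hy]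
  have : CharP (TruncRing 𝔽 D.e) p := by
    have : Nontrivial (TruncRing 𝔽 D.e) := Module.nontrivial_of_finrank_pos (R := 𝔽) (by
      rw [finrank_truncRing]; exact Nat.pos_of_ne_zero (e_ne_zero D))
    exact charP_of_injective_algebraMap (algebraMap 𝔽 (TruncRing 𝔽 D.e)).injective p
  rw [add_pow_char_pow, mul_pow, pow_eq_zero_of_le (e_le_pow D) truncMk_X_pow, zero_mul, zero_add]
  rfl

theorem existsUnique_decomp [IsAlgClosed 𝔽] :
    ∃! Φ : OF p F 𝔽 ≃ₐ[𝔽] (Emb 𝔽 D → TruncRing 𝔽 D.e), IsCanonicalDecomp D Φ := by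
  obtain ⟨Ψ, hX, ht⟩ := exists_inverse_decomp (𝔽 := 𝔽) D
  have h0 : IsCanonicalDecomp D Ψ.symm := by
    refine ⟨fun σ => ?_, fun a σ => ?_⟩
    · rw [← unifF, ← hX, AlgEquiv.symm_apply_apply]
    · obtain ⟨y, hy⟩ := exists_teich_eq (𝔽 := 𝔽) D a
      rw [← inclOF_apply, hy, ← ht, ← hX, map_add, map_mul, AlgEquiv.symm_apply_apply,
        AlgEquiv.symm_apply_apply, Ideal.mem_span_singleton]
      exact ⟨Ψ.symm y σ, by
        rw [Pi.add_apply, Pi.mul_apply]; exact add_sub_cancel_left _ _⟩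
  refine ⟨Ψ.symm, h0, fun Φ hΦ => AlgEquiv.ext fun b => ?_⟩
  have htop : AlgHom.equalizer Φ.toAlgHom Ψ.symm.toAlgHom = ⊤ :=
    subalgebra_eq_top D (hΦ.map_unifF.trans h0.map_unifF.symm)
      fun x => (hΦ.map_teich x).trans (h0.map_teich x).symm
  exact (htop ▸ Algebra.mem_top : b ∈ AlgHom.equalizer Φ.toAlgHom Ψ.symm.toAlgHom)

end Decomposition

end SymplecticLocalModel

namespace SymplecticLocalModel


/-! ### Determinants and the dimensions of components. -/

section DetOfIdempotents

variable {K M : Type*} [Field K] [AddCommGroup M] [Module K M] [Module.Finite K M]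

/-- The map is multiplication by `c` on the image of `E` and the identity on the quotient by it. -/
theorem det_one_add_smul_idempotent {E : Module.End K M} (hE : ∀ x, E (E x) = E x) (c : K) :
    LinearMap.det (1 + (c - 1) • E) = c ^ Module.finrank K (LinearMap.range E) := by
  have hW : LinearMap.range E ≤ (LinearMap.range E).comap (1 + (c - 1) • E) := fun x hx =>
    add_mem hx (Submodule.smul_mem _ _ (LinearMap.mem_range_self E x))
  rw [LinearMap.det_eq_det_mul_det (LinearMap.range E) _ hW]
  have h1 : LinearMap.restrict (p := LinearMap.range E) (q := LinearMap.range E) (1 + (c - 1) • E)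
      (fun _ hx => hW hx) = c • LinearMap.id := by
    ext ⟨_, y, rfl⟩
    change E y + (c - 1) • E (E y) = c • E y
    rw [hE, sub_smul, one_smul, add_sub_cancel]
  have h2 : (LinearMap.range E).mapQ (LinearMap.range E) (1 + (c - 1) • E) hW = LinearMap.id := by
    refine Submodule.linearMap_qext _ (LinearMap.ext fun x => ?_)
    refine (Submodule.Quotient.eq _).2 ?_
    change x + (c - 1) • E x - x ∈ _
    rw [add_sub_cancel_left]
    exact Submodule.smul_mem _ _ (LinearMap.mem_range_self E x)
  rw [h1, h2, LinearMap.det_smul, LinearMap.det_id, LinearMap.det_id, mul_one, mul_one]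

variable {A S : Type*} [CommRing A] [Algebra K A] [Module A M] [IsScalarTower K A M] {e : ℕ}

theorem exists_const_sub_mem (f : TruncRing K e) :
    ∃ c : K, f - algebraMap K _ c ∈ Ideal.span {truncMk K e PowerSeries.X} := by
  obtain ⟨f, rfl⟩ := truncMk_surjective f
  refine ⟨PowerSeries.constantCoeff f, ?_⟩
  rw [← truncMk_C, ← map_sub]
  have h : PowerSeries.X ∣ f - PowerSeries.C (PowerSeries.constantCoeff f) := by
    rw [PowerSeries.X_dvd_iff]; simp
  obtain ⟨g, hg⟩ := h
  rw [hg, map_mul]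
  exact Ideal.mul_mem_right _ _ (Ideal.mem_span_singleton_self _)

theorem truncRing_charP (p : ℕ) [CharP K p] (he : e ≠ 0) : CharP (TruncRing K e) p := by
  have : Nontrivial (TruncRing K e) := Module.nontrivial_of_finrank_pos (R := K) (by
    rw [finrank_truncRing]; exact Nat.pos_of_ne_zero he)
  exact charP_of_injective_algebraMap (algebraMap K (TruncRing K e)).injective p

variable [Fintype S] [DecidableEq S]

theorem det_lsmul_const (Φ : A ≃ₐ[K] (S → TruncRing K e)) (c : S → K) :
    LinearMap.det (Algebra.lsmul K K M (Φ.symm fun σ => algebraMap K _ (c σ))) =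
      ∏ σ, c σ ^ Module.finrank K
        (LinearMap.range (Algebra.lsmul K K M (Φ.symm (Pi.single σ 1)))) := by
  have h : (fun σ => algebraMap K (TruncRing K e) (c σ)) =
      ∏ σ, (1 + (c σ - 1) • (Pi.single σ 1 : S → TruncRing K e)) := by
    funext τ
    rw [Finset.prod_apply, Finset.prod_eq_single τ]
    · rw [Pi.add_apply, Pi.smul_apply, Pi.single_eq_same, Pi.one_apply, ← Algebra.algebraMap_eq_smul_one,
        map_sub, map_one, add_sub_cancel]
    · intro σ _ hσ
      rw [Pi.add_apply, Pi.smul_apply, Pi.single_eq_of_ne hσ.symm, smul_zero, add_zero,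
        Pi.one_apply]
    · exact fun h => absurd (Finset.mem_univ _) h
  let d : A →* K := (LinearMap.det : Module.End K M →* K).comp
    ((Algebra.lsmul K K M : A →ₐ[K] Module.End K M) : A →* Module.End K M)
  change d _ = _
  rw [h, map_prod, map_prod]
  refine Finset.prod_congr rfl fun σ _ => ?_
  change LinearMap.det (Algebra.lsmul K K M (Φ.symm (1 + (c σ - 1) • Pi.single σ 1))) = _
  rw [map_add, map_smul, map_one, map_add, map_smul, map_one]
  refine det_one_add_smul_idempotent (fun x => ?_) _
  change Φ.symm (Pi.single σ 1) • Φ.symm (Pi.single σ 1) • x = Φ.symm (Pi.single σ 1) • x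
  rw [smul_smul, ← map_mul, ← Pi.single_mul, mul_one]

/-- `α` and the tuple of its constant terms have the same `p^e`-th power, and the `p^e`-power map is
injective on `K`; so their determinants agree. -/
theorem det_lsmul_eq_prod (p : ℕ) [Fact p.Prime] [CharP K p] (he : e ≠ 0)
    (Φ : A ≃ₐ[K] (S → TruncRing K e)) (α : A) (c : S → K)
    (h : ∀ σ, Φ α σ - algebraMap K _ (c σ) ∈ Ideal.span {truncMk K e PowerSeries.X}) :
    LinearMap.det (Algebra.lsmul K K M α) =
      ∏ σ, c σ ^ Module.finrank K
        (LinearMap.range (Algebra.lsmul K K M (Φ.symm (Pi.single σ 1)))) := by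
  rw [← det_lsmul_const]
  have := truncRing_charP (K := K) p he
  have h1 : α ^ p ^ e = (Φ.symm fun σ => algebraMap K _ (c σ)) ^ p ^ e := by
    apply Φ.injective
    rw [map_pow, map_pow, AlgEquiv.apply_symm_apply]
    funext σ
    obtain ⟨y, hy⟩ := Ideal.mem_span_singleton.1 (h σ)
    rw [Pi.pow_apply, Pi.pow_apply, eq_add_of_sub_eq hy, add_pow_char_pow, mul_pow,
      pow_eq_zero_of_le (Nat.lt_pow_self (Fact.out : p.Prime).one_lt).le truncMk_X_pow, zero_mul,
      zero_add]
  have h2 := congrArg (fun a => LinearMap.det (Algebra.lsmul K K M a)) h1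
  simp only [map_pow] at h2
  rw [← iterateFrobenius_def, ← iterateFrobenius_def] at h2
  exact iterateFrobenius_inj K p e h2

omit [Fintype S] in
theorem finrank_range_single (Φ : A ≃ₐ[K] (S → TruncRing K e)) (σ : S) :
    Module.finrank K (LinearMap.range (Algebra.lsmul K K A (Φ.symm (Pi.single σ 1)))) = e := by
  have h : LinearMap.range (Algebra.lsmul K K A (Φ.symm (Pi.single σ 1))) =
      LinearMap.range (Φ.symm.toLinearMap ∘ₗ LinearMap.single K (fun _ : S => TruncRing K e) σ) := by
    apply le_antisymm
    · rintro _ ⟨a, rfl⟩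
      refine ⟨Φ a σ, ?_⟩
      change Φ.symm (Pi.single σ (Φ a σ)) = Φ.symm (Pi.single σ 1) * a
      rw [AlgEquiv.symm_apply_eq, map_mul, AlgEquiv.apply_symm_apply, ← Pi.single_mul_left, one_mul]
    · rintro _ ⟨f, rfl⟩
      refine ⟨Φ.symm fun _ => f, ?_⟩
      change Φ.symm (Pi.single σ 1) * _ = Φ.symm (Pi.single σ f)
      rw [← map_mul, ← Pi.single_mul_left, one_mul]
  rw [h, LinearMap.finrank_range_of_inj, finrank_truncRing]
  refine Φ.symm.injective.comp fun f g h => ?_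
  have := congrFun h σ
  rwa [LinearMap.single_apply, LinearMap.single_apply, Pi.single_eq_same, Pi.single_eq_same] at this

/-- The determinant of `M` is the `n`-th power of that of `A` if and only if every component of `M`
has dimension `n * e`. -/
theorem det_lsmul_eq_norm_pow_iff [Infinite K] [Module.Finite K A] (p : ℕ) [Fact p.Prime]
    [CharP K p] (he : e ≠ 0) (Φ : A ≃ₐ[K] (S → TruncRing K e)) (n : ℕ) :
    (∀ α : A, LinearMap.det (Algebra.lsmul K K M α) = Algebra.norm K α ^ n) ↔
      ∀ σ, Module.finrank K
        (LinearMap.range (Algebra.lsmul K K M (Φ.symm (Pi.single σ 1)))) = n * e := by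
  have hnorm : ∀ α, Algebra.norm K α = LinearMap.det (Algebra.lsmul K K A α) := fun α => rfl
  constructor
  · intro h σ
    -- Evaluate at the element equal to `x` in the factor `σ` and to `1` in the others.
    have key : ∀ x : K, x ^ Module.finrank K
        (LinearMap.range (Algebra.lsmul K K M (Φ.symm (Pi.single σ 1)))) = x ^ (n * e) := by
      intro x
      have h1 := h (Φ.symm fun τ => algebraMap K _ (Function.update (1 : S → K) σ x τ))
      rw [hnorm, det_lsmul_const, det_lsmul_const] at h1
      rw [Finset.prod_eq_single σ, Finset.prod_eq_single σ] at h1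
      · rwa [Function.update_self, finrank_range_single, ← pow_mul, mul_comm e] at h1
      · intro τ _ hτ
        rw [Function.update_of_ne hτ, Pi.one_apply, one_pow]
      · exact fun h => absurd (Finset.mem_univ _) h
      · intro τ _ hτ
        rw [Function.update_of_ne hτ, Pi.one_apply, one_pow]
      · exact fun h => absurd (Finset.mem_univ _) h
    have hpoly : (Polynomial.X : K[X]) ^ Module.finrank K
        (LinearMap.range (Algebra.lsmul K K M (Φ.symm (Pi.single σ 1)))) =
          Polynomial.X ^ (n * e) :=
      Polynomial.funext fun x => by simpa using key x
    simpa using congrArg Polynomial.natDegree hpoly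
  · intro h α
    choose c hc using fun σ => exists_const_sub_mem (Φ α σ)
    rw [hnorm, det_lsmul_eq_prod p he Φ α c hc, det_lsmul_eq_prod p he Φ α c hc,
      ← Finset.prod_pow]
    refine Finset.prod_congr rfl fun σ _ => ?_
    rw [h, finrank_range_single, ← pow_mul, mul_comm e]

end DetOfIdempotents

end SymplecticLocalModel

namespace SymplecticLocalModel


/-! ### The determinant condition and the norm form. -/

section DetPoly

variable {F : Type*} [Field F] [NumberField F]

theorem map_det_sum_smul_baseChange {R S M κ : Type*} [CommRing R] [CommRing S] [Algebra R S]
    [AddCommGroup M] [Module R M] [Module.Free R M] [Module.Finite R M] (s : Finset κ) (x : κ → S)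
    (act : κ → Module.End R M) (φ : S →ₐ[R] R) :
    φ (LinearMap.det (∑ k ∈ s, x k • (act k).baseChange S)) =
      LinearMap.det (∑ k ∈ s, φ (x k) • act k) := by
  classical
  let b := Module.Free.chooseBasis R M
  rw [← LinearMap.det_toMatrix b, ← LinearMap.det_toMatrix (Algebra.TensorProduct.basis S b),
    AlgHom.map_det]
  congr 1
  simp only [map_sum, map_smul, LinearMap.toMatrix_baseChange]
  refine Finset.sum_congr rfl fun k _ => ?_
  ext i j
  simp

theorem eval_detPoly {R M : Type*} [CommRing R] [AddCommGroup M] [Module R M] [Module.Free R M]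
    [Module.Finite R M] (act : 𝓞 F → Module.End R M)
    (c : Module.Free.ChooseBasisIndex ℤ (𝓞 F) → R) :
    MvPolynomial.eval c (detPoly F R M act) =
      LinearMap.det (∑ k, c k • act (NumberField.RingOfIntegers.basis F k)) := by
  have h := map_det_sum_smul_baseChange Finset.univ MvPolynomial.X
    (fun k => act (NumberField.RingOfIntegers.basis F k)) (MvPolynomial.aeval c)
  simp only [MvPolynomial.aeval_X] at h
  rw [← h]
  exact (RingHom.congr_fun (MvPolynomial.coe_aeval_eq_eval c) _).symm

variable (F) in
/-- The norm form of `𝒪_F` in the coordinates given by a `ℤ`-basis. -/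
def normPoly : MvPolynomial (Module.Free.ChooseBasisIndex ℤ (𝓞 F)) ℤ :=
  Matrix.det (∑ k, (MvPolynomial.X k : MvPolynomial (Module.Free.ChooseBasisIndex ℤ (𝓞 F)) ℤ) •
    (Algebra.leftMulMatrix (NumberField.RingOfIntegers.basis F)
      (NumberField.RingOfIntegers.basis F k)).map MvPolynomial.C)

/-- Multiplication by an integral basis element has an integer matrix in that basis, and the same
matrix describes it in the base-changed basis `β`. -/
theorem eval_map_normPoly {K A : Type*} [CommRing K] [CommRing A] [Algebra K A] (j : 𝓞 F →+* A)
    (β : Module.Basis (Module.Free.ChooseBasisIndex ℤ (𝓞 F)) K A)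
    (hβ : ∀ k, β k = j (NumberField.RingOfIntegers.basis F k))
    (c : Module.Free.ChooseBasisIndex ℤ (𝓞 F) → K) :
    MvPolynomial.eval c (MvPolynomial.map (Int.castRingHom K) (normPoly F)) =
      Algebra.norm K (∑ k, c k • β k) := by
  have hmat : ∀ x : 𝓞 F, Algebra.leftMulMatrix β (j x) =
      (Algebra.leftMulMatrix (NumberField.RingOfIntegers.basis F) x).map (Int.castRingHom K) := by
    intro x
    ext k l
    rw [Algebra.leftMulMatrix_eq_repr_mul, Matrix.map_apply, Algebra.leftMulMatrix_eq_repr_mul,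
      hβ, ← map_mul]
    have h : j (x * NumberField.RingOfIntegers.basis F l) =
        ∑ m, (((NumberField.RingOfIntegers.basis F).repr
          (x * NumberField.RingOfIntegers.basis F l) m : ℤ) : K) • β m := by
      conv_lhs => rw [← (NumberField.RingOfIntegers.basis F).sum_repr
        (x * NumberField.RingOfIntegers.basis F l), map_sum]
      refine Finset.sum_congr rfl fun m _ => ?_
      rw [map_zsmul, hβ, Int.cast_smul_eq_zsmul]
    rw [h, β.repr_sum_self]
    rfl
  rw [normPoly, Algebra.norm_eq_matrix_det β, RingHom.map_det, RingHom.map_det]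
  congr 1
  simp only [map_sum, map_smul, hβ, hmat]
  refine Finset.sum_congr rfl fun k _ => ?_
  ext i l
  simp

theorem det_lsmul_pi {K A : Type*} [Field K] [CommRing A] [Algebra K A] [Module.Finite K A] (n : ℕ)
    (α : A) : LinearMap.det (Algebra.lsmul K K (Fin n → A) α) = Algebra.norm K α ^ n := by
  have h : Algebra.lsmul K K (Fin n → A) α =
      LinearMap.pi fun i => (Algebra.lmul K A α) ∘ₗ LinearMap.proj i := by
    ext; rfl
  rw [h, LinearMap.det_pi, Finset.prod_const, Finset.card_univ, Fintype.card_fin,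
    Algebra.norm_apply]

theorem det_lsmul_congr {K A M N : Type*} [Field K] [CommRing A] [Algebra K A] [AddCommGroup M]
    [AddCommGroup N] [Module K M] [Module K N] [Module A M] [Module A N] [IsScalarTower K A M]
    [IsScalarTower K A N] (f : M ≃ₗ[A] N) (α : A) :
    LinearMap.det (Algebra.lsmul K K M α) = LinearMap.det (Algebra.lsmul K K N α) := by
  rw [← LinearMap.det_conj (Algebra.lsmul K K M α) (f.restrictScalars K)]
  congr 1
  ext x
  change f (α • f.symm x) = α • x
  rw [map_smul, LinearEquiv.apply_symm_apply]

theorem mem_Vneg {n : ℕ} (v : Fin (2 * n) → ℂ ⊗[ℚ] F) :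
    v ∈ Vneg F n ↔ ∀ j, jsign n _ j * v (Fin.rev j) = (Complex.I ⊗ₜ[ℚ] (1 : F)) * v j := by
  have h : ∀ j, (Jmat n (ℂ ⊗[ℚ] F)).mulVec v j = jsign n _ j * v (Fin.rev j) := fun j => by
    simp only [Matrix.mulVec, dotProduct, Jmat_apply, ite_mul, zero_mul, Finset.sum_ite_eq',
      Finset.mem_univ, if_true]
  rw [Vneg, LinearMap.mem_ker, funext_iff]
  refine forall_congr' fun j => ?_
  rw [← h]
  rw [LinearMap.add_apply, Pi.add_apply, Matrix.mulVecLin_apply, LinearMap.smul_apply,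
    LinearMap.id_apply, Pi.smul_apply, smul_eq_mul, Pi.zero_apply, Matrix.neg_mulVec, Pi.neg_apply, neg_add_eq_zero]

theorem I_tmul_mul_self : (Complex.I ⊗ₜ[ℚ] (1 : F)) * (Complex.I ⊗ₜ[ℚ] (1 : F)) = -1 := by
  rw [Algebra.TensorProduct.tmul_mul_tmul, Complex.I_mul_I, mul_one, TensorProduct.neg_tmul]
  rfl

/-- The first `n` coordinates identify `V_{-i}` with `(ℂ ⊗ F)^n`. -/
def vnegEquiv (n : ℕ) : Vneg F n ≃ₗ[ℂ ⊗[ℚ] F] (Fin n → ℂ ⊗[ℚ] F) where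
  toFun v k := (v : Fin (2 * n) → ℂ ⊗[ℚ] F) (Fin.castLE (by omega) k)
  map_add' _ _ := rfl
  map_smul' _ _ := rfl
  invFun w := ⟨fun j => if h : (j : ℕ) < n then w ⟨j, h⟩ else
    (Complex.I ⊗ₜ[ℚ] (1 : F)) * w ⟨Fin.rev j, by rw [Fin.val_rev]; omega⟩, by
      rw [mem_Vneg]
      intro j
      have hj := Fin.val_rev j
      by_cases h : (j : ℕ) < n
      · have h' : ¬ (Fin.rev j : ℕ) < n := by omega
        rw [dif_neg h', dif_pos h, jsign, if_pos h, one_mul]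
        simp only [Fin.rev_rev]
      · have h' : (Fin.rev j : ℕ) < n := by omega
        rw [dif_pos h', dif_neg h, jsign, if_neg h, ← mul_assoc, I_tmul_mul_self]⟩
  left_inv v := by
    apply Subtype.ext
    funext j
    by_cases h : (j : ℕ) < n
    · simp only [h, dif_pos]
      rfl
    · have hj := Fin.val_rev j
      have h' : (Fin.rev j : ℕ) < n := by omega
      simp only [h, dif_neg, not_false_eq_true]
      have := (mem_Vneg _).1 v.2 (Fin.rev j)
      rw [jsign, if_pos h', one_mul, Fin.rev_rev] at this
      exact this.symm
  right_inv w := by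
    funext k
    simp only [Fin.val_castLE, k.2, dif_pos]

instance (n : ℕ) : Module.Finite ℂ (Vneg F n) :=
  Module.Finite.equiv ((vnegEquiv (F := F) n).symm.restrictScalars ℂ)

/-- `vnegEquiv` makes `V_{-i}` free of rank `n` over `ℂ ⊗ F`. -/
theorem detPoly_Vneg (n : ℕ) :
    detPoly F ℂ (Vneg F n) (fun a => Algebra.lsmul ℂ ℂ (Vneg F n) ((1 : ℂ) ⊗ₜ[ℚ] (a : F))) =
      MvPolynomial.map (Int.castRingHom ℂ) (normPoly F ^ n) := by
  refine MvPolynomial.funext fun c => ?_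
  rw [eval_detPoly, map_pow, map_pow, eval_map_normPoly
    ((Algebra.TensorProduct.includeRight : F →ₐ[ℚ] ℂ ⊗[ℚ] F).toRingHom.comp (algebraMap (𝓞 F) F))
    (Algebra.TensorProduct.basis ℂ (NumberField.integralBasis F)), ← det_lsmul_pi,
    ← det_lsmul_congr (vnegEquiv n)]
  · congr 1
    rw [map_sum]
    refine Finset.sum_congr rfl fun k _ => ?_
    rw [map_smul, Algebra.TensorProduct.basis_apply, NumberField.integralBasis_apply]
  · intro k
    rw [Algebra.TensorProduct.basis_apply, NumberField.integralBasis_apply]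
    rfl

variable {p : ℕ} [Fact p.Prime] {𝔽 : Type*} [Field 𝔽] [Algebra ℤ_[p] 𝔽]

/-- Injectivity of `ℤ → ℂ` on coefficients forces `d` to be the `n`-th power of the norm form, and
over an infinite field an identity of polynomials is an identity of values. -/
theorem determinant_iff_norm [Infinite 𝔽] {M : Type*} [AddCommGroup M] [Module 𝔽 M]
    [Module (OF p F 𝔽) M] [IsScalarTower 𝔽 (OF p F 𝔽) M] [Module.Finite 𝔽 M] (n : ℕ) :
    (∃ d : MvPolynomial (Module.Free.ChooseBasisIndex ℤ (𝓞 F)) ℤ,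
      MvPolynomial.map (Int.castRingHom ℂ) d =
        detPoly F ℂ (Vneg F n) (fun a => Algebra.lsmul ℂ ℂ (Vneg F n) ((1 : ℂ) ⊗ₜ[ℚ] (a : F))) ∧
      MvPolynomial.map (Int.castRingHom 𝔽) d =
        detPoly F 𝔽 M (fun a => Algebra.lsmul 𝔽 𝔽 M ((1 : 𝔽) ⊗ₜ[ℤ_[p]] inclO p F a))) ↔
      ∀ α : OF p F 𝔽, LinearMap.det (Algebra.lsmul 𝔽 𝔽 M α) = Algebra.norm 𝔽 α ^ n := by
  have h1 : (∃ d : MvPolynomial (Module.Free.ChooseBasisIndex ℤ (𝓞 F)) ℤ,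
      MvPolynomial.map (Int.castRingHom ℂ) d =
        detPoly F ℂ (Vneg F n) (fun a => Algebra.lsmul ℂ ℂ (Vneg F n) ((1 : ℂ) ⊗ₜ[ℚ] (a : F))) ∧
      MvPolynomial.map (Int.castRingHom 𝔽) d =
        detPoly F 𝔽 M (fun a => Algebra.lsmul 𝔽 𝔽 M ((1 : 𝔽) ⊗ₜ[ℤ_[p]] inclO p F a))) ↔
      MvPolynomial.map (Int.castRingHom 𝔽) (normPoly F ^ n) =
        detPoly F 𝔽 M (fun a => Algebra.lsmul 𝔽 𝔽 M ((1 : 𝔽) ⊗ₜ[ℤ_[p]] inclO p F a)) := by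
    rw [detPoly_Vneg]
    constructor
    · rintro ⟨d, h1, h2⟩
      rwa [← MvPolynomial.map_injective _ (RingHom.injective_int (Int.castRingHom ℂ)) h1]
    · exact fun h => ⟨_, rfl, h⟩
  have h2 : ∀ c : Module.Free.ChooseBasisIndex ℤ (𝓞 F) → 𝔽,
      MvPolynomial.eval c (MvPolynomial.map (Int.castRingHom 𝔽) (normPoly F ^ n)) =
        Algebra.norm 𝔽 (∑ k, c k • ofBasis p F 𝔽 k) ^ n := fun c => by
    rw [map_pow, map_pow, eval_map_normPoly (inclOF 𝔽) (ofBasis p F 𝔽) (ofBasis_apply 𝔽)]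
  have h3 : ∀ c : Module.Free.ChooseBasisIndex ℤ (𝓞 F) → 𝔽,
      MvPolynomial.eval c (detPoly F 𝔽 M (fun a => Algebra.lsmul 𝔽 𝔽 M
        ((1 : 𝔽) ⊗ₜ[ℤ_[p]] inclO p F a))) =
        LinearMap.det (Algebra.lsmul 𝔽 𝔽 M (∑ k, c k • ofBasis p F 𝔽 k)) := fun c => by
    rw [eval_detPoly]
    congr 1
    rw [map_sum]
    refine Finset.sum_congr rfl fun k _ => ?_
    rw [map_smul, ofBasis_apply]
  rw [h1]
  constructor
  · intro h α
    have := congrArg (MvPolynomial.eval fun k => (ofBasis p F 𝔽).repr α k) h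
    rw [h2, h3, (ofBasis p F 𝔽).sum_repr] at this
    exact this.symm
  · intro h
    refine MvPolynomial.funext fun c => ?_
    rw [h2, h3, h]

end DetPoly

end SymplecticLocalModel

namespace SymplecticLocalModel


/-! ### From families modulo `u^e` to self-dual lattice chains. -/

section Coordinates

variable {n : ℕ} {𝔽 : Type*} [Field 𝔽] {e : ℕ}

theorem symp_map {R S : Type*} [CommRing R] [CommRing S] (f : R →+* S) (x y : Fin (2 * n) → R) :
    symp n S (fun j => f (x j)) (fun j => f (y j)) = f (symp n R x y) := by
  simp only [symp_eq_sum, map_sum, map_mul]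
  refine Finset.sum_congr rfl fun j _ => ?_
  congr 2
  unfold jsign
  split_ifs <;> simp

variable (n 𝔽) in
/-- The coordinates of the lattice `Λ̃_i` in its basis `(u^{ω_i(j)} e_j)_j`. -/
def coordMap (i : ℤ) : (Fin (2 * n) → 𝔽⟦X⟧) →ₗ[𝔽⟦X⟧] (Fin (2 * n) → 𝔽⸨X⸩) where
  toFun c j := c j • upow (omega n i j)
  map_add' _ _ := funext fun _ => add_smul _ _ _
  map_smul' _ _ := funext fun _ => mul_smul _ _ _

theorem coordMap_apply (i : ℤ) (c : Fin (2 * n) → 𝔽⟦X⟧) (j : Fin (2 * n)) :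
    coordMap n 𝔽 i c j = c j • upow (omega n i j) := rfl

theorem smul_upow_mem_fracIdeal_iff {c : 𝔽⟦X⟧} {a m : ℤ} (h : a ≤ m) :
    c • (upow a : 𝔽⸨X⸩) ∈ fracIdeal 𝔽 m ↔ PowerSeries.X ^ (m - a).toNat ∣ c := by
  have h1 : ((m - a).toNat : ℤ) = m - a := Int.toNat_of_nonneg (by omega)
  have hinj := FaithfulSMul.algebraMap_injective 𝔽⟦X⟧ 𝔽⸨X⸩
  rw [mem_fracIdeal]
  constructor
  · rintro ⟨d, hd⟩
    refine ⟨d, hinj ?_⟩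
    have h2 : (upow m : 𝔽⸨X⸩) = upow (m - a) * upow a := by rw [← upow_add, sub_add_cancel]
    rw [Algebra.smul_def, Algebra.smul_def, h2, ← mul_assoc] at hd
    rw [mul_right_cancel₀ (upow_ne_zero a) hd, map_mul, ← upow_natCast, h1, mul_comm]
  · rintro ⟨d, rfl⟩
    refine ⟨d, ?_⟩
    rw [Algebra.smul_def, Algebra.smul_def, map_mul, ← upow_natCast, h1, mul_comm (upow _),
      mul_assoc, ← upow_add, sub_add_cancel]

theorem coordMap_injective (i : ℤ) : Function.Injective (coordMap n 𝔽 i) := by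
  intro c d h
  funext j
  have h1 := congrFun h j
  rw [coordMap_apply, coordMap_apply, Algebra.smul_def, Algebra.smul_def] at h1
  exact FaithfulSMul.algebraMap_injective 𝔽⟦X⟧ 𝔽⸨X⸩ (mul_right_cancel₀ (upow_ne_zero _) h1)

theorem mem_stdChain_iff_exists {i : ℤ} {x : Fin (2 * n) → 𝔽⸨X⸩} :
    x ∈ stdChain n 𝔽 i ↔ ∃ c, coordMap n 𝔽 i c = x := by
  rw [mem_stdChain]
  constructor
  · intro h
    choose c hc using fun j => mem_fracIdeal.1 (h j)
    exact ⟨c, funext fun j => (hc j).symm⟩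
  · rintro ⟨c, rfl⟩ j
    exact mem_fracIdeal.2 ⟨c j, rfl⟩

theorem coordMap_mem_stdChain (i : ℤ) (c : Fin (2 * n) → 𝔽⟦X⟧) :
    coordMap n 𝔽 i c ∈ stdChain n 𝔽 i := mem_stdChain_iff_exists.2 ⟨c, rfl⟩

/-- The inclusion `Λ̃_i ⊆ Λ̃_{i+1}` in coordinates, for a ring `R` and `x ∈ R` in the place of
`𝔽⟦u⟧` and `u`. -/
def stepMap {R : Type*} [CommRing R] (x : R) (i : ℤ) (z : Fin (2 * n) → R) : Fin (2 * n) → R :=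
  fun j => x ^ (omega n i j - omega n (i + 1) j).toNat * z j

theorem coordMap_stepMap (i : ℤ) (c : Fin (2 * n) → 𝔽⟦X⟧) :
    coordMap n 𝔽 (i + 1) (stepMap PowerSeries.X i c) = coordMap n 𝔽 i c := by
  funext j
  rw [coordMap_apply, coordMap_apply, stepMap, mul_comm, mul_smul]
  congr 1
  rw [Algebra.smul_def, ← upow_natCast, ← upow_add, Int.toNat_of_nonneg (sub_nonneg.2 (omega_anti i j)),
    sub_add_cancel]

theorem upow_smul_coordMap (i : ℤ) (c : Fin (2 * n) → 𝔽⟦X⟧) :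
    (upow 1 : 𝔽⸨X⸩) • coordMap n 𝔽 ((2 * n : ℕ) + i) c = coordMap n 𝔽 i c := by
  funext j
  rw [Pi.smul_apply, coordMap_apply, coordMap_apply, omega_add, smul_comm, smul_eq_mul, ← upow_add,
    add_sub_cancel]

theorem symp_coordMap (i : ℤ) (c d : Fin (2 * n) → 𝔽⟦X⟧) :
    symp n 𝔽⸨X⸩ (coordMap n 𝔽 i c) (coordMap n 𝔽 (-i) d) =
      algebraMap 𝔽⟦X⟧ 𝔽⸨X⸩ (symp n 𝔽⟦X⟧ c d) := by
  rw [← symp_map, symp_eq_sum, symp_eq_sum]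
  refine Finset.sum_congr rfl fun j _ => ?_
  have h : (upow (omega n i j) : 𝔽⸨X⸩) * upow (omega n (-i) (Fin.rev j)) = 1 := by
    rw [← upow_add, omega_neg i j (Fin.rev j) (by rw [Fin.val_rev]; omega), upow_zero]
  rw [coordMap_apply, coordMap_apply, Algebra.smul_def, Algebra.smul_def]
  linear_combination (jsign n 𝔽⸨X⸩ j * algebraMap 𝔽⟦X⟧ 𝔽⸨X⸩ (c j) *
    algebraMap 𝔽⟦X⟧ 𝔽⸨X⸩ (d (Fin.rev j))) * h

variable (n 𝔽 e) in
/-- Reduction of coordinates modulo `u^e`. -/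
def redMap : (Fin (2 * n) → 𝔽⟦X⟧) →ₗ[𝔽⟦X⟧] (Fin (2 * n) → TruncRing 𝔽 e) where
  toFun c j := truncMk 𝔽 e (c j)
  map_add' _ _ := rfl
  map_smul' _ _ := rfl

theorem redMap_apply (c : Fin (2 * n) → 𝔽⟦X⟧) :
    redMap n 𝔽 e c = fun j => truncMk 𝔽 e (c j) := rfl

theorem redMap_surjective : Function.Surjective (redMap n 𝔽 e) := by
  intro z
  choose c hc using fun j => truncMk_surjective (z j)
  exact ⟨c, funext hc⟩

theorem redMap_stepMap (i : ℤ) (c : Fin (2 * n) → 𝔽⟦X⟧) :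
    redMap n 𝔽 e (stepMap PowerSeries.X i c) =
      stepMap (truncMk 𝔽 e PowerSeries.X) i (redMap n 𝔽 e c) := by
  funext j
  simp only [redMap_apply, stepMap, map_mul, map_pow]

/-- Families of submodules of `(𝔽[u]/u^e)^{2n}` with the properties of the components of a point of
the local model. -/
structure IsCompFamily (C : ℤ → Submodule (TruncRing 𝔽 e) (Fin (2 * n) → TruncRing 𝔽 e)) :
    Prop where
  step : ∀ i, ∀ z ∈ C i, stepMap (truncMk 𝔽 e PowerSeries.X) i z ∈ C (i + 1)
  periodic : ∀ i, C ((2 * n : ℕ) + i) = C i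
  pairing : ∀ i, ∀ z ∈ C i, ∀ w ∈ C (-i), symp n (TruncRing 𝔽 e) z w = 0
  finrank : ∀ i, Module.finrank 𝔽 ((Fin (2 * n) → TruncRing 𝔽 e) ⧸ C i) = n * e

/-- The chain of the preimages in `Λ̃_i` of submodules of `Λ̃_i / u^e Λ̃_i`. -/
def famChain (C : ℤ → Submodule (TruncRing 𝔽 e) (Fin (2 * n) → TruncRing 𝔽 e)) : Chain n 𝔽 :=
  fun i => (((C i).restrictScalars 𝔽⟦X⟧).comap (redMap n 𝔽 e)).map (coordMap n 𝔽 i)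

variable {C : ℤ → Submodule (TruncRing 𝔽 e) (Fin (2 * n) → TruncRing 𝔽 e)}

theorem mem_famChain {i : ℤ} {x : Fin (2 * n) → 𝔽⸨X⸩} :
    x ∈ famChain C i ↔ ∃ c, redMap n 𝔽 e c ∈ C i ∧ coordMap n 𝔽 i c = x := Iff.rfl

theorem coordMap_mem_famChain {i : ℤ} {c : Fin (2 * n) → 𝔽⟦X⟧} :
    coordMap n 𝔽 i c ∈ famChain C i ↔ redMap n 𝔽 e c ∈ C i := by
  rw [mem_famChain]
  constructor
  · rintro ⟨d, hd, h⟩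
    rwa [← coordMap_injective i h]
  · exact fun h => ⟨c, h, rfl⟩

theorem famChain_le (i : ℤ) : famChain C i ≤ stdChain n 𝔽 i := by
  rintro _ ⟨c, -, rfl⟩
  exact coordMap_mem_stdChain i c

theorem famChain_injective {C' : ℤ → Submodule (TruncRing 𝔽 e) (Fin (2 * n) → TruncRing 𝔽 e)}
    (h : famChain C = famChain C') : C = C' := by
  funext i
  ext z
  obtain ⟨c, rfl⟩ := redMap_surjective z
  rw [← coordMap_mem_famChain, ← coordMap_mem_famChain, h]

/-- The last coefficient of an element of `𝔽[u]/u^e`. -/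
theorem exists_nondegenerate_functional (he : e ≠ 0) :
    ∃ l : TruncRing 𝔽 e →ₗ[𝔽] 𝔽, ∀ a, (∀ b, l (a * b) = 0) → a = 0 := by
  refine ⟨(LinearMap.proj (⟨e - 1, by omega⟩ : Fin e)).comp (truncCoeff 𝔽 e).toLinearMap,
    fun a h => ?_⟩
  obtain ⟨f, rfl⟩ := truncMk_surjective a
  rw [truncMk_eq_zero_iff, PowerSeries.X_pow_dvd_iff]
  intro m hm
  -- The coefficient of `u^m` in `f` is the last coefficient of `f u^{e-1-m}`.
  have h1 := h (truncMk 𝔽 e (PowerSeries.X ^ (e - 1 - m)))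
  rw [← map_mul] at h1
  change PowerSeries.coeff (e - 1) (f * PowerSeries.X ^ (e - 1 - m)) = 0 at h1
  rwa [PowerSeries.coeff_mul_X_pow', if_pos (by omega), show e - 1 - (e - 1 - m) = m by omega] at h1

/-- Composing the symplectic form with a nondegenerate functional gives a nondegenerate `𝔽`-form on
a space of dimension `2ne`. The orthogonal of `C_i` then has dimension `ne`, as does `C_{-i}`, which
it contains. -/
theorem IsCompFamily.mem_of_orthogonal (hC : IsCompFamily C) (he : e ≠ 0) {i : ℤ}
    {w : Fin (2 * n) → TruncRing 𝔽 e} (hw : ∀ z ∈ C i, symp n (TruncRing 𝔽 e) z w = 0) :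
    w ∈ C (-i) := by
  obtain ⟨l, hl⟩ := exists_nondegenerate_functional (𝔽 := 𝔽) he
  let β : LinearMap.BilinForm 𝔽 (Fin (2 * n) → TruncRing 𝔽 e) :=
    LinearMap.mk₂ 𝔽 (fun z w => l (symp n (TruncRing 𝔽 e) z w))
      (fun _ _ _ => by rw [map_add, LinearMap.add_apply, map_add])
      (fun c z w => by
        rw [← algebraMap_smul (TruncRing 𝔽 e) c z, map_smul, LinearMap.smul_apply,
          algebraMap_smul, map_smul])
      (fun _ _ _ => by rw [map_add, map_add])
      (fun c z w => by
        rw [← algebraMap_smul (TruncRing 𝔽 e) c w, map_smul, algebraMap_smul, map_smul])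
  have hβ : ∀ z w, β z w = l (symp n (TruncRing 𝔽 e) z w) := fun _ _ => rfl
  have halt : β.IsAlt := fun z => by rw [hβ, symp_self, map_zero]
  have hnd : β.Nondegenerate := by
    refine halt.isRefl.nondegenerate_iff_separatingLeft.2 fun z hz => funext fun j => hl _ fun b => ?_
    have h1 := hz (Pi.single (Fin.rev j) (jsign n _ j * b))
    rw [hβ, symp_neg_swap, symp_single_left, Fin.rev_rev, jsign_rev] at h1
    rw [← h1]
    congr 1
    linear_combination (-b * z j) * jsign_mul_self (R := TruncRing 𝔽 e) j
  have hdim : ∀ i, Module.finrank 𝔽 ((C i).restrictScalars 𝔽) + n * e = 2 * n * e := fun i => by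
    have h1 := Submodule.finrank_quotient_add_finrank ((C i).restrictScalars 𝔽)
    have h2 := hC.finrank i
    change Module.finrank 𝔽 ((Fin (2 * n) → TruncRing 𝔽 e) ⧸ (C i).restrictScalars 𝔽) = n * e at h2
    rw [h2, Module.finrank_pi_fintype] at h1
    simp only [finrank_truncRing, Finset.sum_const, Finset.card_univ, Fintype.card_fin,
      smul_eq_mul] at h1
    omega
  have hle : (C (-i)).restrictScalars 𝔽 ≤ β.orthogonal ((C i).restrictScalars 𝔽) := by
    intro y hy z hz
    change β z y = 0
    rw [hβ, hC.pairing i z hz y hy, map_zero]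
  have heq := Submodule.eq_of_le_of_finrank_eq hle (by
    rw [LinearMap.BilinForm.finrank_orthogonal hnd, Module.finrank_pi_fintype]
    simp only [finrank_truncRing, Finset.sum_const, Finset.card_univ, Fintype.card_fin, smul_eq_mul]
    have h1 := hdim i
    have h2 := hdim (-i)
    have h3 : 2 * n * e = n * e + n * e := by ring
    omega)
  have : w ∈ β.orthogonal ((C i).restrictScalars 𝔽) := by
    intro z hz
    change β z w = 0
    rw [hβ, hw z hz, map_zero]
  rw [← heq] at this
  exact this

/-- Modulo `u^e`, `C_i` and `C_{-i}` are each other's orthogonals, so the dual of `L_i` is `u^{-e}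
L_{-i}`, which is `L_{2ne-i}` by periodicity. -/
theorem IsCompFamily.isDualChain (hC : IsCompFamily C) (he : e ≠ 0) :
    IsDualChain ((2 * n : ℕ) * (e : ℤ)) (famChain C) := by
  have hS := isDualChain_stdChain (𝔽 := 𝔽) (n := n)
  have hmono : ∀ i, ∀ x ∈ famChain C i, x ∈ famChain C (i + 1) := by
    rintro i _ ⟨c, hc, rfl⟩
    rw [← coordMap_stepMap, coordMap_mem_famChain, redMap_stepMap]
    exact hC.step i _ hc
  have hper : ∀ i x, x ∈ famChain C (i + (2 * n : ℕ)) ↔ (upow 1 : 𝔽⸨X⸩) • x ∈ famChain C i := by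
    intro i x
    rw [add_comm i]
    constructor
    · rintro ⟨c, hc, rfl⟩
      rw [upow_smul_coordMap, coordMap_mem_famChain, ← hC.periodic]
      exact hc
    · rintro ⟨c, hc, h⟩
      rw [← upow_smul_coordMap] at h
      rw [← smul_right_injective _ (upow_ne_zero 1) h, coordMap_mem_famChain, hC.periodic]
      exact hc
  have hper' : ∀ (m : ℕ) i x, x ∈ famChain C (i + (2 * n : ℕ) * m) ↔
      (upow (m : ℤ) : 𝔽⸨X⸩) • x ∈ famChain C i := by
    intro m
    induction m with
    | zero => intro i x; simp [upow_zero]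
    | succ m ih =>
      intro i x
      rw [show i + (2 * n : ℕ) * ((m + 1 : ℕ) : ℤ) = i + (2 * n : ℕ) * m + (2 * n : ℕ) by
        push_cast; ring, hper, ih, smul_smul, ← upow_add]
      push_cast
      rfl
  have hper'' : ∀ i x, x ∈ famChain C ((2 * n : ℕ) * (e : ℤ) - i) ↔
      (upow (e : ℤ) : 𝔽⸨X⸩) • x ∈ famChain C (-i) := fun i x => by
    rw [← hper', neg_add_eq_sub]
  have hXe : ∀ c : Fin (2 * n) → 𝔽⟦X⟧, redMap n 𝔽 e ((PowerSeries.X ^ e : 𝔽⟦X⟧) • c) = 0 := fun c => by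
    funext j
    change truncMk 𝔽 e (PowerSeries.X ^ e * c j) = 0
    rw [map_mul, map_pow, truncMk_X_pow, zero_mul]
  refine ⟨hmono, hper, ?_, ?_⟩
  · rintro i _ ⟨a, ha, rfl⟩ y hy
    rw [hper''] at hy
    obtain ⟨b, hb, hby⟩ := hy
    have h1 := hC.pairing i _ ha _ hb
    rw [redMap_apply, redMap_apply, symp_map, truncMk_eq_zero_iff] at h1
    obtain ⟨r, hr⟩ := h1
    have h2 := symp_coordMap i a b
    rw [hby, map_smul, hr, map_mul, ← upow_natCast, smul_eq_mul] at h2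
    exact mem_fracIdeal_zero.2 ⟨r, (mul_left_cancel₀ (upow_ne_zero _) h2).symm⟩
  · intro i y hy
    rw [hper'']
    -- Because `u^e Λ̃_i ⊆ L_i`, the vector `u^e y` pairs integrally with `Λ̃_i`; so it has
    -- coordinates to reduce.
    have h1 : (upow (e : ℤ) : 𝔽⸨X⸩) • y ∈ stdChain n 𝔽 (-i) := by
      have h := hS.dual i ((upow (e : ℤ) : 𝔽⸨X⸩) • y) fun x hx => ?_
      · rwa [zero_sub] at h
      · obtain ⟨c, rfl⟩ := mem_stdChain_iff_exists.1 hx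
        have h2 := hy (coordMap n 𝔽 i ((PowerSeries.X ^ e : 𝔽⟦X⟧) • c))
          (coordMap_mem_famChain.2 (by rw [hXe]; exact zero_mem _))
        rw [map_smul, ← algebraMap_smul 𝔽⸨X⸩ (PowerSeries.X ^ e : 𝔽⟦X⟧), ← upow_natCast, map_smul,
          LinearMap.smul_apply] at h2
        rwa [map_smul]
    obtain ⟨b, hb⟩ := mem_stdChain_iff_exists.1 h1
    rw [← hb, coordMap_mem_famChain]
    refine hC.mem_of_orthogonal he fun z hz => ?_
    obtain ⟨a, rfl⟩ := redMap_surjective z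
    obtain ⟨r, hr⟩ := mem_fracIdeal_zero.1 (hy _ (coordMap_mem_famChain.2 hz))
    have h2 := symp_coordMap i a b
    rw [hb, map_smul, smul_eq_mul, ← hr, upow_natCast, ← map_mul] at h2
    rw [redMap_apply, redMap_apply, symp_map, truncMk_eq_zero_iff,
      ← FaithfulSMul.algebraMap_injective 𝔽⟦X⟧ 𝔽⸨X⸩ h2]
    exact dvd_mul_right _ _

end Coordinates

end SymplecticLocalModel

namespace SymplecticLocalModel


/-! ### Relative dimensions and permissibility of the alcove. -/

section RelativeDimension

theorem finrank_quotient_eq {K A V W : Type*} [Field K] [Ring A] [SMul K A] [AddCommGroup V]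
    [Module K V] [Module A V] [IsScalarTower K A V] [AddCommGroup W] [Module K W]
    (f : V →ₗ[K] W) (hf : Function.Surjective f) (S : Submodule A V) (h : ∀ x, f x = 0 ↔ x ∈ S) :
    Module.finrank K (V ⧸ S) = Module.finrank K W := by
  have hS : S.restrictScalars K = LinearMap.ker f := by
    ext x
    rw [LinearMap.mem_ker, h]
    rfl
  change Module.finrank K (V ⧸ S.restrictScalars K) = _
  rw [hS]
  exact (f.quotKerEquivOfSurjective hf).finrank_eq

theorem finrank_quotient_eq_of_equiv {K A V : Type*} [Field K] [Ring A] [SMul K A]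
    [AddCommGroup V] [Module K V] [Module A V] [IsScalarTower K A V] (θ : V ≃ₗ[A] V)
    {S S' : Submodule A V} (h : ∀ x, x ∈ S ↔ θ x ∈ S') :
    Module.finrank K (V ⧸ S) = Module.finrank K (V ⧸ S') := by
  refine finrank_quotient_eq ((S'.mkQ.comp θ.toLinearMap).restrictScalars K)
    (S'.mkQ_surjective.comp θ.surjective) S fun x => ?_
  rw [h]
  exact Submodule.Quotient.mk_eq_zero S'

variable {n : ℕ} {𝔽 : Type*} [Field 𝔽] {e : ℕ}

theorem finrank_quotient_comap_redMap
    (C : Submodule (TruncRing 𝔽 e) (Fin (2 * n) → TruncRing 𝔽 e)) :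
    Module.finrank 𝔽 ((Fin (2 * n) → 𝔽⟦X⟧) ⧸ (C.restrictScalars 𝔽⟦X⟧).comap (redMap n 𝔽 e)) =
      Module.finrank 𝔽 ((Fin (2 * n) → TruncRing 𝔽 e) ⧸ C) := by
  refine finrank_quotient_eq ((C.mkQ.restrictScalars 𝔽).comp ((redMap n 𝔽 e).restrictScalars 𝔽))
    (C.mkQ_surjective.comp redMap_surjective) _ fun x => ?_
  exact Submodule.Quotient.mk_eq_zero C

theorem comap_coordMap_famChain
    (C : ℤ → Submodule (TruncRing 𝔽 e) (Fin (2 * n) → TruncRing 𝔽 e)) (i : ℤ) :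
    (famChain C i).comap (coordMap n 𝔽 i) =
      ((C i).restrictScalars 𝔽⟦X⟧).comap (redMap n 𝔽 e) :=
  Submodule.comap_map_eq_of_injective (coordMap_injective i) _

theorem finrank_quotient_comap_diagLattice {i : ℤ} {x : Fin (2 * n) → ℤ} (h : omega n i ≤ x) :
    Module.finrank 𝔽 ((Fin (2 * n) → 𝔽⟦X⟧) ⧸ (diagLattice x).comap (coordMap n 𝔽 i)) =
      ∑ j, (x j - omega n i j).toNat := by
  let f : (Fin (2 * n) → 𝔽⟦X⟧) →ₗ[𝔽] (∀ j, TruncRing 𝔽 (x j - omega n i j).toNat) :=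
    { toFun := fun c j => truncMk 𝔽 _ (c j)
      map_add' := fun _ _ => rfl
      map_smul' := fun _ _ => rfl }
  rw [finrank_quotient_eq f]
  · rw [Module.finrank_pi_fintype]
    simp only [finrank_truncRing]
  · intro z
    choose c hc using fun j => truncMk_surjective (z j)
    exact ⟨c, funext hc⟩
  · intro c
    rw [Submodule.mem_comap, mem_diagLattice, funext_iff]
    refine forall_congr' fun j => ?_
    rw [coordMap_apply, smul_upow_mem_fracIdeal_iff (h j)]
    exact truncMk_eq_zero_iff

theorem exists_latticeAut {g : GSp n 𝔽⸨X⸩} (hg : g ∈ Iwahori n 𝔽) (i : ℤ) :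
    ∃ θ : (Fin (2 * n) → 𝔽⟦X⟧) ≃ₗ[𝔽⟦X⟧] (Fin (2 * n) → 𝔽⟦X⟧), ∀ c,
      coordMap n 𝔽 i (θ c) = (g : GL (Fin (2 * n)) 𝔽⸨X⸩).val.mulVec (coordMap n 𝔽 i c) := by
  have h1 : ∀ g ∈ Iwahori n 𝔽, ∀ c, ∃ d,
      coordMap n 𝔽 i d = (g : GL (Fin (2 * n)) 𝔽⸨X⸩).val.mulVec (coordMap n 𝔽 i c) := by
    intro g hg c
    rw [← mem_stdChain_iff_exists]
    have := mulVec_mem_smul_chain_iff (g := g).2 (coordMap_mem_stdChain (𝔽 := 𝔽) i c)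
    rwa [mem_Iwahori_iff.1 hg] at this
  choose f hf using h1 g hg
  choose f' hf' using h1 g⁻¹ (inv_mem hg)
  refine ⟨{ toFun := f, invFun := f', map_add' := fun c d => ?_, map_smul' := fun a c => ?_,
            left_inv := fun c => ?_, right_inv := fun c => ?_ }, hf⟩ <;>
    apply coordMap_injective i
  · rw [map_add, hf, hf, hf, map_add, Matrix.mulVec_add]
  · rw [map_smul, hf, hf, map_smul, RingHom.id_apply, Matrix.mulVec_smul]
  · rw [hf', hf, GSp.inv_mulVec_mulVec]
  · rw [hf, hf', GSp.mulVec_inv_mulVec]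

theorem finrank_quotient_comap_smul {g : GSp n 𝔽⸨X⸩} (hg : g ∈ Iwahori n 𝔽) (M : Chain n 𝔽)
    (i : ℤ) :
    Module.finrank 𝔽 ((Fin (2 * n) → 𝔽⟦X⟧) ⧸ ((g • M) i).comap (coordMap n 𝔽 i)) =
      Module.finrank 𝔽 ((Fin (2 * n) → 𝔽⟦X⟧) ⧸ (M i).comap (coordMap n 𝔽 i)) := by
  obtain ⟨θ, hθ⟩ := exists_latticeAut hg i
  refine (finrank_quotient_eq_of_equiv θ fun x => ?_).symm
  rw [Submodule.mem_comap, Submodule.mem_comap, hθ, mulVec_mem_smul_chain_iff]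

theorem smul_chain_le_iff {g : GSp n 𝔽⸨X⸩} {M M' : Chain n 𝔽} {i k : ℤ} :
    (g • M) i ≤ (g • M') k ↔ M i ≤ M' k :=
  ⟨fun h _ hx => mulVec_mem_smul_chain_iff.1 (h (mulVec_mem_smul_chain_iff.2 hx)), smul_chain_mono⟩

theorem sum_omega (hn : 0 < n) (i : ℤ) : ∑ j, omega n i j = -i := by
  have hstep : ∀ i, ∑ j, omega n i j = ∑ j, omega n (i + 1) j + 1 := by
    intro i
    have hN : (0 : ℤ) < (2 * n : ℕ) := by omega
    have h1 := Int.emod_nonneg i hN.ne'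
    have h2 := Int.emod_lt_of_pos i hN
    rw [← sub_eq_iff_eq_add', ← Finset.sum_sub_distrib]
    simp only [omega_sub_omega_succ]
    rw [Finset.sum_eq_single (⟨(i % (2 * n : ℕ)).toNat, by omega⟩ : Fin (2 * n))]
    · rw [if_pos (Int.toNat_of_nonneg h1)]
    · intro j _ hj
      rw [if_neg]
      intro h
      exact hj (Fin.ext (by change (j : ℕ) = (i % (2 * n : ℕ)).toNat; omega))
    · exact fun h => absurd (Finset.mem_univ _) h
  induction i using Int.induction_on with
  | zero => simp [omega]
  | succ k ih => have := hstep k; omega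
  | pred k ih =>
    have := hstep (-k - 1)
    rw [sub_add_cancel] at this
    omega

theorem eq_single_of_sum_eq_one {ι : Type*} [Fintype ι] [DecidableEq ι] {d : ι → ℤ}
    (h0 : ∀ j, 0 ≤ d j) (h1 : ∑ j, d j = 1) : ∃ k, d = Pi.single k 1 := by
  obtain ⟨k, hk⟩ : ∃ k, d k ≠ 0 := by
    by_contra! h
    simp [h] at h1
  refine ⟨k, ?_⟩
  have h2 := Finset.add_sum_erase Finset.univ d (Finset.mem_univ k)
  have h3 : 0 ≤ ∑ j ∈ Finset.univ.erase k, d j := Finset.sum_nonneg fun j _ => h0 j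
  have hk1 := h0 k
  have hkk : d k = 1 := by omega
  have h4 : ∑ j ∈ Finset.univ.erase k, d j = 0 := by omega
  rw [Finset.sum_eq_zero_iff_of_nonneg fun j _ => h0 j] at h4
  funext j
  rcases eq_or_ne j k with rfl | hj
  · rw [Pi.single_eq_same, hkk]
  · rw [Pi.single_eq_of_ne hj, h4 j (Finset.mem_erase.2 ⟨hj, Finset.mem_univ j⟩)]

/-- The thresholds of a common basis define `x`. The codimension `ne` fixes the sums, so `x_i -
x_{i+1}` is nonnegative with sum `1`, hence a basis vector. The lower bound is `L_i ⊆ Λ̃_i`, and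
duality turns it into the upper bound. -/
theorem IsCompFamily.exists_alcove
    {C : ℤ → Submodule (TruncRing 𝔽 e) (Fin (2 * n) → TruncRing 𝔽 e)} (hC : IsCompFamily C)
    (he : e ≠ 0) (hn : 0 < n) :
    ∃ g ∈ Iwahori n 𝔽, ∃ x, IsExtendedAlcove x ∧ IsPermissible e x ∧
      famChain C = g • diagChain 𝔽 x := by
  have hN : (0 : ℤ) < (2 * n : ℕ) := by omega
  obtain ⟨g, hg, τ, hτ, hL⟩ := (hC.isDualChain he).exists_common_basis famChain_le
  set x : ℤ → Fin (2 * n) → ℤ := fun i j => cexp (2 * n : ℕ) (τ j) i with hx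
  have hlow : ∀ i, omega n i ≤ x i := fun i => by
    rw [← diagLattice_le_iff (𝔽 := 𝔽)]
    have h := famChain_le (C := C) i
    rw [hL, ← mem_Iwahori_iff.1 hg, smul_chain_le_iff] at h
    exact h
  have hdual : ∀ i j, x i j + x (-i) (Fin.rev j) = e := fun i j => cexp_add_cexp_neg hN (hτ j) i
  have hsum : ∀ i, ∑ j, x i j = n * e - i := fun i => by
    have h1 := hC.finrank i
    rw [← finrank_quotient_comap_redMap, ← comap_coordMap_famChain, hL,
      finrank_quotient_comap_smul hg] at h1
    change Module.finrank 𝔽 ((Fin (2 * n) → 𝔽⟦X⟧) ⧸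
      (diagLattice (x i)).comap (coordMap n 𝔽 i)) = n * e at h1
    rw [finrank_quotient_comap_diagLattice (hlow i)] at h1
    have h2 : ((∑ j, (x i j - omega n i j).toNat : ℕ) : ℤ) = ∑ j, x i j + i := by
      rw [Nat.cast_sum, Finset.sum_congr rfl fun j _ =>
        Int.toNat_of_nonneg (sub_nonneg.2 (hlow i j)), Finset.sum_sub_distrib, sum_omega hn,
        sub_neg_eq_add]
    rw [h1] at h2
    push_cast at h2
    omega
  refine ⟨g, hg, x, ⟨fun i j => cexp_add_self hN _ _, fun i => ?_, e, hdual⟩,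
    ⟨fun i _ _ => hlow i, fun i _ _ j => ?_, fun i _ _ => hsum i⟩, hL⟩
  · refine eq_single_of_sum_eq_one (fun j => sub_nonneg.2 (cexp_anti hN _ (by omega))) ?_
    simp only [Pi.sub_apply, Finset.sum_sub_distrib, hsum]
    ring
  · have h1 := hdual i j
    have h2 : omega n (-i) (Fin.rev j) ≤ x (-i) (Fin.rev j) := hlow (-i) (Fin.rev j)
    have h3 := omega_neg i j (Fin.rev j) (by rw [Fin.val_rev]; omega)
    omega

end RelativeDimension

end SymplecticLocalModel

namespace SymplecticLocalModel


/-! ### Splitting the special fibre into its factors. -/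

section GlobalCoordinates

variable {p : ℕ} [Fact p.Prime] {F : Type*} [Field F] [NumberField F]
  {𝔽 : Type*} [Field 𝔽] [Algebra ℤ_[p] 𝔽] {D : LocalDatum p F} {n : ℕ}
  (Φ : OF p F 𝔽 ≃ₐ[𝔽] (Emb 𝔽 D → TruncRing 𝔽 D.e))

variable (n) in
/-- The identification `Λ_{i,𝔽} = ∏_σ (𝔽[u]/u^e)^{2n}`. -/
def coordEquiv (i : ℤ) :
    LamF 𝔽 D n i ≃ₗ[𝔽] (Emb 𝔽 D → Fin (2 * n) → TruncRing 𝔽 D.e) where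
  toFun x σ j := Φ ((frameEquiv 𝔽 D n i).symm x j) σ
  invFun z := frameEquiv 𝔽 D n i fun j => Φ.symm fun σ => z σ j
  map_add' x y := by
    funext σ j
    rw [map_add, Pi.add_apply, map_add]
    rfl
  map_smul' c x := by
    funext σ j
    have h : (frameEquiv 𝔽 D n i).symm (c • x) = c • (frameEquiv 𝔽 D n i).symm x :=
      ((frameEquiv 𝔽 D n i).restrictScalars 𝔽).symm.map_smul c x
    rw [h, Pi.smul_apply, map_smul]
    rfl
  left_inv x := by
    simp only [AlgEquiv.symm_apply_apply]
    exact LinearEquiv.apply_symm_apply _ x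
  right_inv z := by
    funext σ j
    change Φ ((frameEquiv 𝔽 D n i).symm (frameEquiv 𝔽 D n i fun j => Φ.symm fun σ => z σ j) j) σ = _
    rw [LinearEquiv.symm_apply_apply, AlgEquiv.apply_symm_apply]

theorem coordEquiv_frameF (i : ℤ) (z : Fin (2 * n) → OF p F 𝔽) (σ : Emb 𝔽 D) :
    coordEquiv n Φ i (frameF D n i z) σ = fun j => Φ (z j) σ := by
  funext j
  change Φ ((frameEquiv 𝔽 D n i).symm (frameEquiv 𝔽 D n i z) j) σ = _
  rw [LinearEquiv.symm_apply_apply]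

theorem coordEquiv_symm (i : ℤ) (z : Emb 𝔽 D → Fin (2 * n) → TruncRing 𝔽 D.e) :
    (coordEquiv n Φ i).symm z = frameF D n i fun j => Φ.symm fun σ => z σ j := rfl

theorem coordEquiv_smul (i : ℤ) (a : OF p F 𝔽) (x : LamF 𝔽 D n i) (σ : Emb 𝔽 D) :
    coordEquiv n Φ i (a • x) σ = Φ a σ • coordEquiv n Φ i x σ := by
  obtain ⟨z, rfl⟩ := frameF_surjective i x
  rw [← map_smul, coordEquiv_frameF, coordEquiv_frameF]
  funext j
  rw [Pi.smul_apply, smul_eq_mul, map_mul]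
  rfl

variable {Φ} in
theorem IsCanonicalDecomp.coordEquiv_rhoF (hΦ : IsCanonicalDecomp D Φ) (i : ℤ) (x : LamF 𝔽 D n i)
    (σ : Emb 𝔽 D) : coordEquiv n Φ (i + 1) (rhoF D n i x) σ =
      stepMap (truncMk 𝔽 D.e PowerSeries.X) i (coordEquiv n Φ i x σ) := by
  obtain ⟨z, rfl⟩ := frameF_surjective i x
  rw [rhoF_frameF, coordEquiv_frameF, coordEquiv_frameF]
  funext j
  rw [map_mul, map_pow, Pi.mul_apply, Pi.pow_apply, hΦ.map_unifF]
  rfl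

theorem coordEquiv_thetaF (i : ℤ) (x : LamF 𝔽 D n ((2 * n : ℕ) + i)) (σ : Emb 𝔽 D) :
    coordEquiv n Φ i (thetaF D n i x) σ = coordEquiv n Φ ((2 * n : ℕ) + i) x σ := by
  obtain ⟨z, rfl⟩ := frameF_surjective _ x
  rw [thetaF_frameF, coordEquiv_frameF, coordEquiv_frameF]

theorem thetaF_bijective (i : ℤ) : Function.Bijective (thetaF (𝔽 := 𝔽) D n i) := by
  constructor
  · intro x y h
    obtain ⟨z, rfl⟩ := frameF_surjective _ x
    obtain ⟨w, rfl⟩ := frameF_surjective _ y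
    rw [thetaF_frameF, thetaF_frameF] at h
    rw [frameF_injective i h]
  · intro x
    obtain ⟨z, rfl⟩ := frameF_surjective _ x
    exact ⟨_, thetaF_frameF i z⟩

theorem pairingF_eq (i : ℤ) (x : LamF 𝔽 D n i) (y : LamF 𝔽 D n (-i)) :
    pairingF D n i x y = traceDeltaF D 𝔽 (Φ.symm fun σ =>
      symp n (TruncRing 𝔽 D.e) (coordEquiv n Φ i x σ) (coordEquiv n Φ (-i) y σ)) := by
  obtain ⟨z, rfl⟩ := frameF_surjective i x
  obtain ⟨w, rfl⟩ := frameF_surjective (-i) y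
  rw [pairingF_frameF]
  congr 1
  rw [AlgEquiv.eq_symm_apply]
  funext σ
  rw [coordEquiv_frameF, coordEquiv_frameF]
  exact (symp_map ((Pi.evalRingHom (fun _ : Emb 𝔽 D => TruncRing 𝔽 D.e) σ).comp
    (Φ : OF p F 𝔽 →+* (Emb 𝔽 D → TruncRing 𝔽 D.e))) z w).symm

section Components

open scoped Classical

theorem single_smul_coordEquiv_symm (i : ℤ) (σ : Emb 𝔽 D) (x : LamF 𝔽 D n i) :
    Φ.symm (Pi.single σ 1) • x =
      (coordEquiv n Φ i).symm (Pi.single σ (coordEquiv n Φ i x σ)) := by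
  rw [LinearEquiv.eq_symm_apply]
  funext τ
  rw [coordEquiv_smul, AlgEquiv.apply_symm_apply]
  rcases eq_or_ne τ σ with rfl | h
  · rw [Pi.single_eq_same, Pi.single_eq_same, one_smul]
  · rw [Pi.single_eq_of_ne h, Pi.single_eq_of_ne h]
    exact zero_smul (TruncRing 𝔽 D.e) (coordEquiv n Φ i x τ)

/-- The component of an `𝒪_F ⊗ 𝔽`-submodule of `Λ_{i,𝔽}` at `σ`. -/
def compOf {i : ℤ} (T : Submodule (OF p F 𝔽) (LamF 𝔽 D n i)) (σ : Emb 𝔽 D) :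
    Submodule (TruncRing 𝔽 D.e) (Fin (2 * n) → TruncRing 𝔽 D.e) where
  carrier := {y | (coordEquiv n Φ i).symm (Pi.single σ y) ∈ T}
  add_mem' {y y'} h h' := by
    change (coordEquiv n Φ i).symm (Pi.single σ (y + y')) ∈ T
    rw [Pi.single_add, map_add]
    exact add_mem h h'
  zero_mem' := by
    change (coordEquiv n Φ i).symm (Pi.single σ 0) ∈ T
    rw [Pi.single_zero, map_zero]
    exact zero_mem T
  smul_mem' r y h := by
    change (coordEquiv n Φ i).symm (Pi.single σ (r • y)) ∈ T
    have h1 : (coordEquiv n Φ i).symm (Pi.single σ (r • y)) =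
        Φ.symm (fun _ => r) • (coordEquiv n Φ i).symm (Pi.single σ y) := by
      rw [LinearEquiv.symm_apply_eq]
      funext τ
      rw [coordEquiv_smul, AlgEquiv.apply_symm_apply, LinearEquiv.apply_symm_apply]
      rcases eq_or_ne τ σ with rfl | h
      · rw [Pi.single_eq_same, Pi.single_eq_same]
      · rw [Pi.single_eq_of_ne h, Pi.single_eq_of_ne h, smul_zero]
    rw [h1]
    exact T.smul_mem _ h

variable {i : ℤ} {T : Submodule (OF p F 𝔽) (LamF 𝔽 D n i)}

theorem mem_compOf {σ : Emb 𝔽 D} {y : Fin (2 * n) → TruncRing 𝔽 D.e} :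
    y ∈ compOf Φ T σ ↔ (coordEquiv n Φ i).symm (Pi.single σ y) ∈ T := Iff.rfl

theorem coordEquiv_mem_compOf {x : LamF 𝔽 D n i} (hx : x ∈ T) (σ : Emb 𝔽 D) :
    coordEquiv n Φ i x σ ∈ compOf Φ T σ := by
  rw [mem_compOf, ← single_smul_coordEquiv_symm]
  exact T.smul_mem _ hx

theorem mem_iff_coordEquiv_mem [Fintype (Emb 𝔽 D)] {x : LamF 𝔽 D n i} :
    x ∈ T ↔ ∀ σ, coordEquiv n Φ i x σ ∈ compOf Φ T σ := by
  refine ⟨fun h => coordEquiv_mem_compOf Φ h, fun h => ?_⟩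
  rw [← (coordEquiv n Φ i).symm_apply_apply x, ← Finset.univ_sum_single (coordEquiv n Φ i x),
    map_sum]
  exact Submodule.sum_mem _ fun σ _ => h σ

/-- The idempotent of `σ` cuts out the factor at `σ` of the quotient, which connects the determinant
condition with the components. -/
theorem finrank_range_component (σ : Emb 𝔽 D) :
    Module.finrank 𝔽 (LinearMap.range (Algebra.lsmul 𝔽 𝔽 (LamF 𝔽 D n i ⧸ T)
      (Φ.symm (Pi.single σ 1)))) =
      Module.finrank 𝔽 ((Fin (2 * n) → TruncRing 𝔽 D.e) ⧸ compOf Φ T σ) := by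
  let f₀ : (Fin (2 * n) → TruncRing 𝔽 D.e) →ₗ[𝔽] LamF 𝔽 D n i ⧸ T :=
    (T.mkQ.restrictScalars 𝔽) ∘ₗ (coordEquiv n Φ i).symm.toLinearMap ∘ₗ
      LinearMap.single 𝔽 (fun _ : Emb 𝔽 D => Fin (2 * n) → TruncRing 𝔽 D.e) σ
  have hf₀ : ∀ y, f₀ y = T.mkQ ((coordEquiv n Φ i).symm (Pi.single σ y)) := fun _ => rfl
  have hE : ∀ x, Algebra.lsmul 𝔽 𝔽 (LamF 𝔽 D n i ⧸ T) (Φ.symm (Pi.single σ 1)) (T.mkQ x) =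
      f₀ (coordEquiv n Φ i x σ) := fun x => by
    change Φ.symm (Pi.single σ 1) • T.mkQ x = _
    rw [← map_smul, single_smul_coordEquiv_symm, hf₀]
  have hmem : ∀ y, f₀ y ∈ LinearMap.range (Algebra.lsmul 𝔽 𝔽 (LamF 𝔽 D n i ⧸ T)
      (Φ.symm (Pi.single σ 1))) := fun y => by
    refine ⟨T.mkQ ((coordEquiv n Φ i).symm (Pi.single σ y)), ?_⟩
    rw [hE, LinearEquiv.apply_symm_apply, Pi.single_eq_same]
  rw [finrank_quotient_eq (f₀.codRestrict _ hmem)]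
  · rintro ⟨_, m, rfl⟩
    obtain ⟨x, rfl⟩ := T.mkQ_surjective m
    exact ⟨_, Subtype.ext (hE x).symm⟩
  · intro y
    rw [← Subtype.val_inj]
    change f₀ y = 0 ↔ _
    rw [hf₀, mem_compOf]
    exact Submodule.Quotient.mk_eq_zero T

end Components

end GlobalCoordinates

end SymplecticLocalModel

namespace SymplecticLocalModel


/-! ### Reducing elements of the Iwahori group to isometries modulo `u^e`. -/

section LocalAutomorphisms

variable {n : ℕ} {𝔽 : Type*} [Field 𝔽] {e : ℕ}

/-- If `c = b²` is the constant term of `u`, then `u^{p^e} = c^{p^e}`. With `p^e = 2k + 1` odd, `s =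
u^{k+1} / b^{p^e}` has square `u^{2k+2} / c^{p^e} = u`. -/
theorem exists_mul_self_eq_of_isUnit (p : ℕ) [Fact p.Prime] (hp : p ≠ 2) [CharP 𝔽 p]
    [IsAlgClosed 𝔽] (he : e ≠ 0) {u : TruncRing 𝔽 e} (hu : IsUnit u) :
    ∃ s : (TruncRing 𝔽 e)ˣ, (s * s : TruncRing 𝔽 e) = u := by
  have hchar := truncRing_charP (K := 𝔽) p he
  have : Nontrivial (TruncRing 𝔽 e) := CharP.nontrivial_of_char_ne_one
    (Fact.out : p.Prime).one_lt.ne' (R := TruncRing 𝔽 e)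
  obtain ⟨c, hc⟩ := exists_const_sub_mem u
  obtain ⟨y, hy⟩ := Ideal.mem_span_singleton.1 hc
  have hQ : u ^ p ^ e = algebraMap 𝔽 _ (c ^ p ^ e) := by
    rw [eq_add_of_sub_eq hy, add_pow_char_pow, mul_pow,
      pow_eq_zero_of_le (Nat.lt_pow_self (Fact.out : p.Prime).one_lt).le truncMk_X_pow, zero_mul,
      zero_add, map_pow]
  have hc0 : c ≠ 0 := by
    rintro rfl
    rw [zero_pow (pow_pos (Fact.out : p.Prime).pos e).ne', map_zero] at hQ
    exact (hu.pow (p ^ e)).ne_zero hQ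
  obtain ⟨b, hb⟩ := IsAlgClosed.exists_pow_nat_eq c (n := 2) two_pos
  obtain ⟨k, hk⟩ : Odd (p ^ e) := ((Fact.out : p.Prime).odd_of_ne_two hp).pow
  set s : TruncRing 𝔽 e := u ^ (k + 1) * algebraMap 𝔽 _ (b ^ p ^ e)⁻¹ with hs
  have hss : s * s = u := by
    have h1 : (b ^ p ^ e)⁻¹ * (b ^ p ^ e)⁻¹ * c ^ p ^ e = 1 := by
      have hb0 : b ≠ 0 := by
        rintro rfl
        exact hc0 (by rw [← hb]; ring)
      rw [← hb]
      field_simp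
      ring
    have h2 := congrArg (algebraMap 𝔽 (TruncRing 𝔽 e)) h1
    have h3 : u ^ p ^ e = u ^ (2 * k + 1) := by rw [hk]
    rw [map_mul, map_mul, map_one, ← hQ, h3] at h2
    rw [hs]
    linear_combination u * h2
  have hsu : IsUnit s := isUnit_of_mul_isUnit_left (hss.symm ▸ hu)
  exact ⟨hsu.unit, hss⟩

theorem redMap_eq_zero_iff {c : Fin (2 * n) → 𝔽⟦X⟧} :
    redMap n 𝔽 e c = 0 ↔ ∃ d, c = (PowerSeries.X ^ e : 𝔽⟦X⟧) • d := by
  constructor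
  · intro h
    choose d hd using fun j => truncMk_eq_zero_iff.1 (congrFun h j)
    exact ⟨d, funext hd⟩
  · rintro ⟨d, rfl⟩
    funext j
    change truncMk 𝔽 e (PowerSeries.X ^ e * d j) = 0
    rw [map_mul, map_pow, truncMk_X_pow, zero_mul]

theorem redMap_congr (θ : (Fin (2 * n) → 𝔽⟦X⟧) →ₗ[𝔽⟦X⟧] (Fin (2 * n) → 𝔽⟦X⟧))
    {c d : Fin (2 * n) → 𝔽⟦X⟧} (h : redMap n 𝔽 e c = redMap n 𝔽 e d) :
    redMap n 𝔽 e (θ c) = redMap n 𝔽 e (θ d) := by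
  rw [← sub_eq_zero, ← map_sub, redMap_eq_zero_iff] at h ⊢
  obtain ⟨r, hr⟩ := h
  exact ⟨θ r, by rw [← map_sub, hr, map_smul]⟩

variable (e) in
/-- Automorphisms of `𝔽⟦u⟧^{2n}` induce automorphisms of `(𝔽[u]/u^e)^{2n}`. -/
theorem exists_reduced_aut (θ : (Fin (2 * n) → 𝔽⟦X⟧) ≃ₗ[𝔽⟦X⟧] (Fin (2 * n) → 𝔽⟦X⟧)) :
    ∃ ψ : (Fin (2 * n) → TruncRing 𝔽 e) ≃ₗ[TruncRing 𝔽 e] (Fin (2 * n) → TruncRing 𝔽 e),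
      ∀ c, ψ (redMap n 𝔽 e c) = redMap n 𝔽 e (θ c) := by
  let r := Function.surjInv (redMap_surjective (n := n) (𝔽 := 𝔽) (e := e))
  have hr : ∀ z, redMap n 𝔽 e (r z) = z := Function.surjInv_eq _
  have h1 : ∀ c, redMap n 𝔽 e (θ (r (redMap n 𝔽 e c))) = redMap n 𝔽 e (θ c) := fun c =>
    redMap_congr θ.toLinearMap (hr _)
  have h2 : ∀ c, redMap n 𝔽 e (θ.symm (r (redMap n 𝔽 e c))) = redMap n 𝔽 e (θ.symm c) := fun c =>
    redMap_congr θ.symm.toLinearMap (hr _)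
  refine ⟨{ toFun := fun z => redMap n 𝔽 e (θ (r z)),
            invFun := fun z => redMap n 𝔽 e (θ.symm (r z)),
            map_add' := fun z w => ?_, map_smul' := fun a z => ?_,
            left_inv := fun z => ?_, right_inv := fun z => ?_ }, h1⟩
  · obtain ⟨c, rfl⟩ := redMap_surjective z
    obtain ⟨d, rfl⟩ := redMap_surjective w
    rw [← map_add, h1, h1, h1, map_add, map_add]
  · obtain ⟨c, rfl⟩ := redMap_surjective z
    obtain ⟨a, rfl⟩ := truncMk_surjective a
    have h3 : ∀ c : Fin (2 * n) → 𝔽⟦X⟧,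
        truncMk 𝔽 e a • redMap n 𝔽 e c = redMap n 𝔽 e (a • c) := fun c => rfl
    rw [h3, h1, h1, map_smul, RingHom.id_apply, h3]
  · obtain ⟨c, rfl⟩ := redMap_surjective z
    change redMap n 𝔽 e (θ.symm (r (redMap n 𝔽 e (θ (r (redMap n 𝔽 e c)))))) = _
    rw [h1, h2, LinearEquiv.symm_apply_apply]
  · obtain ⟨c, rfl⟩ := redMap_surjective z
    change redMap n 𝔽 e (θ (r (redMap n 𝔽 e (θ.symm (r (redMap n 𝔽 e c)))))) = _
    rw [h2, h1, LinearEquiv.apply_symm_apply]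

/-- The multiplier of `g` is the value of the form on the image of a pair with value `1`, hence a
power series; applied to a preimage of that pair, the same relation shows that it is a unit. -/
theorem exists_similitude_unit (hn : 0 < n) {g : GSp n 𝔽⸨X⸩}
    {θ : ℤ → (Fin (2 * n) → 𝔽⟦X⟧) ≃ₗ[𝔽⟦X⟧] (Fin (2 * n) → 𝔽⟦X⟧)}
    (hθ : ∀ i c, coordMap n 𝔽 i (θ i c) =
      (g : GL (Fin (2 * n)) 𝔽⸨X⸩).val.mulVec (coordMap n 𝔽 i c)) :
    ∃ m : 𝔽⟦X⟧, IsUnit m ∧ ∀ i a b,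
      symp n 𝔽⟦X⟧ (θ i a) (θ (-i) b) = m * symp n 𝔽⟦X⟧ a b := by
  obtain ⟨κ, hκ⟩ := g.2
  have hinj := FaithfulSMul.algebraMap_injective 𝔽⟦X⟧ 𝔽⸨X⸩
  have h1 : ∀ i a b, algebraMap 𝔽⟦X⟧ 𝔽⸨X⸩ (symp n 𝔽⟦X⟧ (θ i a) (θ (-i) b)) =
      κ * algebraMap 𝔽⟦X⟧ 𝔽⸨X⸩ (symp n 𝔽⟦X⟧ a b) := fun i a b => by
    rw [← symp_coordMap i, ← symp_coordMap i, hθ, hθ]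
    exact symp_mulVec_of_eq hκ _ _
  let k : Fin (2 * n) := ⟨0, by omega⟩
  obtain ⟨a, b, hab⟩ : ∃ a b : Fin (2 * n) → 𝔽⟦X⟧, symp n 𝔽⟦X⟧ a b = 1 := by
    refine ⟨Pi.single k 1, Pi.single (Fin.rev k) 1, ?_⟩
    rw [symp_single_left, Pi.single_eq_same, jsign, if_pos hn, mul_one, mul_one]
  have h2 : ∀ i a' b', symp n 𝔽⟦X⟧ (θ i a') (θ (-i) b') =
      symp n 𝔽⟦X⟧ (θ 0 a) (θ (-0) b) * symp n 𝔽⟦X⟧ a' b' := fun i a' b' => by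
    apply hinj
    rw [map_mul, h1, h1, hab, map_one, mul_one]
  refine ⟨_, ?_, h2⟩
  have h3 := h2 0 ((θ 0).symm a) ((θ (-0)).symm b)
  rw [LinearEquiv.apply_symm_apply, LinearEquiv.apply_symm_apply, hab] at h3
  exact IsUnit.of_mul_eq_one _ h3.symm

/-- Reduce `g` modulo `u^e` on every `Λ̃_i` and multiply by a square root of the inverse multiplier.
The scalar restores the pairing and fixes every submodule, so the effect on chains is still that of
`g`. -/
theorem exists_localAut (p : ℕ) [Fact p.Prime] (hp : p ≠ 2) [CharP 𝔽 p] [IsAlgClosed 𝔽]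
    (he : e ≠ 0) (hn : 0 < n) {g : GSp n 𝔽⸨X⸩} (hg : g ∈ Iwahori n 𝔽) :
    ∃ ψ : ℤ → (Fin (2 * n) → TruncRing 𝔽 e) ≃ₗ[TruncRing 𝔽 e] (Fin (2 * n) → TruncRing 𝔽 e),
      (∀ i z, ψ (i + 1) (stepMap (truncMk 𝔽 e PowerSeries.X) i z) =
        stepMap (truncMk 𝔽 e PowerSeries.X) i (ψ i z)) ∧
      (∀ i z, ψ ((2 * n : ℕ) + i) z = ψ i z) ∧
      (∀ i z w, symp n (TruncRing 𝔽 e) (ψ i z) (ψ (-i) w) = symp n (TruncRing 𝔽 e) z w) ∧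
      ∀ C C' : ℤ → Submodule (TruncRing 𝔽 e) (Fin (2 * n) → TruncRing 𝔽 e),
        (∀ i z, ψ i z ∈ C' i ↔ z ∈ C i) → famChain C' = g • famChain C := by
  choose θ hθ using fun i => exists_latticeAut hg i
  obtain ⟨m, hm, hsymp⟩ := exists_similitude_unit hn hθ
  obtain ⟨s, hs⟩ := exists_mul_self_eq_of_isUnit p hp he
    ((hm.map (truncMk 𝔽 e)).unit⁻¹).isUnit
  choose ψ hψ using fun i => exists_reduced_aut e (θ i)
  have hs1 : (s * s : TruncRing 𝔽 e) * truncMk 𝔽 e m = 1 := by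
    rw [hs]
    exact (hm.map (truncMk 𝔽 e)).val_inv_mul
  have hval : ∀ i c, ((ψ i).trans (LinearEquiv.smulOfUnit s)) (redMap n 𝔽 e c) =
      (s : TruncRing 𝔽 e) • redMap n 𝔽 e (θ i c) := fun i c => by
    rw [LinearEquiv.trans_apply, hψ]
    rfl
  refine ⟨fun i => (ψ i).trans (LinearEquiv.smulOfUnit s), fun i z => ?_, fun i z => ?_,
    fun i z w => ?_, fun C C' h => ?_⟩
  · obtain ⟨c, rfl⟩ := redMap_surjective z
    have h1 : θ (i + 1) (stepMap PowerSeries.X i c) = stepMap PowerSeries.X i (θ i c) := by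
      apply coordMap_injective (i + 1)
      rw [hθ, coordMap_stepMap, coordMap_stepMap, hθ]
    rw [← redMap_stepMap, hval, hval, h1, redMap_stepMap]
    funext j
    simp only [stepMap, Pi.smul_apply, smul_eq_mul]
    ring
  · obtain ⟨c, rfl⟩ := redMap_surjective z
    rw [hval, hval]
    congr 2
    apply coordMap_injective i
    rw [hθ, ← upow_smul_coordMap, hθ, ← upow_smul_coordMap i c, Matrix.mulVec_smul]
  · obtain ⟨a, rfl⟩ := redMap_surjective z
    obtain ⟨b, rfl⟩ := redMap_surjective w
    have h1 : ∀ a b, symp n (TruncRing 𝔽 e) (redMap n 𝔽 e a) (redMap n 𝔽 e b) =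
        truncMk 𝔽 e (symp n 𝔽⟦X⟧ a b) := fun a b => symp_map (truncMk 𝔽 e) a b
    rw [hval, hval, LinearMap.map_smul₂, map_smul, h1, h1, hsymp, map_mul, smul_eq_mul,
      smul_eq_mul]
    linear_combination (truncMk 𝔽 e (symp n 𝔽⟦X⟧ a b)) * hs1
  · have key : ∀ i c, redMap n 𝔽 e (θ i c) ∈ C' i ↔ redMap n 𝔽 e c ∈ C i := fun i c => by
      rw [← h, hval]
      exact (Submodule.smul_mem_iff_of_isUnit _ s.isUnit).symm
    funext i
    ext x
    rw [mem_smul_chain, mem_famChain]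
    constructor
    · rintro ⟨c, hc, rfl⟩
      refine ⟨coordMap n 𝔽 i ((θ i).symm c), ?_, ?_⟩
      · rw [coordMap_mem_famChain, ← key, LinearEquiv.apply_symm_apply]
        exact hc
      · rw [← hθ, LinearEquiv.apply_symm_apply]
    · rintro ⟨_, ⟨c, hc, rfl⟩, rfl⟩
      exact ⟨θ i c, (key i c).2 hc, hθ i c⟩

end LocalAutomorphisms

end SymplecticLocalModel

namespace SymplecticLocalModel


/-! ### Points of the local model as tuples of families. -/

section LocalModelPoints

variable {p : ℕ} [Fact p.Prime] {F : Type*} [Field F] [NumberField F]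
  {𝔽 : Type*} [Field 𝔽] [Algebra ℤ_[p] 𝔽] {D : LocalDatum p F} {n : ℕ}

instance (i : ℤ) : Module.Finite 𝔽 (LamF 𝔽 D n i) :=
  Module.Finite.equiv ((frameEquiv 𝔽 D n i).restrictScalars 𝔽)

instance (i : ℤ) (T : Submodule (OF p F 𝔽) (LamF 𝔽 D n i)) :
    Module.Finite 𝔽 (LamF 𝔽 D n i ⧸ T) :=
  Module.Finite.of_surjective (T.mkQ.restrictScalars 𝔽) T.mkQ_surjective

variable {Φ : OF p F 𝔽 ≃ₐ[𝔽] (Emb 𝔽 D → TruncRing 𝔽 D.e)}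

theorem component_eq_compOf (t : MLoc 𝔽 D n) (σ : Emb 𝔽 D) (i : ℤ) :
    component Φ t σ i = compOf Φ (t.t i) σ := by
  classical
  ext y
  constructor
  · rintro ⟨z, hz, h⟩
    have h1 := coordEquiv_mem_compOf Φ hz σ
    rw [coordEquiv_frameF] at h1
    exact (funext h : (fun j => Φ (z j) σ) = y) ▸ h1
  · intro h
    rw [mem_compOf, coordEquiv_symm] at h
    refine ⟨_, h, fun j => ?_⟩
    rw [AlgEquiv.apply_symm_apply]
    exact congrFun (Pi.single_eq_same (M := fun _ => Fin (2 * n) → TruncRing 𝔽 D.e) σ y) j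

theorem chainOf_eq_famChain (t : MLoc 𝔽 D n) (σ : Emb 𝔽 D) :
    chainOf Φ t σ = famChain (component Φ t σ) := by
  funext i
  ext x
  rw [mem_famChain]
  constructor
  · rintro ⟨c, h, hc⟩
    refine ⟨c, hc, funext fun j => ?_⟩
    rw [h j]
    rfl
  · rintro ⟨c, hc, rfl⟩
    exact ⟨c, fun j => rfl, hc⟩

/-- The submodule of `Λ_{i,𝔽}` with given components. -/
def submoduleOfComponents (Φ : OF p F 𝔽 ≃ₐ[𝔽] (Emb 𝔽 D → TruncRing 𝔽 D.e)) (i : ℤ)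
    (C : Emb 𝔽 D → Submodule (TruncRing 𝔽 D.e) (Fin (2 * n) → TruncRing 𝔽 D.e)) :
    Submodule (OF p F 𝔽) (LamF 𝔽 D n i) where
  carrier := {x | ∀ σ, coordEquiv n Φ i x σ ∈ C σ}
  add_mem' {x y} hx hy σ := by
    rw [map_add]
    exact add_mem (hx σ) (hy σ)
  zero_mem' σ := by
    rw [map_zero]
    exact zero_mem _
  smul_mem' a x hx σ := by
    rw [coordEquiv_smul]
    exact (C σ).smul_mem _ (hx σ)

theorem mem_submoduleOfComponents {i : ℤ} {x : LamF 𝔽 D n i}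
    {C : Emb 𝔽 D → Submodule (TruncRing 𝔽 D.e) (Fin (2 * n) → TruncRing 𝔽 D.e)} :
    x ∈ submoduleOfComponents Φ i C ↔ ∀ σ, coordEquiv n Φ i x σ ∈ C σ := Iff.rfl

theorem compOf_submoduleOfComponents (i : ℤ)
    (C : Emb 𝔽 D → Submodule (TruncRing 𝔽 D.e) (Fin (2 * n) → TruncRing 𝔽 D.e)) (σ : Emb 𝔽 D) :
    compOf Φ (submoduleOfComponents Φ i C) σ = C σ := by
  classical
  ext y
  rw [mem_compOf, mem_submoduleOfComponents, LinearEquiv.apply_symm_apply]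
  constructor
  · intro h
    simpa using h σ
  · intro h τ
    rcases eq_or_ne τ σ with rfl | hτ
    · rwa [Pi.single_eq_same]
    · rw [Pi.single_eq_of_ne hτ]
      exact zero_mem _

variable [CharP 𝔽 p]

theorem mem_t_iff (t : MLoc 𝔽 D n) {i : ℤ} {x : LamF 𝔽 D n i} :
    x ∈ t.t i ↔ ∀ σ, coordEquiv n Φ i x σ ∈ component Φ t σ i := by
  simp only [component_eq_compOf]
  exact mem_iff_coordEquiv_mem Φ

theorem MLoc.eq_of_chainOf {t t' : MLoc 𝔽 D n} (h : ∀ σ, chainOf Φ t σ = chainOf Φ t' σ) :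
    t = t' := by
  refine MLoc.ext (funext fun i => ?_)
  ext x
  have h1 : ∀ σ, component Φ t σ = component Φ t' σ := fun σ =>
    famChain_injective (by rw [← chainOf_eq_famChain, ← chainOf_eq_famChain, h])
  rw [mem_t_iff (Φ := Φ), mem_t_iff (Φ := Φ)]
  simp only [h1]

theorem determinant_iff_finrank_component [Infinite 𝔽] {i : ℤ}
    (T : Submodule (OF p F 𝔽) (LamF 𝔽 D n i)) :
    (∃ d : MvPolynomial (Module.Free.ChooseBasisIndex ℤ (𝓞 F)) ℤ,
      MvPolynomial.map (Int.castRingHom ℂ) d =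
        detPoly F ℂ (Vneg F n) (fun a => Algebra.lsmul ℂ ℂ (Vneg F n) ((1 : ℂ) ⊗ₜ[ℚ] (a : F))) ∧
      MvPolynomial.map (Int.castRingHom 𝔽) d =
        detPoly F 𝔽 (LamF 𝔽 D n i ⧸ T)
          (fun a => Algebra.lsmul 𝔽 𝔽 (LamF 𝔽 D n i ⧸ T) ((1 : 𝔽) ⊗ₜ[ℤ_[p]] inclO p F a))) ↔
    ∀ σ, Module.finrank 𝔽 ((Fin (2 * n) → TruncRing 𝔽 D.e) ⧸ compOf Φ T σ) = n * D.e := by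
  classical
  rw [determinant_iff_norm, det_lsmul_eq_norm_pow_iff p (e_ne_zero D) Φ]
  simp only [finrank_range_component]

theorem isCompFamily_component [Infinite 𝔽] (hΦ : IsCanonicalDecomp D Φ) (t : MLoc 𝔽 D n)
    (σ : Emb 𝔽 D) : IsCompFamily (component Φ t σ) where
  step i z hz := by
    classical
    rw [component_eq_compOf] at hz ⊢
    have h := coordEquiv_mem_compOf Φ (t.functorial i _ ((mem_compOf Φ).1 hz)) σ
    rwa [hΦ.coordEquiv_rhoF, LinearEquiv.apply_symm_apply, Pi.single_eq_same] at h
  periodic i := by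
    classical
    ext y
    rw [component_eq_compOf, component_eq_compOf, mem_compOf, mem_compOf]
    have h1 : (coordEquiv n Φ i).symm (Pi.single σ y) =
        thetaF D n i ((coordEquiv n Φ ((2 * n : ℕ) + i)).symm (Pi.single σ y)) := by
      rw [LinearEquiv.symm_apply_eq]
      funext τ
      rw [coordEquiv_thetaF, LinearEquiv.apply_symm_apply]
    rw [h1, ← SetLike.mem_coe (p := t.t i), ← t.periodic i,
      (thetaF_bijective i).1.mem_set_image, SetLike.mem_coe]
  pairing i z hz w hw := by
    classical
    rw [component_eq_compOf, mem_compOf] at hz hw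
    -- `t_i` is stable under `𝒪_F ⊗ 𝔽`, so the trace form vanishes on all multiples of this element.
    have key : Φ.symm (Pi.single σ (symp n (TruncRing 𝔽 D.e) z w)) = 0 := by
      refine eq_zero_of_traceDeltaF D 𝔽 fun b => ?_
      have h := t.dual i _ ((t.t i).smul_mem b hz) _ hw
      rw [pairingF_eq Φ] at h
      rw [← h]
      congr 1
      rw [AlgEquiv.eq_symm_apply, map_mul, AlgEquiv.apply_symm_apply]
      funext τ
      rw [coordEquiv_smul, LinearEquiv.apply_symm_apply, LinearEquiv.apply_symm_apply, Pi.mul_apply,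
        LinearMap.map_smul₂, smul_eq_mul, mul_comm]
      congr 1
      rcases eq_or_ne τ σ with rfl | hτ
      · rw [Pi.single_eq_same, Pi.single_eq_same, Pi.single_eq_same]
      · rw [Pi.single_eq_of_ne hτ, Pi.single_eq_of_ne hτ, LinearMap.map_zero₂]
    rw [EmbeddingLike.map_eq_zero_iff, Pi.single_eq_zero_iff] at key
    exact key
  finrank i := by
    rw [component_eq_compOf]
    exact (determinant_iff_finrank_component (Φ := Φ) _).1 (t.determinant i) σ

theorem exists_MLoc_of_isCompFamily [Infinite 𝔽] (hΦ : IsCanonicalDecomp D Φ)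
    {C : Emb 𝔽 D → ℤ → Submodule (TruncRing 𝔽 D.e) (Fin (2 * n) → TruncRing 𝔽 D.e)}
    (hC : ∀ σ, IsCompFamily (C σ)) : ∃ t : MLoc 𝔽 D n, ∀ σ, component Φ t σ = C σ := by
  let t : MLoc 𝔽 D n :=
  { t := fun i => submoduleOfComponents Φ i fun σ => C σ i
    functorial := fun i x hx σ => by
      rw [hΦ.coordEquiv_rhoF]
      exact (hC σ).step i _ (hx σ)
    finite := fun i => inferInstance
    projective := fun i => inferInstance
    determinant := fun i => by
      rw [determinant_iff_finrank_component (Φ := Φ)]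
      intro σ
      rw [compOf_submoduleOfComponents]
      exact (hC σ).finrank i
    dual := fun i x hx y hy => by
      rw [pairingF_eq Φ]
      have h : (fun σ => symp n (TruncRing 𝔽 D.e) (coordEquiv n Φ i x σ)
          (coordEquiv n Φ (-i) y σ)) = 0 := funext fun σ => (hC σ).pairing i _ (hx σ) _ (hy σ)
      rw [h, map_zero, map_zero]
    periodic := fun i => by
      ext x
      obtain ⟨y, rfl⟩ := (thetaF_bijective i).2 x
      rw [(thetaF_bijective i).1.mem_set_image, SetLike.mem_coe, SetLike.mem_coe]
      refine forall_congr' fun σ => ?_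
      rw [coordEquiv_thetaF]
      exact SetLike.ext_iff.1 ((hC σ).periodic i) _ }
  refine ⟨t, fun σ => funext fun i => ?_⟩
  rw [component_eq_compOf]
  exact compOf_submoduleOfComponents i (fun σ => C σ i) σ

end LocalModelPoints

end SymplecticLocalModel

namespace SymplecticLocalModel


/-! ### Points attached to permissible alcoves. -/

section PermissibleFamilies

variable {n : ℕ} {e : ℕ} {x : ℤ → Fin (2 * n) → ℤ}

theorem IsExtendedAlcove.add_mul (hx : IsExtendedAlcove x) (i q : ℤ) (j : Fin (2 * n)) :
    x (i + (2 * n : ℕ) * q) j = x i j - q := by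
  induction q with
  | zero => simp
  | succ q ih =>
    have h : i + ((2 * n : ℕ) : ℤ) * ((q : ℤ) + 1) = i + (2 * n : ℕ) * q + (2 * n : ℕ) := by ring
    rw [h, hx.periodic, ih]
    ring
  | pred q ih =>
    have h := hx.periodic (i + ((2 * n : ℕ) : ℤ) * (-(q : ℤ) - 1)) j
    have h1 : i + ((2 * n : ℕ) : ℤ) * (-(q : ℤ) - 1) + (2 * n : ℕ) = i + (2 * n : ℕ) * (-q) := by
      ring
    rw [h1, ih] at h
    linarith

theorem omega_add_mul (i q : ℤ) (j : Fin (2 * n)) :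
    omega n (i + (2 * n : ℕ) * q) j = omega n i j - q := by
  have hN : ((2 * n : ℕ) : ℤ) ≠ 0 := by have := j.2; omega
  unfold omega
  rw [Int.add_mul_emod_self_left, Int.add_mul_ediv_left _ _ hN]
  ring

theorem IsPermissible.omega_le (hp : IsPermissible e x) (hx : IsExtendedAlcove x) (i : ℤ)
    (j : Fin (2 * n)) : omega n i j ≤ x i j := by
  have hN : (0 : ℤ) < (2 * n : ℕ) := by have := j.2; omega
  rw [← Int.emod_add_mul_ediv i (2 * n : ℕ), hx.add_mul, omega_add_mul]
  exact sub_le_sub_right (hp.lower _ (Int.emod_nonneg _ hN.ne') (Int.emod_lt_of_pos _ hN) j) _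

theorem IsPermissible.le_omega_add (hp : IsPermissible e x) (hx : IsExtendedAlcove x) (i : ℤ)
    (j : Fin (2 * n)) : x i j ≤ omega n i j + e := by
  have hN : (0 : ℤ) < (2 * n : ℕ) := by have := j.2; omega
  have h := hp.upper _ (Int.emod_nonneg i hN.ne') (Int.emod_lt_of_pos i hN) j
  rw [← Int.emod_add_mul_ediv i (2 * n : ℕ), hx.add_mul, omega_add_mul]
  linarith

theorem IsPermissible.sum_eq (hp : IsPermissible e x) (hx : IsExtendedAlcove x) (hn : 0 < n)
    (i : ℤ) : ∑ j, x i j = n * e - i := by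
  have hN : (0 : ℤ) < (2 * n : ℕ) := by omega
  have h := hp.sum _ (Int.emod_nonneg i hN.ne') (Int.emod_lt_of_pos i hN)
  have h1 := Int.emod_add_mul_ediv i (2 * n : ℕ)
  conv_lhs => rw [← h1]
  simp only [hx.add_mul, Finset.sum_sub_distrib, h, Finset.sum_const, Finset.card_univ,
    Fintype.card_fin, nsmul_eq_mul]
  linarith

/-- Summing the duality relation at `i = 0` over all coordinates gives `2n c = 2 n e`. -/
theorem IsPermissible.add_rev (hp : IsPermissible e x) (hx : IsExtendedAlcove x) (hn : 0 < n)
    (i : ℤ) (j : Fin (2 * n)) : x i j + x (-i) (Fin.rev j) = e := by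
  obtain ⟨c, hc⟩ := hx.dual
  have h1 : ∑ j, (x 0 j + x (-0) (Fin.rev j)) = ∑ _j : Fin (2 * n), c :=
    Finset.sum_congr rfl fun j _ => hc 0 j
  have h2 : ∑ j, x 0 (Fin.rev j) = ∑ j, x 0 j := Equiv.sum_comp Fin.revPerm (x 0)
  rw [Finset.sum_add_distrib, neg_zero, h2, hp.sum_eq hx hn, Finset.sum_const, Finset.card_univ,
    Fintype.card_fin, nsmul_eq_mul] at h1
  rw [hc]
  have h3 : (n : ℤ) ≠ 0 := by omega
  push_cast at h1
  exact mul_left_cancel₀ h3 (by linarith)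

variable (𝔽 : Type*) [Field 𝔽]

/-- The family of submodules of `(𝔽[u]/u^e)^{2n}` attached to a permissible alcove. -/
def alcoveFamily (e : ℕ) (x : ℤ → Fin (2 * n) → ℤ) (i : ℤ) :
    Submodule (TruncRing 𝔽 e) (Fin (2 * n) → TruncRing 𝔽 e) where
  carrier := {z | ∀ j, truncMk 𝔽 e PowerSeries.X ^ (x i j - omega n i j).toNat ∣ z j}
  add_mem' hz hw j := dvd_add (hz j) (hw j)
  zero_mem' _ := dvd_zero _
  smul_mem' a _ hz j := (hz j).mul_left a

variable {𝔽}

theorem mem_alcoveFamily {i : ℤ} {z : Fin (2 * n) → TruncRing 𝔽 e} :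
    z ∈ alcoveFamily 𝔽 e x i ↔
      ∀ j, truncMk 𝔽 e PowerSeries.X ^ (x i j - omega n i j).toNat ∣ z j := Iff.rfl

theorem truncMk_X_pow_dvd_iff {d : ℕ} (hd : d ≤ e) (c : 𝔽⟦X⟧) :
    truncMk 𝔽 e PowerSeries.X ^ d ∣ truncMk 𝔽 e c ↔ PowerSeries.X ^ d ∣ c := by
  constructor
  · rintro ⟨a, ha⟩
    obtain ⟨a, rfl⟩ := truncMk_surjective a
    rw [← map_pow, ← map_mul, truncMk_eq_iff] at ha
    have h1 := (pow_dvd_pow (PowerSeries.X : 𝔽⟦X⟧) hd).trans ha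
    exact (dvd_iff_dvd_of_dvd_sub h1).2 (dvd_mul_right _ _)
  · rintro ⟨a, rfl⟩
    rw [map_mul, map_pow]
    exact dvd_mul_right _ _

/-- The bound `x_i ≤ ω_i + e` ensures that truncation modulo `u^e` loses no divisibility condition,
and `ω_i ≤ x_i` places the lattice inside `Λ̃_i`. -/
theorem famChain_alcoveFamily (hp : IsPermissible e x) (hx : IsExtendedAlcove x) :
    famChain (alcoveFamily 𝔽 e x) = diagChain 𝔽 x := by
  have key : ∀ i c, redMap n 𝔽 e c ∈ alcoveFamily 𝔽 e x i ↔
      coordMap n 𝔽 i c ∈ diagLattice (x i) := fun i c => by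
    rw [mem_alcoveFamily, mem_diagLattice]
    refine forall_congr' fun j => ?_
    rw [coordMap_apply, smul_upow_mem_fracIdeal_iff (hp.omega_le hx i j), redMap_apply,
      truncMk_X_pow_dvd_iff]
    have := hp.le_omega_add hx i j
    omega
  funext i
  refine le_antisymm ?_ fun y hy => ?_
  · rintro _ ⟨c, hc, rfl⟩
    exact (key i c).1 hc
  · have h1 : y ∈ stdChain n 𝔽 i := diagLattice_le_iff.2 (fun j => hp.omega_le hx i j) hy
    obtain ⟨c, rfl⟩ := mem_stdChain_iff_exists.1 h1
    exact coordMap_mem_famChain.2 ((key i c).2 hy)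

/-- Isotropy holds because the exponents of partner coordinates add up to `e`; the dimension is the
sum of the exponents. -/
theorem isCompFamily_alcoveFamily (hp : IsPermissible e x) (hx : IsExtendedAlcove x)
    (hn : 0 < n) : IsCompFamily (alcoveFamily 𝔽 e x) where
  step i z hz j := by
    obtain ⟨k, hk⟩ := hx.step i
    have h1 : x (i + 1) j ≤ x i j := by
      have h2 : (0 : ℤ) ≤ (Pi.single k 1 : Fin (2 * n) → ℤ) j :=
        (Pi.single_nonneg.2 zero_le_one : (0 : Fin (2 * n) → ℤ) ≤ Pi.single k 1) j
      rw [← hk] at h2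
      exact sub_nonneg.1 h2
    have h2 := mul_dvd_mul_left
      (truncMk 𝔽 e PowerSeries.X ^ (omega n i j - omega n (i + 1) j).toNat) (hz j)
    rw [← pow_add] at h2
    refine (pow_dvd_pow _ ?_).trans h2
    have := hp.omega_le hx i j
    have := omega_anti i j
    omega
  periodic i := by
    ext z
    have h1 : ∀ j, x ((2 * n : ℕ) + i) j - omega n ((2 * n : ℕ) + i) j =
        x i j - omega n i j := fun j => by
      rw [add_comm, hx.periodic, add_comm, omega_add]
      ring
    simp only [mem_alcoveFamily, h1]
  pairing i z hz w hw := by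
    rw [symp_eq_sum]
    refine Finset.sum_eq_zero fun j _ => ?_
    obtain ⟨a, ha⟩ := hz j
    obtain ⟨b, hb⟩ := hw (Fin.rev j)
    have h1 : e = (x i j - omega n i j).toNat +
        (x (-i) (Fin.rev j) - omega n (-i) (Fin.rev j)).toNat := by
      have h2 := hp.omega_le hx i j
      have h3 := hp.omega_le hx (-i) (Fin.rev j)
      have h4 := omega_neg i j (Fin.rev j) (by rw [Fin.val_rev]; omega)
      have h5 := hp.add_rev hx hn i j
      omega
    have h2 : truncMk 𝔽 e PowerSeries.X ^ (x i j - omega n i j).toNat * truncMk 𝔽 e PowerSeries.X ^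
        (x (-i) (Fin.rev j) - omega n (-i) (Fin.rev j)).toNat = 0 := by
      rw [← pow_add, ← h1, truncMk_X_pow]
    rw [ha, hb]
    linear_combination (jsign n (TruncRing 𝔽 e) j * a * b) * h2
  finrank i := by
    rw [← finrank_quotient_comap_redMap, ← comap_coordMap_famChain, famChain_alcoveFamily hp hx]
    change Module.finrank 𝔽 ((Fin (2 * n) → 𝔽⟦X⟧) ⧸ (diagLattice (x i)).comap (coordMap n 𝔽 i)) = _
    rw [finrank_quotient_comap_diagLattice (hp.omega_le hx i), ← Nat.cast_inj (R := ℤ),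
      Nat.cast_sum, Finset.sum_congr rfl fun j _ =>
        Int.toNat_of_nonneg (sub_nonneg.2 (hp.omega_le hx i j)), Finset.sum_sub_distrib,
      sum_omega hn, hp.sum_eq hx hn]
    push_cast
    ring

end PermissibleFamilies

end SymplecticLocalModel

namespace SymplecticLocalModel


/-! ### Realizing the Iwahori action by chain automorphisms. -/

section Automorphisms

variable {p : ℕ} [Fact p.Prime] {F : Type*} [Field F] [NumberField F]
  {𝔽 : Type*} [Field 𝔽] [Algebra ℤ_[p] 𝔽] {D : LocalDatum p F} {n : ℕ}
  {Φ : OF p F 𝔽 ≃ₐ[𝔽] (Emb 𝔽 D → TruncRing 𝔽 D.e)}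

theorem coordEquiv_ext {i : ℤ} {x y : LamF 𝔽 D n i}
    (h : ∀ σ, coordEquiv n Φ i x σ = coordEquiv n Φ i y σ) : x = y :=
  (coordEquiv n Φ i).injective (funext h)

/-- Automorphisms of the factors `(𝔽[u]/u^e)^{2n}` induce an automorphism of `Λ_{i,𝔽}`. -/
theorem exists_linearEquiv_of_components (i : ℤ)
    (ψ : Emb 𝔽 D →
      (Fin (2 * n) → TruncRing 𝔽 D.e) ≃ₗ[TruncRing 𝔽 D.e] (Fin (2 * n) → TruncRing 𝔽 D.e)) :
    ∃ φ : LamF 𝔽 D n i ≃ₗ[OF p F 𝔽] LamF 𝔽 D n i, ∀ x σ,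
      coordEquiv n Φ i (φ x) σ = ψ σ (coordEquiv n Φ i x σ) := by
  refine ⟨{ toFun := fun x => (coordEquiv n Φ i).symm fun σ => ψ σ (coordEquiv n Φ i x σ)
            invFun := fun x => (coordEquiv n Φ i).symm fun σ => (ψ σ).symm (coordEquiv n Φ i x σ)
            map_add' := fun x y => coordEquiv_ext (Φ := Φ) fun σ => ?_
            map_smul' := fun a x => coordEquiv_ext (Φ := Φ) fun σ => ?_
            left_inv := fun x => coordEquiv_ext (Φ := Φ) fun σ => ?_
            right_inv := fun x => coordEquiv_ext (Φ := Φ) fun σ => ?_ }, fun x σ => ?_⟩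
  · simp only [map_add, Pi.add_apply, LinearEquiv.apply_symm_apply]
  · rw [RingHom.id_apply, coordEquiv_smul, LinearEquiv.apply_symm_apply,
      LinearEquiv.apply_symm_apply, coordEquiv_smul, map_smul]
  · rw [LinearEquiv.apply_symm_apply, LinearEquiv.apply_symm_apply, LinearEquiv.symm_apply_apply]
  · rw [LinearEquiv.apply_symm_apply, LinearEquiv.apply_symm_apply, LinearEquiv.apply_symm_apply]
  · exact congrFun ((coordEquiv n Φ i).apply_symm_apply _) σ

/-- The isometries of `exists_localAut` for the various `σ` are assembled through `coordEquiv`; the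
images of the components again satisfy `IsCompFamily` and so define `t'`. -/
theorem exists_mem_autOrbit [CharP 𝔽 p] [IsAlgClosed 𝔽] (hp : p ≠ 2) (hn : 0 < n)
    (hΦ : IsCanonicalDecomp D Φ) (t : MLoc 𝔽 D n) {g : Emb 𝔽 D → GSp n 𝔽⸨X⸩}
    (hg : ∀ σ, g σ ∈ Iwahori n 𝔽) :
    ∃ t' ∈ autOrbit t, ∀ σ, chainOf Φ t' σ = g σ • chainOf Φ t σ := by
  have : Infinite 𝔽 := IsAlgClosed.instInfinite
  choose ψ h1 h2 h3 h4 using fun σ => exists_localAut p hp (e_ne_zero D) hn (hg σ)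
  choose φ hφ using fun i => exists_linearEquiv_of_components (Φ := Φ) i fun σ => ψ σ i
  have hC := fun σ => isCompFamily_component hΦ t σ
  have hmem : ∀ σ i z, ψ σ i z ∈ (component Φ t σ i).map (ψ σ i).toLinearMap ↔
      z ∈ component Φ t σ i := fun σ i z =>
    ⟨fun ⟨_, hw, h⟩ => (ψ σ i).injective h ▸ hw, fun h => ⟨z, h, rfl⟩⟩
  have hC' : ∀ σ, IsCompFamily fun i => (component Φ t σ i).map (ψ σ i).toLinearMap := fun σ =>
    { step := by
        rintro i _ ⟨z, hz, rfl⟩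
        exact ⟨_, (hC σ).step i z hz, h1 σ i z⟩
      periodic := fun i => by
        have h : ψ σ ((2 * n : ℕ) + i) = ψ σ i := LinearEquiv.ext (h2 σ i)
        simp only [h, (hC σ).periodic]
      pairing := by
        rintro i _ ⟨z, hz, rfl⟩ _ ⟨w, hw, rfl⟩
        exact (h3 σ i z w).trans ((hC σ).pairing i z hz w hw)
      finrank := fun i => by
        rw [← (hC σ).finrank i]
        exact (finrank_quotient_eq_of_equiv (ψ σ i) fun z => (hmem σ i z).symm).symm }
  obtain ⟨t', ht'⟩ := exists_MLoc_of_isCompFamily hΦ hC'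
  refine ⟨t', ⟨φ, ⟨fun i x => ?_, fun i x => ?_, fun i x y => ?_⟩, fun i => ?_⟩, fun σ => ?_⟩
  · refine coordEquiv_ext (Φ := Φ) fun σ => ?_
    rw [hΦ.coordEquiv_rhoF, hφ, hφ, hΦ.coordEquiv_rhoF, h1]
  · refine coordEquiv_ext (Φ := Φ) fun σ => ?_
    rw [coordEquiv_thetaF, hφ, hφ, coordEquiv_thetaF, h2]
  · rw [pairingF_eq Φ, pairingF_eq Φ]
    simp only [hφ, h3]
  · ext y
    obtain ⟨x, rfl⟩ := (φ i).surjective y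
    rw [(φ i).injective.mem_set_image, SetLike.mem_coe, SetLike.mem_coe, mem_t_iff (Φ := Φ),
      mem_t_iff (Φ := Φ)]
    simp only [ht', hφ, hmem]
  · rw [chainOf_eq_famChain, chainOf_eq_famChain]
    refine h4 σ _ _ fun i z => ?_
    rw [ht', hmem]

end Automorphisms

end SymplecticLocalModel

namespace SymplecticLocalModel


/-! ### Invariance of the relative position under chain automorphisms. -/

section RelativePosition

variable {p : ℕ} [Fact p.Prime] {F : Type*} [Field F] [NumberField F]
  {𝔽 : Type*} [Field 𝔽] [Algebra ℤ_[p] 𝔽] {D : LocalDatum p F} {n : ℕ}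

/-- The elements of the image of the `m`-fold transition map `Λ_{i-m,𝔽} → Λ_{i,𝔽}`. -/
inductive IsImg : ℕ → ∀ i : ℤ, LamF 𝔽 D n i → Prop
  | zero (i : ℤ) (x : LamF 𝔽 D n i) : IsImg 0 i x
  | succ (m : ℕ) (i : ℤ) (x : LamF 𝔽 D n i) : IsImg m i x → IsImg (m + 1) (i + 1) (rhoF D n i x)

theorem IsImg.map {φ : ∀ i : ℤ, LamF 𝔽 D n i ≃ₗ[OF p F 𝔽] LamF 𝔽 D n i} (hφ : φ ∈ AutL 𝔽 D n)
    {m : ℕ} {i : ℤ} {x : LamF 𝔽 D n i} (h : IsImg m i x) : IsImg m i (φ i x) := by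
  induction h with
  | zero i x => exact .zero i _
  | succ m i x _ ih =>
    rw [← hφ.1]
    exact .succ m i _ ih

variable {Φ : OF p F 𝔽 ≃ₐ[𝔽] (Emb 𝔽 D → TruncRing 𝔽 D.e)}

/-- In coordinates the transition maps are reductions of the inclusions of standard lattices, so
their images are the reductions of `Λ̃_{i-m}`. -/
theorem isImg_iff (hΦ : IsCanonicalDecomp D Φ) {m : ℕ} {i : ℤ} {x : LamF 𝔽 D n i} :
    IsImg m i x ↔ ∀ σ, ∃ c, redMap n 𝔽 D.e c = coordEquiv n Φ i x σ ∧
      coordMap n 𝔽 i c ∈ stdChain n 𝔽 (i - m) := by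
  constructor
  · intro h
    induction h with
    | zero i x =>
      intro σ
      obtain ⟨c, hc⟩ := redMap_surjective (coordEquiv n Φ i x σ)
      refine ⟨c, hc, ?_⟩
      rw [Nat.cast_zero, sub_zero]
      exact coordMap_mem_stdChain i c
    | succ m i x _ ih =>
      intro σ
      obtain ⟨c, hc, hc'⟩ := ih σ
      refine ⟨stepMap PowerSeries.X i c, ?_, ?_⟩
      · rw [redMap_stepMap, hc, hΦ.coordEquiv_rhoF]
      · rwa [coordMap_stepMap, Nat.cast_succ, add_sub_add_right_eq_sub]
  · induction m generalizing i with
    | zero => exact fun _ => .zero i x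
    | succ m ih =>
      intro h
      obtain ⟨k, rfl⟩ : ∃ k, i = k + 1 := ⟨i - 1, by ring⟩
      choose c hc hc' using h
      have h1 : ∀ σ, ∃ d, coordMap n 𝔽 k d = coordMap n 𝔽 (k + 1) (c σ) := fun σ => by
        rw [← mem_stdChain_iff_exists]
        refine isDualChain_stdChain.monotone ?_ (hc' σ)
        push_cast
        omega
      choose d hd using h1
      have h2 : ∀ σ, stepMap PowerSeries.X k (d σ) = c σ := fun σ => by
        apply coordMap_injective (k + 1)
        rw [coordMap_stepMap, hd]
      have h3 : rhoF D n k ((coordEquiv n Φ k).symm fun σ => redMap n 𝔽 D.e (d σ)) = x := by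
        apply (coordEquiv n Φ (k + 1)).injective
        funext σ
        rw [hΦ.coordEquiv_rhoF, LinearEquiv.apply_symm_apply, ← redMap_stepMap, h2, hc]
      rw [← h3]
      refine .succ m k _ (ih fun σ => ⟨d σ, ?_, ?_⟩)
      · rw [LinearEquiv.apply_symm_apply]
      · rw [hd]
        convert hc' σ using 2
        push_cast
        ring

-- The right side involves only `t_i`, the images of the transition maps and the idempotent of `σ`,
-- all of which a chain automorphism respects.
open scoped Classical in
theorem stdChain_le_chainOf_sup_iff (hΦ : IsCanonicalDecomp D Φ) (t : MLoc 𝔽 D n) (σ : Emb 𝔽 D)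
    (i : ℤ) (m : ℕ) :
    stdChain n 𝔽 (i - m) ≤ chainOf Φ t σ i ⊔ stdChain n 𝔽 (i - (m + 1 : ℕ)) ↔
      ∀ x : LamF 𝔽 D n i, IsImg m i x → ∃ y ∈ t.t i, ∃ w, IsImg (m + 1) i w ∧
        Φ.symm (Pi.single σ 1) • x = y + w := by
  have himg : ∀ k (c : Fin (2 * n) → 𝔽⟦X⟧), coordMap n 𝔽 i c ∈ stdChain n 𝔽 (i - (k : ℕ)) →
      IsImg k i ((coordEquiv n Φ i).symm (Pi.single σ (redMap n 𝔽 D.e c))) := fun k c h => by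
    rw [isImg_iff hΦ]
    intro τ
    rw [LinearEquiv.apply_symm_apply]
    rcases eq_or_ne τ σ with rfl | hτ
    · refine ⟨c, ?_, h⟩
      rw [Pi.single_eq_same]
    · refine ⟨0, ?_, ?_⟩
      · rw [Pi.single_eq_of_ne hτ, map_zero]
      · rw [map_zero]
        exact zero_mem _
  rw [chainOf_eq_famChain]
  constructor
  · intro h x hx
    obtain ⟨c, hc, hc'⟩ := (isImg_iff hΦ).1 hx σ
    obtain ⟨_, ⟨c₁, hc₁, rfl⟩, s, hs, hsum⟩ := Submodule.mem_sup.1 (h hc')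
    obtain rfl : coordMap n 𝔽 i (c - c₁) = s := by rw [map_sub, ← hsum, add_sub_cancel_left]
    refine ⟨(coordEquiv n Φ i).symm (Pi.single σ (redMap n 𝔽 D.e c₁)), ?_, _, himg _ _ hs, ?_⟩
    · rw [← mem_compOf, ← component_eq_compOf]
      exact hc₁
    · rw [single_smul_coordEquiv_symm, ← map_add, ← Pi.single_add, ← map_add, add_sub_cancel, hc]
  · intro h v hv
    obtain ⟨c, rfl⟩ := mem_stdChain_iff_exists.1
      (isDualChain_stdChain.monotone (by omega : i - (m : ℤ) ≤ i) hv)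
    obtain ⟨y, hy, w, hw, hsum⟩ := h _ (himg m c hv)
    obtain ⟨d, hd, hd'⟩ := (isImg_iff hΦ).1 hw σ
    have h1 := congrFun (congrArg (coordEquiv n Φ i) hsum) σ
    rw [coordEquiv_smul, LinearEquiv.apply_symm_apply, AlgEquiv.apply_symm_apply,
      Pi.single_eq_same, Pi.single_eq_same, one_smul, map_add, Pi.add_apply, ← hd,
      ← sub_eq_iff_eq_add, ← map_sub] at h1
    refine Submodule.mem_sup.2 ⟨coordMap n 𝔽 i (c - d), ?_, coordMap n 𝔽 i d, hd', ?_⟩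
    · rw [coordMap_mem_famChain, h1, component_eq_compOf]
      exact coordEquiv_mem_compOf Φ hy σ
    · rw [← map_add, sub_add_cancel]

theorem stdChain_le_chainOf_sup_of_mem_autOrbit (hn : 0 < n) (hΦ : IsCanonicalDecomp D Φ)
    {t t' : MLoc 𝔽 D n} (ht : t' ∈ autOrbit t) (σ : Emb 𝔽 D) (i j : ℤ)
    (h : stdChain n 𝔽 (j + 1) ≤ chainOf Φ t σ i ⊔ stdChain n 𝔽 j) :
    stdChain n 𝔽 (j + 1) ≤ chainOf Φ t' σ i ⊔ stdChain n 𝔽 j := by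
  classical
  -- For `i ≤ j` one has `L_i ⊆ Λ̃_i ⊆ Λ̃_j`, and the inclusion cannot hold.
  rcases le_or_gt i j with hij | hij
  · exfalso
    obtain ⟨w, hw, hw'⟩ := exists_mem_stdChain_notMem (𝔽 := 𝔽) hn (j + 1)
    rw [add_sub_cancel_right] at hw'
    refine hw' (sup_le (le_trans ?_ (isDualChain_stdChain.monotone hij)) le_rfl (h hw))
    rw [chainOf_eq_famChain]
    exact famChain_le i
  · obtain ⟨m, hm⟩ := Int.eq_ofNat_of_zero_le (by omega : 0 ≤ i - j - 1)
    obtain rfl : j = i - (m + 1 : ℕ) := by push_cast; omega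
    have h1 : i - ((m + 1 : ℕ) : ℤ) + 1 = i - m := by push_cast; ring
    rw [h1, stdChain_le_chainOf_sup_iff hΦ] at h ⊢
    obtain ⟨φ, hφ, hφt⟩ := ht
    intro x hx
    obtain ⟨y, hy, w, hw, hsum⟩ := h _ (hx.map (inv_mem hφ))
    refine ⟨φ i y, ?_, φ i w, hw.map hφ, ?_⟩
    · rw [← SetLike.mem_coe, ← hφt]
      exact ⟨y, hy, rfl⟩
    · rw [← map_add, ← hsum, map_smul]
      congr 1
      exact ((φ i).apply_symm_apply x).symm

end RelativePosition

end SymplecticLocalModel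

namespace SymplecticLocalModel


/-! ### Disjointness of the double cosets. -/

section AlcoveCosets

variable {n : ℕ} {𝔽 : Type*} [Field 𝔽]

theorem exists_flag_eq_smul (g : GSp n 𝔽⸨X⸩) (y : GSp n 𝔽⸨X⸩ ⧸ Iwahori n 𝔽) :
    ∃ y' : GSp n 𝔽⸨X⸩ ⧸ Iwahori n 𝔽, flag y' = g • flag y := by
  obtain ⟨h, rfl⟩ := QuotientGroup.mk_surjective y
  exact ⟨QuotientGroup.mk (g * h), mul_smul g h (stdChain n 𝔽)⟩

/-- The uniqueness half of the Bruhat decomposition: elements of one double coset have the same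
relative position to the standard chain, hence the same alcove. -/
theorem toDouble_weylCoset_injective (hn : 0 < n) :
    Function.Injective fun w : ExtWeyl n 𝔽 => toDouble (weylCoset w) := fun w w' h => by
  obtain ⟨g, hg, hgw⟩ := mem_orbit_Iwahori_iff.1 (toDouble_eq_iff.1 h)
  obtain ⟨x, ⟨-, hx⟩, -⟩ := existsUnique_alcove hn w
  obtain ⟨x', ⟨-, hx'⟩, -⟩ := existsUnique_alcove hn w'
  rw [hx.flag_eq, hx'.flag_eq] at hgw
  obtain rfl : x = x' := alcove_eq_of_relPos (one_mem _) hg fun i j => by rw [one_smul, hgw]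
  exact hasAlcove_injective hx hx'

end AlcoveCosets

/-! ### The map `α̃` and its orbits. -/

section AlphaTilde

variable {p : ℕ} [Fact p.Prime] {F : Type*} [Field F] [NumberField F]
  {𝔽 : Type*} [Field 𝔽] [Algebra ℤ_[p] 𝔽] [CharP 𝔽 p] [IsAlgClosed 𝔽] {D : LocalDatum p F} {n : ℕ}
  {Φ : OF p F 𝔽 ≃ₐ[𝔽] (Emb 𝔽 D → TruncRing 𝔽 D.e)}

theorem exists_alcove_chainOf (hn : 0 < n) (hΦ : IsCanonicalDecomp D Φ) (t : MLoc 𝔽 D n)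
    (σ : Emb 𝔽 D) : ∃ g ∈ Iwahori n 𝔽, ∃ x, IsExtendedAlcove x ∧ IsPermissible D.e x ∧
      chainOf Φ t σ = g • diagChain 𝔽 x := by
  have : Infinite 𝔽 := IsAlgClosed.instInfinite
  rw [chainOf_eq_famChain]
  exact (isCompFamily_component hΦ t σ).exists_alcove (e_ne_zero D) hn

/-- The chain is a translate of an alcove chain, and every extended alcove comes from `W̃`; so it
lies in the range of `flag`. -/
theorem flag_alphaTilde (hn : 0 < n) (hΦ : IsCanonicalDecomp D Φ) (t : MLoc 𝔽 D n)
    (σ : Emb 𝔽 D) : flag (alphaTilde Φ t σ) = chainOf Φ t σ := by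
  obtain ⟨g, -, x, hx, -, h⟩ := exists_alcove_chainOf hn hΦ t σ
  obtain ⟨w, hw⟩ := exists_hasAlcove (𝔽 := 𝔽) hx
  obtain ⟨y, hy⟩ := exists_flag_eq_smul g (weylCoset w)
  exact Function.invFun_eq ⟨y, by rw [hy, hw.flag_eq, h]⟩

theorem alphaTilde_injective (hn : 0 < n) (hΦ : IsCanonicalDecomp D Φ) :
    Function.Injective (alphaTilde (n := n) Φ) := fun t t' h =>
  MLoc.eq_of_chainOf (Φ := Φ) fun σ => by
    rw [← flag_alphaTilde hn hΦ, ← flag_alphaTilde hn hΦ, h]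

/-- Equal relative positions give both chains the same alcove, each through an element of `I`; the
quotient of the two elements carries one chain to the other. -/
theorem alphaTilde_mem_orbit (hn : 0 < n) (hΦ : IsCanonicalDecomp D Φ) {t t' : MLoc 𝔽 D n}
    (ht : t' ∈ autOrbit t) (σ : Emb 𝔽 D) :
    alphaTilde Φ t' σ ∈ MulAction.orbit (Iwahori n 𝔽) (alphaTilde Φ t σ) := by
  rw [mem_orbit_Iwahori_iff, flag_alphaTilde hn hΦ, flag_alphaTilde hn hΦ]
  obtain ⟨g, hg, x, -, -, h⟩ := exists_alcove_chainOf hn hΦ t σ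
  obtain ⟨g', hg', x', -, -, h'⟩ := exists_alcove_chainOf hn hΦ t' σ
  obtain rfl : x = x' := alcove_eq_of_relPos hg hg' fun i j => by
    rw [← h, ← h']
    exact ⟨stdChain_le_chainOf_sup_of_mem_autOrbit hn hΦ ht σ i j,
      stdChain_le_chainOf_sup_of_mem_autOrbit hn hΦ ((autSetoid 𝔽 D n).symm ht) σ i j⟩
  exact ⟨g' * g⁻¹, mul_mem hg' (inv_mem hg), by rw [h, h', mul_smul, inv_smul_smul]⟩

theorem bijOn_alphaTilde (hp : p ≠ 2) (hn : 0 < n) (hΦ : IsCanonicalDecomp D Φ)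
    (t : MLoc 𝔽 D n) : Set.BijOn (alphaTilde Φ) (autOrbit t)
      (Set.univ.pi fun σ => MulAction.orbit (Iwahori n 𝔽) (alphaTilde Φ t σ)) := by
  refine ⟨fun t' ht' σ _ => alphaTilde_mem_orbit hn hΦ ht' σ,
    (alphaTilde_injective hn hΦ).injOn, fun y hy => ?_⟩
  choose g hg hgy using fun σ => mem_orbit_Iwahori_iff.1 (hy σ (Set.mem_univ σ))
  obtain ⟨t', ht', h⟩ := exists_mem_autOrbit hp hn hΦ t hg
  refine ⟨t', ht', funext fun σ => flag_injective ?_⟩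
  rw [flag_alphaTilde hn hΦ, h, hgy, flag_alphaTilde hn hΦ]

theorem exists_alphaTilde_eq_weylCoset (hn : 0 < n) (hΦ : IsCanonicalDecomp D Φ)
    {w : Emb 𝔽 D → ExtWeyl n 𝔽} (hw : ∀ σ, w σ ∈ Perm n 𝔽 D.e) :
    ∃ t : MLoc 𝔽 D n, ∀ σ, alphaTilde Φ t σ = weylCoset (w σ) := by
  have : Infinite 𝔽 := IsAlgClosed.instInfinite
  choose x hx hperm hwx using hw
  obtain ⟨t, ht⟩ := exists_MLoc_of_isCompFamily hΦ fun σ =>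
    isCompFamily_alcoveFamily (𝔽 := 𝔽) (hperm σ) (hx σ) hn
  refine ⟨t, fun σ => flag_injective ?_⟩
  rw [flag_alphaTilde hn hΦ, chainOf_eq_famChain, ht, famChain_alcoveFamily (hperm σ) (hx σ),
    (hwx σ).flag_eq]

theorem exists_toDouble_weylCoset_eq (hn : 0 < n) (hΦ : IsCanonicalDecomp D Φ)
    (t : MLoc 𝔽 D n) (σ : Emb 𝔽 D) :
    ∃ w ∈ Perm n 𝔽 D.e, toDouble (weylCoset w) = toDouble (alphaTilde Φ t σ) := by
  obtain ⟨g, hg, x, hx, hperm, h⟩ := exists_alcove_chainOf hn hΦ t σ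
  obtain ⟨w, hw⟩ := exists_hasAlcove (𝔽 := 𝔽) hx
  refine ⟨w, ⟨x, hx, hperm, hw⟩, ?_⟩
  rw [toDouble_eq_iff, mem_orbit_Iwahori_iff, hw.flag_eq, flag_alphaTilde hn hΦ, h]
  exact ⟨g⁻¹, inv_mem hg, (inv_smul_smul g _).symm⟩

end AlphaTilde

end SymplecticLocalModel

open SymplecticLocalModel in
theorem mainTheorem4 (p : ℕ) [Fact p.Prime] (hp : p ≠ 2)
    (𝔽 : Type*) [Field 𝔽] [Algebra (ZMod p) 𝔽] [IsAlgClosure (ZMod p) 𝔽] [Algebra ℤ_[p] 𝔽]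
    (F : Type*) [Field F] [NumberField F] [NumberField.IsTotallyReal F]
    (n : ℕ) (hn : 1 ≤ n) (D : LocalDatum p F) :
    -- the canonical decomposition of `𝒪_F ⊗ 𝔽`
    (∃! Φ : OF p F 𝔽 ≃ₐ[𝔽] (Emb 𝔽 D → TruncRing 𝔽 D.e), IsCanonicalDecomp D Φ) ∧
    -- `W̃` is identified with the set of extended alcoves
    ((∀ w : ExtWeyl n 𝔽, ∃! x, IsExtendedAlcove x ∧ HasAlcove w x) ∧
      ∀ x, IsExtendedAlcove x → ∃! w : ExtWeyl n 𝔽, HasAlcove w x) ∧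
    ∀ Φ : OF p F 𝔽 ≃ₐ[𝔽] (Emb 𝔽 D → TruncRing 𝔽 D.e), IsCanonicalDecomp D Φ →
      -- `α̃` is well defined: every chain `(α_i⁻¹(t_{i,σ}))_i` comes from a (unique) coset
      (∀ (t : MLoc 𝔽 D n) (σ : Emb 𝔽 D), flag (alphaTilde Φ t σ) = chainOf Φ t σ) ∧
      -- `α̃` maps each orbit bijectively onto a product of orbits
      (∀ t : MLoc 𝔽 D n, Set.BijOn (alphaTilde Φ) (autOrbit t)
        (Set.univ.pi fun σ => MulAction.orbit (Iwahori n 𝔽) (alphaTilde Φ t σ))) ∧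
      -- the induced embedding of the orbit set, and its image
      ∃ ι : Quotient (autSetoid 𝔽 D n) → (Emb 𝔽 D → DoubleCosets n 𝔽),
        (∀ t : MLoc 𝔽 D n, ι (Quotient.mk _ t) = fun σ => toDouble (alphaTilde Φ t σ)) ∧
        Function.Injective ι ∧
        Set.BijOn (fun (x : Emb 𝔽 D → ExtWeyl n 𝔽) σ => toDouble (weylCoset (x σ)))
          (Set.univ.pi fun _ => Perm n 𝔽 D.e) (Set.range ι) := by
  have : CharP 𝔽 p := charP_of_injective_algebraMap (algebraMap (ZMod p) 𝔽).injective p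
  have : IsAlgClosed 𝔽 := IsAlgClosure.isAlgClosed (ZMod p)
  refine ⟨existsUnique_decomp, ⟨fun w => existsUnique_alcove hn w, fun x hx => ?_⟩,
    fun Φ hΦ => ⟨flag_alphaTilde hn hΦ, bijOn_alphaTilde hp hn hΦ, ?_⟩⟩
  · obtain ⟨w, hw⟩ := exists_hasAlcove (𝔽 := 𝔽) hx
    exact ⟨w, hw, fun w' hw' => hasAlcove_injective hw' hw⟩
  refine ⟨Quotient.lift (fun t σ => toDouble (alphaTilde Φ t σ)) fun t t' h => funext fun σ =>
    (toDouble_eq_iff.2 (alphaTilde_mem_orbit hn hΦ h σ)).symm, fun _ => rfl, ?_, ?_, ?_, ?_⟩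
  · rintro ⟨t⟩ ⟨t'⟩ h
    -- Equal double cosets put `α̃(t)` in the product of orbits through `α̃(t')`, which is filled by
    -- the orbit of `t'`; injectivity of `α̃` then places `t` in that orbit.
    obtain ⟨t'', ht'', h'⟩ := (bijOn_alphaTilde hp hn hΦ t').surjOn
      (fun σ _ => toDouble_eq_iff.1 (congrFun h σ) : alphaTilde Φ t ∈ _)
    rw [alphaTilde_injective hn hΦ h'] at ht''
    exact (Quotient.sound ht'').symm
  · intro w hw
    obtain ⟨t, ht⟩ := exists_alphaTilde_eq_weylCoset hn hΦ fun σ => hw σ (Set.mem_univ σ)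
    exact ⟨Quotient.mk _ t, funext fun σ => congrArg toDouble (ht σ)⟩
  · exact fun w _ w' _ h => funext fun σ => toDouble_weylCoset_injective hn (congrFun h σ)
  · rintro _ ⟨⟨t⟩, rfl⟩
    choose w hw h using exists_toDouble_weylCoset_eq hn hΦ t
    exact ⟨w, fun σ _ => hw σ, funext h⟩
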